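/- Write $\mathrm{Lip}(\mathbb R^n)\cap BUC(\mathbb R^n)$ for the bounded Lipschitz functions on $\mathbb R^n$. For a Hamiltonian $G:\mathbb R^n\times\mathbb R^n\times\mathbb R\to\mathbb R$ and $w_0:\mathbb R^n\to\mathbb R$, a function $w:\mathbb R^n\times[0,\infty)\to\mathbb R$ is a viscosity subsolution (supersolution) of $$w_s+G(x,Dw,w)=0\ \text{ in }\mathbb R^n\times(0,\infty),\qquad w(\cdot,0)=w_0,$$ if $w(\cdot,0)\le w_0$ ($\ge w_0$) and, whenever $\phi\in C^1(\mathbb R^n\times(0,\infty))$, $w(x_0,s_0)=\phi(x_0,s_0)$ and $w-\phi$ attains a strict maximum (minimum) over $\mathbb R^n\times(0,\infty)$ at $(x_0,s_0)$, one has $\phi_s(x_0,s_0)+G(x_0,D\phi(x_0,s_0),\phi(x_0,s_0))\le 0$ ($\ge 0$). It is a viscosity solution if it is both. Let $H,F:\mathbb R^n\times\mathbb R^n\times\mathbb R\to\mathbb R$, $(x,p,u)\mapsto H(x,p,u),F(x,p,u)$, be $C^1$. Assume that each $G\in\{H,F\}$ satisfies: (H1) for every $R>0$ there is $K_R>0$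 with $|G(x,p,u)|\le K_R$ and $|D_pG(x,p,u)|\le K_R(1+|x|)$ for all $(x,p,u)\in\mathbb R^n\times B(0,R)\times\mathbb R$; (H2) $\lim_{|p|\to\infty}\inf_{x\in\mathbb R^n,\,u\in\mathbb R}G(x,p,u)/|p|=+\infty$; (H4) there is $C>0$ with $|\partial_uG|\le C$ everywhere; and that the pair satisfies, at every $(x,p,u)$, (H5) $D_xH\cdot D_pF-D_pH\cdot D_xF+(p\cdot D_pF)\,\partial_uH-(p\cdot D_pH)\,\partial_uF+H\,\partial_uF-F\,\partial_uH=0.$ Let $u_0\in\mathrm{Lip}(\mathbb R^n)\cap BUC(\mathbb R^n)$. For every $\lambda\ge0$ let $v(\cdot,\cdot,\lambda):\mathbb R^n\times[0,\infty)\to\mathbb R$ be the viscosity solution, Lipschitz on $\mathbb R^n\times[0,T]$ for every $T>0$, of $$w_t+H(x,Dw,w)+\lambda F(x,Dw,w)=0\ \text{ in }\mathbb R^n\times(0,\infty),\qquad w(\cdot,0)=u_0.$$ (i) If $p\mapsto F(x,p,u)$ is convex for all $(x,u)$, then for every $t\ge0$ the function $(x,\lambda)\mapsto v(x,t,\lambda)$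 is a viscosity subsolution of $$\partial_\lambda\xi+tF(x,D\xi,\xi)=0\ \text{ in }\mathbb R^n\times(0,\infty),\qquad \xi(x,0)=v(x,t,0)\ \text{ in }\mathbb R^n.\tag{1}$$ (ii) If $p\mapsto F(x,p,u)$ and $p\mapsto H(x,p,u)$ are both convex for all $(x,u)$, then for every $t\ge0$ the function $(x,\lambda)\mapsto v(x,t,\lambda)$ is a viscosity solution of (1). -/

import Mathlib

open scoped NNReal

namespace ContactHJ

/-- `ℝⁿ` with its Euclidean norm. -/
abbrev Rn (n : ℕ) : Type := EuclideanSpace ℝ (Fin n)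

/-- A contact Hamiltonian `(x, p, u) ↦ H x p u`. -/
abbrev Hamiltonian (n : ℕ) : Type := Rn n → Rn n → ℝ → ℝ

variable {n : ℕ}

/-- Joint continuous differentiability in `(x, p, u)`. -/
def IsC1 (H : Hamiltonian n) : Prop :=
  ContDiff ℝ 1 (fun z : Rn n × Rn n × ℝ => H z.1 z.2.1 z.2.2)

/-- The partial gradient `D_x H`. -/
noncomputable def Dx (H : Hamiltonian n) (x p : Rn n) (u : ℝ) : Rn n :=
  gradient (fun y => H y p u) x

/-- The partial gradient `D_p H`. -/
noncomputable def Dp (H : Hamiltonian n) (x p : Rn n) (u : ℝ) : Rn n :=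
  gradient (fun q => H x q u) p

/-- The partial derivative `∂H/∂u`. -/
noncomputable def Du (H : Hamiltonian n) (x p : Rn n) (u : ℝ) : ℝ :=
  deriv (fun r => H x p r) u

/-- (H1): for `p` in a ball, `H` is bounded and `D_p H` grows at most linearly in `x`. -/
def LocallyBounded (H : Hamiltonian n) : Prop :=
  ∀ R : ℝ, 0 < R → ∃ K : ℝ, 0 < K ∧ ∀ (x p : Rn n) (u : ℝ), p ∈ Metric.ball 0 R →
    |H x p u| ≤ K ∧ ‖Dp H x p u‖ ≤ K * (1 + ‖x‖)

/-- (H2): `H(x,p,u)/|p| → +∞` as `|p| → ∞`, uniformly in `(x, u)`. -/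
def Superlinear (H : Hamiltonian n) : Prop :=
  ∀ M : ℝ, ∀ᶠ p : Rn n in Bornology.cobounded (Rn n),
    ∀ (x : Rn n) (u : ℝ), M ≤ H x p u / ‖p‖

/-- (H3): convexity in the momentum variable. -/
def ConvexInP (H : Hamiltonian n) : Prop :=
  ∀ (x : Rn n) (u : ℝ), ConvexOn ℝ Set.univ (fun p => H x p u)

/-- (H4): `∂H/∂u` is bounded. -/
def LipschitzInU (H : Hamiltonian n) : Prop :=
  ∃ C : ℝ, 0 < C ∧ ∀ (x p : Rn n) (u : ℝ), |Du H x p u| ≤ C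

/-- (H5): the Jacobi bracket of `H` and `F` vanishes identically. -/
def JacobiCommute (H F : Hamiltonian n) : Prop :=
  ∀ (x p : Rn n) (u : ℝ),
    inner ℝ (Dx H x p u) (Dp F x p u) - inner ℝ (Dp H x p u) (Dx F x p u)
      + inner ℝ p (Dp F x p u) * Du H x p u - inner ℝ p (Dp H x p u) * Du F x p u
      + Du F x p u * H x p u - Du H x p u * F x p u = 0

/-- `w` is a viscosity subsolution of `w_s + H(x, Dw, w) = 0` in `ℝⁿ × (0,∞)` with initial
datum `w(·,0) = w₀`. Only the values `w x s` with `0 ≤ s` matter. -/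
def IsViscositySubsolution (H : Hamiltonian n) (w₀ : Rn n → ℝ) (w : Rn n → ℝ → ℝ) : Prop :=
  (∀ φ : Rn n × ℝ → ℝ, ContDiffOn ℝ 1 φ (Set.univ ×ˢ Set.Ioi 0) →
    ∀ (x₀ : Rn n) (s₀ : ℝ), 0 < s₀ → w x₀ s₀ = φ (x₀, s₀) →
      (∀ (x : Rn n) (s : ℝ), 0 < s → (x, s) ≠ (x₀, s₀) →
        w x s - φ (x, s) < w x₀ s₀ - φ (x₀, s₀)) →
      deriv (fun s => φ (x₀, s)) s₀
        + H x₀ (gradient (fun x => φ (x, s₀)) x₀) (φ (x₀, s₀)) ≤ 0) ∧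
  ∀ x : Rn n, w x 0 ≤ w₀ x

/-- `w` is a viscosity supersolution of `w_s + H(x, Dw, w) = 0` in `ℝⁿ × (0,∞)` with initial
datum `w(·,0) = w₀`. Only the values `w x s` with `0 ≤ s` matter. -/
def IsViscositySupersolution (H : Hamiltonian n) (w₀ : Rn n → ℝ) (w : Rn n → ℝ → ℝ) : Prop :=
  (∀ φ : Rn n × ℝ → ℝ, ContDiffOn ℝ 1 φ (Set.univ ×ˢ Set.Ioi 0) →
    ∀ (x₀ : Rn n) (s₀ : ℝ), 0 < s₀ → w x₀ s₀ = φ (x₀, s₀) →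
      (∀ (x : Rn n) (s : ℝ), 0 < s → (x, s) ≠ (x₀, s₀) →
        w x₀ s₀ - φ (x₀, s₀) < w x s - φ (x, s)) →
      0 ≤ deriv (fun s => φ (x₀, s)) s₀
        + H x₀ (gradient (fun x => φ (x, s₀)) x₀) (φ (x₀, s₀))) ∧
  ∀ x : Rn n, w₀ x ≤ w x 0

/-- A viscosity solution is both a subsolution and a supersolution. -/
def IsViscositySolution (H : Hamiltonian n) (w₀ : Rn n → ℝ) (w : Rn n → ℝ → ℝ) : Prop :=
  IsViscositySubsolution H w₀ w ∧ IsViscositySupersolution H w₀ w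

/-- `w` is Lipschitz in `(x, s)` on `ℝⁿ × [0,T]` for every finite `T`. -/
def IsLipschitzOnStrips (w : Rn n → ℝ → ℝ) : Prop :=
  ∀ T : ℝ, 0 < T → ∃ K : ℝ≥0,
    LipschitzOnWith K (fun z : Rn n × ℝ => w z.1 z.2) (Set.univ ×ˢ Set.Icc 0 T)

/-- `u₀ ∈ Lip(ℝⁿ) ∩ BUC(ℝⁿ)`. -/
def IsLipBUC (u₀ : Rn n → ℝ) : Prop :=
  (∃ K : ℝ≥0, LipschitzWith K u₀) ∧ (∃ M : ℝ, ∀ x, |u₀ x| ≤ M) ∧ UniformContinuous u₀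

end ContactHJ

namespace ContactHJ

open Filter Topology Set

section Jets

variable {V : Type*} [NormedAddCommGroup V] [NormedSpace ℝ V]

/-- `ℓ` is a first-order superjet of `w` at `z`: `w` lies below the affine function with slope `ℓ`
up to `o(|z' - z|)`. -/
def SuperJet (w : V → ℝ) (z : V) (ℓ : V →L[ℝ] ℝ) : Prop :=
  ∀ ε : ℝ, 0 < ε → ∀ᶠ z' in 𝓝 z, w z' ≤ w z + ℓ (z' - z) + ε * ‖z' - z‖

/-- `ℓ` is a first-order subjet of `w` at `z`. -/
def SubJet (w : V → ℝ) (z : V) (ℓ : V →L[ℝ] ℝ) : Prop :=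
  ∀ ε : ℝ, 0 < ε → ∀ᶠ z' in 𝓝 z, w z + ℓ (z' - z) - ε * ‖z' - z‖ ≤ w z'

theorem subJet_iff_superJet_neg {w : V → ℝ} {z : V} {ℓ : V →L[ℝ] ℝ} :
    SubJet w z ℓ ↔ SuperJet (fun z => -w z) z (-ℓ) := by
  refine forall₂_congr fun ε _ => eventually_congr (Eventually.of_forall fun z' => ?_)
  rw [neg_apply]
  constructor <;> intro h <;> linarith

theorem superJet_iff_subJet_neg {w : V → ℝ} {z : V} {ℓ : V →L[ℝ] ℝ} :
    SuperJet w z ℓ ↔ SubJet (fun z => -w z) z (-ℓ) := by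
  simp [subJet_iff_superJet_neg]

theorem _root_.HasFDerivAt.subJet {w : V → ℝ} {z : V} {ℓ : V →L[ℝ] ℝ} (h : HasFDerivAt w ℓ z) :
    SubJet w z ℓ := by
  intro ε hε
  filter_upwards [h.isLittleO.def hε] with z' hz'
  have := (abs_le.1 hz').1
  linarith

theorem _root_.HasFDerivAt.superJet {w : V → ℝ} {z : V} {ℓ : V →L[ℝ] ℝ} (h : HasFDerivAt w ℓ z) :
    SuperJet w z ℓ := by
  intro ε hε
  filter_upwards [h.isLittleO.def hε] with z' hz'
  have := (abs_le.1 hz').2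
  linarith

theorem SubJet.mono {w f : V → ℝ} {z : V} {ℓ : V →L[ℝ] ℝ} (h : SubJet f z ℓ)
    (hz : f z = w z) (hle : ∀ᶠ z' in 𝓝 z, f z' ≤ w z') : SubJet w z ℓ := by
  intro ε hε
  filter_upwards [h ε hε, hle] with z' h1 h2
  rw [← hz]; exact h1.trans h2

theorem SuperJet.mono {w f : V → ℝ} {z : V} {ℓ : V →L[ℝ] ℝ} (h : SuperJet f z ℓ)
    (hz : f z = w z) (hle : ∀ᶠ z' in 𝓝 z, w z' ≤ f z') : SuperJet w z ℓ := by
  intro ε hε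
  filter_upwards [h ε hε, hle] with z' h1 h2
  rw [← hz]; exact h2.trans h1

theorem SubJet.apply_le {w : V → ℝ} {z : V} {ℓ : V →L[ℝ] ℝ} (h : SubJet w z ℓ) (d : V) {M : ℝ}
    (hM : ∀ᶠ s : ℝ in 𝓝[>] 0, w (z + s • d) ≤ w z + s * M) : ℓ d ≤ M := by
  refine le_of_forall_pos_le_add fun ε hε => ?_
  have ht : Tendsto (fun s : ℝ => z + s • d) (𝓝[>] 0) (𝓝 z) := by
    have : Continuous fun s : ℝ => z + s • d := by fun_prop
    simpa using (this.tendsto 0).mono_left nhdsWithin_le_nhds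
  have hε' : 0 < ε / (1 + ‖d‖) := by positivity
  obtain ⟨s, h1, h2, hs⟩ := ((ht.eventually (h _ hε')).and
    (hM.and (self_mem_nhdsWithin : Ioi (0 : ℝ) ∈ 𝓝[>] 0))).exists
  have hs : 0 < s := hs
  simp only [add_sub_cancel_left, map_smul, smul_eq_mul, norm_smul, Real.norm_eq_abs,
    abs_of_pos hs] at h1
  have h3 : ε / (1 + ‖d‖) * ‖d‖ ≤ ε := by
    rw [div_mul_eq_mul_div, div_le_iff₀ (by positivity)]; nlinarith [norm_nonneg d]
  have h4 : s * ℓ d ≤ s * (M + ε) := by nlinarith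
  exact le_of_mul_le_mul_left h4 hs

theorem SuperJet.apply_le {w : V → ℝ} {z : V} {ℓ : V →L[ℝ] ℝ} (h : SuperJet w z ℓ) (d : V) {M : ℝ}
    (hM : ∀ᶠ s : ℝ in 𝓝[>] 0, w z ≤ w (z + s • d) + s * M) : -ℓ d ≤ M := by
  refine (superJet_iff_subJet_neg.1 h).apply_le d ?_
  filter_upwards [hM] with s hs
  linarith

end Jets

section SpaceTime

variable {n : ℕ}

/-- The linear form `(x, t) ↦ ⟪p, x⟫ + a t`. -/
noncomputable def jet (p : Rn n) (a : ℝ) : Rn n × ℝ →L[ℝ] ℝ :=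
  (innerSL ℝ p).comp (ContinuousLinearMap.fst ℝ (Rn n) ℝ)
    + a • ContinuousLinearMap.snd ℝ (Rn n) ℝ

@[simp] theorem jet_apply (p : Rn n) (a : ℝ) (z : Rn n × ℝ) :
    jet p a z = inner ℝ p z.1 + a * z.2 := by
  simp [jet]

theorem neg_jet (p : Rn n) (a : ℝ) : -jet p a = jet (-p) (-a) := by
  ext z <;> simp

theorem exists_eq_jet (ℓ : Rn n × ℝ →L[ℝ] ℝ) : ∃ p a, ℓ = jet p a := by
  refine ⟨(InnerProductSpace.toDual ℝ (Rn n)).symm (ℓ.comp (ContinuousLinearMap.inl ℝ (Rn n) ℝ)),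
    ℓ (0, 1), ?_⟩
  refine ContinuousLinearMap.ext fun z => ?_
  rw [jet_apply, InnerProductSpace.toDual_symm_apply]
  have : z = (z.1, 0) + z.2 • ((0, 1) : Rn n × ℝ) := by ext <;> simp
  conv_lhs => rw [this]
  rw [map_add, map_smul]
  simp [mul_comm]

theorem gradient_eq_of_hasFDerivAt_jet {φ : Rn n × ℝ → ℝ} {p : Rn n} {a : ℝ} {x : Rn n} {s : ℝ}
    (h : HasFDerivAt φ (jet p a) (x, s)) : gradient (fun y => φ (y, s)) x = p := by
  refine HasGradientAt.gradient ?_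
  rw [hasGradientAt_iff_hasFDerivAt]
  have h1 : HasFDerivAt (fun y : Rn n => (y, s)) (ContinuousLinearMap.inl ℝ (Rn n) ℝ) x :=
    (hasFDerivAt_id x).prodMk (hasFDerivAt_const s x)
  refine (h.comp x h1).congr_fderiv ?_
  ext y; simp

theorem deriv_eq_of_hasFDerivAt_jet {φ : Rn n × ℝ → ℝ} {p : Rn n} {a : ℝ} {x : Rn n} {s : ℝ}
    (h : HasFDerivAt φ (jet p a) (x, s)) : deriv (fun r => φ (x, r)) s = a := by
  have h1 : HasDerivAt (fun r : ℝ => (x, r)) ((0 : Rn n), (1 : ℝ)) s :=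
    (hasDerivAt_const s x).prodMk (hasDerivAt_id s)
  have := (h.comp_hasDerivAt s h1).deriv
  rw [jet_apply] at this
  simpa [Function.comp_def] using this

theorem hasFDerivAt_jet_of_contDiffOn {φ : Rn n × ℝ → ℝ}
    (hφ : ContDiffOn ℝ 1 φ (univ ×ˢ Ioi 0)) (x : Rn n) {s : ℝ} (hs : 0 < s) :
    HasFDerivAt φ (jet (gradient (fun y => φ (y, s)) x) (deriv (fun r => φ (x, r)) s)) (x, s) := by
  have hd : DifferentiableAt ℝ φ (x, s) := by
    refine (hφ.differentiableOn one_ne_zero).differentiableAt ?_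
    exact (isOpen_univ.prod isOpen_Ioi).mem_nhds ⟨mem_univ _, hs⟩
  obtain ⟨p, a, hpa⟩ := exists_eq_jet (fderiv ℝ φ (x, s))
  have h := hd.hasFDerivAt
  rw [hpa] at h
  rwa [gradient_eq_of_hasFDerivAt_jet h, deriv_eq_of_hasFDerivAt_jet h]

/-- The square of the Euclidean norm of space-time. -/
noncomputable def sqNorm (z : Rn n × ℝ) : ℝ := ‖z.1‖ ^ 2 + z.2 ^ 2

theorem sqNorm_hasFDerivAt (z : Rn n × ℝ) :
    HasFDerivAt sqNorm (jet ((2 : ℝ) • z.1) (2 * z.2)) z := by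
  have h1 : HasFDerivAt (fun z : Rn n × ℝ => ‖z.1‖ ^ 2) _ z :=
    (hasFDerivAt_fst (𝕜 := ℝ) (p := z)).norm_sq
  have h2 : HasFDerivAt (fun z : Rn n × ℝ => z.2 ^ 2) _ z :=
    (hasFDerivAt_snd (𝕜 := ℝ) (p := z)).pow 2
  refine (h1.add h2).congr_fderiv ?_
  refine ContinuousLinearMap.ext fun y => ?_
  simp [inner_smul_left]

theorem sqNorm_sub_hasFDerivAt (z₀ z : Rn n × ℝ) : HasFDerivAt (fun z => sqNorm (z - z₀))
    (jet ((2 : ℝ) • (z - z₀).1) (2 * (z - z₀).2)) z :=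
  (HasFDerivAt.comp z (g := sqNorm) (f := fun z => z - z₀) (sqNorm_hasFDerivAt (z - z₀))
    ((hasFDerivAt_id z).sub_const z₀)).congr_fderiv (ContinuousLinearMap.comp_id _)

theorem sqNorm_contDiff : ContDiff ℝ 1 (sqNorm : Rn n × ℝ → ℝ) :=
  (contDiff_fst.norm_sq ℝ).add (contDiff_snd.pow 2)

theorem norm_sq_le_sqNorm (z : Rn n × ℝ) : ‖z‖ ^ 2 ≤ sqNorm z := by
  unfold sqNorm
  rcases le_total ‖z.1‖ ‖z.2‖ with h | h
  · rw [Prod.norm_def, max_eq_right h, Real.norm_eq_abs, sq_abs]; nlinarith [sq_nonneg ‖z.1‖]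
  · rw [Prod.norm_def, max_eq_left h]; nlinarith [sq_nonneg z.2]

theorem sqNorm_pos {z : Rn n × ℝ} (hz : z ≠ 0) : 0 < sqNorm z :=
  lt_of_lt_of_le (pow_pos (norm_pos_iff.2 hz) 2) (norm_sq_le_sqNorm z)

@[simp] theorem sqNorm_zero : sqNorm (0 : Rn n × ℝ) = 0 := by simp [sqNorm]

/-- A function uniformly close to one with a given superjet has an interior maximum after
subtracting a quadratic with slope close to the jet. -/
theorem SuperJet.exists_isMaxOn {w f : Rn n × ℝ → ℝ} {z₀ : Rn n × ℝ} {ℓ : Rn n × ℝ →L[ℝ] ℝ}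
    {ε ρ κ : ℝ} (hε : 0 < ε) (hρ : 0 < ρ)
    (hw : ∀ z ∈ Metric.closedBall z₀ ρ, w z ≤ w z₀ + ℓ (z - z₀) + ε * ‖z - z₀‖)
    (hf : ContinuousOn f (Metric.closedBall z₀ ρ))
    (hκ : ∀ z ∈ Metric.closedBall z₀ ρ, |f z - w z| ≤ κ) (hκρ : 2 * κ < ε * ρ) :
    ∃ z₁ ∈ Metric.ball z₀ ρ, IsMaxOn
      (fun z => f z - ℓ (z - z₀) - 2 * ε / ρ * sqNorm (z - z₀)) (Metric.closedBall z₀ ρ) z₁ := by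
  have hc : ContinuousOn (fun z => f z - ℓ (z - z₀) - 2 * ε / ρ * sqNorm (z - z₀))
      (Metric.closedBall z₀ ρ) := by
    have := (sqNorm_contDiff (n := n)).continuous
    refine (hf.sub ?_).sub ?_ <;> fun_prop
  obtain ⟨z₁, hz₁, hmax⟩ := (isCompact_closedBall z₀ ρ).exists_isMaxOn
    ⟨z₀, Metric.mem_closedBall_self hρ.le⟩ hc
  refine ⟨z₁, ?_, hmax⟩
  by_contra hb
  have hd : ‖z₁ - z₀‖ = ρ := by
    rw [← dist_eq_norm]
    exact le_antisymm hz₁ (not_lt.1 hb)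
  have h0 := hmax (Metric.mem_closedBall_self hρ.le)
  simp only [sub_self, map_zero, sqNorm_zero, mem_ofPred_eq] at h0
  have h1 := hw z₁ hz₁
  have h2 := (abs_le.1 (hκ z₁ hz₁)).2
  have h3 := (abs_le.1 (hκ z₀ (Metric.mem_closedBall_self hρ.le))).1
  have h4 : 2 * ε * ρ ≤ 2 * ε / ρ * sqNorm (z₁ - z₀) := by
    have := norm_sq_le_sqNorm (z₁ - z₀)
    rw [hd] at this
    calc 2 * ε * ρ = 2 * ε / ρ * ρ ^ 2 := by field_simp
      _ ≤ _ := by gcongr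
  rw [hd] at h1
  linarith

/-- A local strict test function can be modified away from the contact point into a global one. -/
theorem exists_global_test {W φ : Rn n × ℝ → ℝ} (hW : ContinuousOn W (univ ×ˢ Ici 0))
    (hφ : ContDiff ℝ 1 φ) {z₁ : Rn n × ℝ} {d : ℝ} (hd : 0 < d)
    (hlt : ∀ z ∈ Metric.closedBall z₁ d, z ≠ z₁ → W z < φ z) :
    ∃ φ' : Rn n × ℝ → ℝ, ContDiff ℝ 1 φ' ∧ φ' =ᶠ[𝓝 z₁] φ ∧
      ∀ z : Rn n × ℝ, 0 ≤ z.2 → z ≠ z₁ → W z < φ' z := by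
  let W' : Rn n × ℝ → ℝ := fun z => W (z.1, max z.2 0)
  have hW' : Continuous W' := by
    refine hW.comp_continuous (by fun_prop) fun z => ⟨mem_univ _, mem_Ici.2 (le_max_right _ _)⟩
  have hc : Continuous fun z => W' z - φ z := hW'.sub hφ.continuous
  obtain ⟨M, hMc, hMd, -⟩ := hc.exists_contDiff_approx 1
    (ε := fun _ => 1) continuous_const (fun _ => one_pos)
  have hMc : ContDiff ℝ 1 M := hMc
  let b : ContDiffBump z₁ := ⟨d / 2, d, by positivity, by linarith⟩
  have hb : ContDiff ℝ 1 (fun z => b z) := b.contDiff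
  refine ⟨fun z => φ z + (1 - b z) * (M z ^ 2 + 2), by fun_prop, ?_, ?_⟩
  · filter_upwards [b.eventuallyEq_one] with z hz
    simp [hz]
  · intro z hz hne
    have h1 : 0 ≤ (1 - b z) * (M z ^ 2 + 2) :=
      mul_nonneg (by linarith [b.le_one (x := z)]) (by positivity)
    by_cases hzd : z ∈ Metric.closedBall z₁ d
    · linarith [hlt z hzd hne]
    · have hb0 : b z = 0 := b.zero_of_le_dist (le_of_lt (not_le.1 hzd))
      have hW'z : W' z = W z := by simp [W', max_eq_left hz]
      have h2 := hMd z
      rw [Real.dist_eq, abs_lt, hW'z] at h2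
      simp only [hb0]
      nlinarith [sq_nonneg (M z - 1)]

/-- The viscosity inequality of a subsolution holds along superjets. -/
theorem IsViscositySubsolution.superJet_le {G : Hamiltonian n} {w₀ : Rn n → ℝ} {w : Rn n → ℝ → ℝ}
    (h : IsViscositySubsolution G w₀ w)
    (hG : Continuous fun z : Rn n × Rn n × ℝ => G z.1 z.2.1 z.2.2)
    (hw : ContinuousOn (fun z : Rn n × ℝ => w z.1 z.2) (univ ×ˢ Ici 0))
    {z₀ : Rn n × ℝ} (hz₀ : 0 < z₀.2) {p : Rn n} {a : ℝ}
    (hj : SuperJet (fun z : Rn n × ℝ => w z.1 z.2) z₀ (jet p a)) :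
    a + G z₀.1 p (w z₀.1 z₀.2) ≤ 0 := by
  set W : Rn n × ℝ → ℝ := fun z => w z.1 z.2 with hWdef
  have hopen : IsOpen (univ ×ˢ Ioi 0 : Set (Rn n × ℝ)) := isOpen_univ.prod isOpen_Ioi
  have hWz : ∀ z : Rn n × ℝ, 0 < z.2 → ContinuousAt W z := fun z hz =>
    (hw.mono (prod_mono_right Ioi_subset_Ici_self)).continuousAt (hopen.mem_nhds ⟨mem_univ _, hz⟩)
  by_contra! hlt
  -- the inequality is an open condition on the point and the jet
  have hcont : ContinuousAt (fun y : (Rn n × ℝ) × (Rn n × ℝ) =>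
      y.2.2 + G y.1.1 y.2.1 (W y.1)) (z₀, (p, a)) := by
    have h1 : ContinuousAt (fun y : (Rn n × ℝ) × (Rn n × ℝ) => W y.1) (z₀, (p, a)) :=
      ContinuousAt.comp (f := Prod.fst) (g := W) (hWz z₀ hz₀) continuousAt_fst
    have h2 : ContinuousAt (fun y : (Rn n × ℝ) × (Rn n × ℝ) => (y.1.1, y.2.1, W y.1))
        (z₀, (p, a)) := by fun_prop
    exact (by fun_prop : ContinuousAt (fun y : (Rn n × ℝ) × (Rn n × ℝ) => y.2.2) _).add
      (hG.continuousAt.comp h2)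
  obtain ⟨δ, hδ, hball⟩ := Metric.eventually_nhds_iff.1 (hcont.eventually (lt_mem_nhds hlt))
  set ε := δ / 8 with hεdef
  have hε : 0 < ε := by positivity
  obtain ⟨ρ₁, hρ₁, hj'⟩ := Metric.eventually_nhds_iff.1 (hj ε hε)
  set ρ := min (ρ₁ / 2) (min (δ / 2) (z₀.2 / 2)) with hρdef
  have hρ : 0 < ρ := by positivity
  have hρ1 : ρ < ρ₁ := lt_of_le_of_lt (min_le_left _ _) (by linarith)
  have hρ2 : ρ ≤ δ / 2 := (min_le_right _ _).trans (min_le_left _ _)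
  have hρ3 : ρ ≤ z₀.2 / 2 := (min_le_right _ _).trans (min_le_right _ _)
  have hpos : ∀ z ∈ Metric.closedBall z₀ ρ, 0 < z.2 := by
    intro z hz
    have h1 : |z.2 - z₀.2| ≤ ρ := by
      rw [← Real.dist_eq]
      exact (le_max_right _ _).trans hz
    have := (abs_le.1 h1).1
    linarith
  obtain ⟨z₁, hz₁, hmax⟩ := SuperJet.exists_isMaxOn (w := W) (f := W) (ℓ := jet p a) (κ := 0) hε hρ
    (fun z hz => hj' (lt_of_le_of_lt hz hρ1))
    (fun z hz => (hWz z (hpos z hz)).continuousWithinAt) (by simp) (by simpa using by positivity)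
  set c := 2 * ε / ρ with hc
  let φ : Rn n × ℝ → ℝ := fun z =>
    W z₁ + jet p a (z - z₁) + c * (sqNorm (z - z₀) - sqNorm (z₁ - z₀)) + sqNorm (z - z₁)
  have hφc : ContDiff ℝ 1 φ := by
    have := sqNorm_contDiff (n := n)
    have h1 : ContDiff ℝ 1 (fun z : Rn n × ℝ => sqNorm (z - z₀)) := this.comp (by fun_prop)
    have h2 : ContDiff ℝ 1 (fun z : Rn n × ℝ => sqNorm (z - z₁)) := this.comp (by fun_prop)
    have h3 : ContDiff ℝ 1 (fun z : Rn n × ℝ => jet p a (z - z₁)) :=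
      (jet p a).contDiff.comp (by fun_prop)
    fun_prop
  obtain ⟨d, hd, hdball⟩ := Metric.nhds_basis_closedBall.mem_iff.1 (Metric.isOpen_ball.mem_nhds hz₁)
  have hlt' : ∀ z ∈ Metric.closedBall z₁ d, z ≠ z₁ → W z < φ z := by
    intro z hz hne
    have h1 := hmax (Metric.ball_subset_closedBall (hdball hz))
    simp only [mem_ofPred_eq] at h1
    have h2 := sqNorm_pos (sub_ne_zero.2 hne)
    have h3 : jet p a (z - z₁) = jet p a (z - z₀) - jet p a (z₁ - z₀) := by
      rw [← map_sub]; simp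
    simp only [φ, h3]
    linarith
  obtain ⟨φ', hφ'c, hφ'e, hφ'lt⟩ := exists_global_test hw hφc hd hlt'
  have hφ1 : φ z₁ = W z₁ := by simp [φ]
  have hφ'1 : φ' z₁ = W z₁ := by rw [hφ'e.eq_of_nhds, hφ1]
  have hder : HasFDerivAt φ' (jet (p + (2 * c) • (z₁.1 - z₀.1)) (a + 2 * c * (z₁.2 - z₀.2))) z₁ := by
    refine HasFDerivAt.congr_of_eventuallyEq ?_ hφ'e
    have e1 : HasFDerivAt (fun z => sqNorm (z - z₀)) (jet ((2 : ℝ) • (z₁ - z₀).1)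
        (2 * (z₁ - z₀).2)) z₁ := by
      exact sqNorm_sub_hasFDerivAt z₀ z₁
    have e2 : HasFDerivAt (fun z => sqNorm (z - z₁)) (jet ((2 : ℝ) • (z₁ - z₁).1)
        (2 * (z₁ - z₁).2)) z₁ := by
      exact sqNorm_sub_hasFDerivAt z₁ z₁
    have e3 : HasFDerivAt (fun z => jet p a (z - z₁)) (jet p a) z₁ := by
      simp only [map_sub]
      exact (jet p a).hasFDerivAt.sub_const _
    refine (((e3.const_add (W z₁)).add ((e1.sub_const _).const_mul c)).add e2).congr_fderiv ?_
    refine ContinuousLinearMap.ext fun y => ?_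
    simp [inner_smul_left, inner_add_left]
    ring
  have hz₁' := Metric.ball_subset_closedBall hz₁
  have hmain := h.1 φ' hφ'c.contDiffOn z₁.1 z₁.2 (hpos z₁ hz₁') hφ'1.symm (by
    intro x s hs hne
    have := hφ'lt (x, s) hs.le hne
    change W (x, s) - _ < W z₁ - φ' z₁
    rw [hφ'1]; linarith)
  rw [gradient_eq_of_hasFDerivAt_jet hder, deriv_eq_of_hasFDerivAt_jet hder, hφ'1] at hmain
  have hnorm : ‖z₁ - z₀‖ < ρ := by rw [← dist_eq_norm]; exact hz₁
  have hcρ : 2 * c * ρ = 4 * ε := by rw [hc]; field_simp; ring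
  have hc0 : 0 < 2 * c := by positivity
  have hdist : dist (z₁, (p + (2 * c) • (z₁.1 - z₀.1), a + 2 * c * (z₁.2 - z₀.2)))
      (z₀, (p, a)) < δ := by
    have n1 : ‖z₁.1 - z₀.1‖ < ρ := (norm_fst_le (z₁ - z₀)).trans_lt hnorm
    have n2 : ‖z₁.2 - z₀.2‖ < ρ := (norm_snd_le (z₁ - z₀)).trans_lt hnorm
    have m1 : 2 * c * ‖z₁.1 - z₀.1‖ < δ := by nlinarith
    have m2 : 2 * c * ‖z₁.2 - z₀.2‖ < δ := by nlinarith
    rw [Prod.dist_eq, dist_eq_norm z₁, dist_eq_norm]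
    refine max_lt (by linarith) ?_
    rw [Prod.mk_sub_mk, add_sub_cancel_left, add_sub_cancel_left, Prod.norm_mk, norm_smul,
      norm_mul (2 * c), Real.norm_eq_abs (2 * c), abs_of_pos hc0]
    exact max_lt m1 m2
  exact absurd (hball hdist) (not_lt.2 hmain)

theorem IsViscositySupersolution.neg {G : Hamiltonian n} {w₀ : Rn n → ℝ} {w : Rn n → ℝ → ℝ}
    (h : IsViscositySupersolution G w₀ w) :
    IsViscositySubsolution (fun x p u => -G x (-p) (-u)) (fun x => -w₀ x) (fun x t => -w x t) := by
  refine ⟨fun φ hφ x₀ s₀ hs₀ heq hmax => ?_, fun x => neg_le_neg (h.2 x)⟩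
  have hφ' := hasFDerivAt_jet_of_contDiffOn hφ x₀ hs₀
  have hneg := hφ'.neg
  rw [neg_jet] at hneg
  have key := h.1 (fun z => -φ z) hφ.neg x₀ s₀ hs₀ (by linarith) (fun x s hs hne => by
    have := hmax x s hs hne
    linarith)
  have e1 : gradient (fun x => -φ (x, s₀)) x₀ = -gradient (fun x => φ (x, s₀)) x₀ :=
    gradient_eq_of_hasFDerivAt_jet (φ := fun z => -φ z) hneg
  have e2 : deriv (fun s => -φ (x₀, s)) s₀ = -deriv (fun s => φ (x₀, s)) s₀ :=
    deriv_eq_of_hasFDerivAt_jet (φ := fun z => -φ z) hneg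
  simp only [e1, e2] at key
  linarith

/-- The viscosity inequality of a supersolution holds along subjets. -/
theorem IsViscositySupersolution.le_subJet {G : Hamiltonian n} {w₀ : Rn n → ℝ} {w : Rn n → ℝ → ℝ}
    (h : IsViscositySupersolution G w₀ w)
    (hG : Continuous fun z : Rn n × Rn n × ℝ => G z.1 z.2.1 z.2.2)
    (hw : ContinuousOn (fun z : Rn n × ℝ => w z.1 z.2) (univ ×ˢ Ici 0))
    {z₀ : Rn n × ℝ} (hz₀ : 0 < z₀.2) {p : Rn n} {a : ℝ}
    (hj : SubJet (fun z : Rn n × ℝ => w z.1 z.2) z₀ (jet p a)) :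
    0 ≤ a + G z₀.1 p (w z₀.1 z₀.2) := by
  rw [subJet_iff_superJet_neg, neg_jet] at hj
  have hG' : Continuous fun z : Rn n × Rn n × ℝ => -G z.1 (-z.2.1) (-z.2.2) :=
    (hG.comp (by fun_prop : Continuous fun z : Rn n × Rn n × ℝ => (z.1, -z.2.1, -z.2.2))).neg
  have := h.neg.superJet_le hG' hw.neg hz₀ hj
  simp only [neg_neg] at this
  linarith

end SpaceTime

end ContactHJ

namespace ContactHJ

open Filter Topology Set MeasureTheory

section Average

variable {V : Type*} [NormedAddCommGroup V] [NormedSpace ℝ V] [FiniteDimensional ℝ V]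

/-- A function that is Lipschitz on a ball, with almost all derivatives in a closed convex set `S`,
is uniformly approximated on smaller balls by differentiable functions with derivatives in `S`. -/
theorem exists_differentiable_approx {w : V → ℝ} {z₀ : V} {r κ : ℝ} {K : ℝ≥0} (hκ : 0 < κ)
    (hw : LipschitzOnWith K w (Metric.ball z₀ (r + κ))) {S : Set (V →L[ℝ] ℝ)}
    (hSc : Convex ℝ S) (hScl : IsClosed S)
    (hS : ∀ z ∈ Metric.ball z₀ (r + κ), DifferentiableAt ℝ w z → fderiv ℝ w z ∈ S) :
    ∃ f : V → ℝ, (∀ z ∈ Metric.ball z₀ r, ∃ ℓ ∈ S, HasFDerivAt f ℓ z) ∧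
      ∀ z ∈ Metric.ball z₀ r, |f z - w z| ≤ K * κ := by
  borelize V
  obtain ⟨μ, hμ⟩ : ∃ μ : Measure V, μ.IsAddHaarMeasure := ⟨Measure.addHaar, inferInstance⟩
  obtain ⟨D, hD⟩ : ∃ D : Set V, D = Metric.ball 0 κ := ⟨_, rfl⟩
  have hDm : MeasurableSet D := hD ▸ Metric.isOpen_ball.measurableSet
  have hD0 : μ D ≠ 0 := hD ▸ (Metric.measure_ball_pos μ 0 hκ).ne'
  have hDt : μ D ≠ ⊤ := hD ▸ measure_ball_lt_top.ne
  have hadd : ∀ z ∈ Metric.ball z₀ r, ∀ ζ ∈ D, z + ζ ∈ Metric.ball z₀ (r + κ) := by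
    intro z hz ζ hζ
    rw [hD] at hζ
    rw [Metric.mem_ball, dist_eq_norm] at *
    rw [sub_zero] at hζ
    calc ‖z + ζ - z₀‖ = ‖(z - z₀) + ζ‖ := by congr 1; abel
      _ ≤ ‖z - z₀‖ + ‖ζ‖ := norm_add_le _ _
      _ < r + κ := by linarith
  have hcont : ∀ z ∈ Metric.ball z₀ r, ContinuousOn (fun ζ => w (z + ζ)) D := fun z hz =>
    hw.continuousOn.comp (by fun_prop) fun ζ hζ => hadd z hz ζ hζ
  have hbd : ∀ z ∈ Metric.ball z₀ r, ∀ ζ ∈ D, |w (z + ζ) - w z| ≤ K * κ := by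
    intro z hz ζ hζ
    have hz' : z ∈ Metric.ball z₀ (r + κ) := Metric.ball_subset_ball (by linarith) hz
    have := hw.dist_le_mul _ (hadd z hz ζ hζ) _ hz'
    rw [Real.dist_eq, dist_eq_norm, add_sub_cancel_left] at this
    refine this.trans ?_
    have : ‖ζ‖ < κ := by simpa [hD] using hζ
    gcongr
  have hint : ∀ z ∈ Metric.ball z₀ r, IntegrableOn (fun ζ => w (z + ζ)) D μ := by
    intro z hz
    refine IntegrableOn.of_bound hDt.lt_top
      ((hcont z hz).aestronglyMeasurable hDm) (|w z| + K * κ) ?_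
    filter_upwards [ae_restrict_mem hDm] with ζ hζ
    have := hbd z hz ζ hζ
    rw [Real.norm_eq_abs]
    calc |w (z + ζ)| = |w z + (w (z + ζ) - w z)| := by congr 1; ring
      _ ≤ _ := (abs_add_le _ _).trans (by linarith)
  refine ⟨fun z => ⨍ ζ in D, w (z + ζ) ∂μ, ?_, ?_⟩
  · intro z hz
    have hae : ∀ᵐ ζ ∂(μ.restrict D), DifferentiableAt ℝ w (z + ζ) := by
      have h1 := hw.ae_differentiableWithinAt_of_mem (μ := μ)
      have h2 : ∀ᵐ ζ ∂μ, z + ζ ∈ Metric.ball z₀ (r + κ) →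
          DifferentiableWithinAt ℝ w (Metric.ball z₀ (r + κ)) (z + ζ) :=
        (measurePreserving_add_left μ z).quasiMeasurePreserving.ae
          (p := fun y => y ∈ Metric.ball z₀ (r + κ) →
            DifferentiableWithinAt ℝ w (Metric.ball z₀ (r + κ)) y) h1
      filter_upwards [ae_restrict_of_ae h2,
        ae_restrict_mem hDm] with ζ h3 h4
      exact (h3 (hadd z hz ζ h4)).differentiableAt (Metric.isOpen_ball.mem_nhds (hadd z hz ζ h4))
    have key := hasFDerivAt_integral_of_dominated_loc_of_lip (μ := μ.restrict D) (𝕜 := ℝ)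
      (F := fun z ζ => w (z + ζ)) (x₀ := z) (bound := fun _ => (K : ℝ))
      (F' := fun ζ => fderiv ℝ w (z + ζ)) (s := Metric.ball z₀ r)
      (Metric.isOpen_ball.mem_nhds hz)
      (by
        filter_upwards [Metric.isOpen_ball.mem_nhds hz] with y hy
        exact (hcont y hy).aestronglyMeasurable hDm)
      (hint z hz)
      ((measurable_fderiv ℝ w).comp (measurable_const_add z)).aestronglyMeasurable
      (by
        filter_upwards [ae_restrict_mem hDm] with ζ hζ
        have : Real.nnabs (K : ℝ) = K := by ext; simp
        rw [this]
        intro a ha b hb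
        simpa using hw (hadd a ha ζ hζ) (hadd b hb ζ hζ))
      (integrableOn_const hDt)
      (by
        filter_upwards [hae] with ζ hζ
        have := hζ.hasFDerivAt
        exact (hasFDerivAt_comp_add_right ζ).2 this)
    refine ⟨⨍ ζ in D, fderiv ℝ w (z + ζ) ∂μ, ?_, ?_⟩
    · refine hSc.set_average_mem hScl hD0 hDt ?_ key.1
      filter_upwards [hae, ae_restrict_mem hDm] with ζ h3 h4
      exact hS _ (hadd z hz ζ h4) h3
    · simp only [setAverage_eq]
      exact key.2.fun_const_smul _
  · intro z hz
    have h1 : (⨍ ζ in D, w (z + ζ) ∂μ) ∈ Metric.closedBall (w z) (K * κ) := by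
      refine (convex_closedBall _ _).set_average_mem Metric.isClosed_closedBall hD0 hDt ?_ (hint z hz)
      filter_upwards [ae_restrict_mem hDm] with ζ hζ
      exact hbd z hz ζ hζ
    exact h1

end Average

variable {n : ℕ}

/-- Superjets of a Lipschitz function lie in every closed convex set containing its nearby
derivatives. -/
theorem SuperJet.mem_of_fderiv_mem {w : Rn n × ℝ → ℝ} {z₀ : Rn n × ℝ} {ℓ : Rn n × ℝ →L[ℝ] ℝ}
    {r : ℝ} (hr : 0 < r) {K : ℝ≥0} (hw : LipschitzOnWith K w (Metric.ball z₀ r))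
    {S : Set (Rn n × ℝ →L[ℝ] ℝ)} (hSc : Convex ℝ S) (hScl : IsClosed S)
    (hS : ∀ z ∈ Metric.ball z₀ r, DifferentiableAt ℝ w z → fderiv ℝ w z ∈ S)
    (hj : SuperJet w z₀ ℓ) : ℓ ∈ S := by
  rw [← hScl.closure_eq, Metric.mem_closure_iff]
  intro δ hδ
  set ε := δ / 16 with hεdef
  have hε : 0 < ε := by positivity
  obtain ⟨ρ₁, hρ₁, hj'⟩ := Metric.eventually_nhds_iff.1 (hj ε hε)
  set ρ := min (ρ₁ / 2) (r / 4) with hρdef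
  have hρ : 0 < ρ := by positivity
  have hρ1 : ρ < ρ₁ := lt_of_le_of_lt (min_le_left _ _) (by linarith)
  have hρ2 : ρ ≤ r / 4 := min_le_right _ _
  set κ := min (r / 2) (ε * ρ / (4 * (K + 1))) with hκdef
  have hκ : 0 < κ := by positivity
  have hκ1 : κ ≤ r / 2 := min_le_left _ _
  have hκ2 : 2 * (K * κ) < ε * ρ := by
    have h1 : κ * (4 * (K + 1)) ≤ ε * ρ := by
      rw [← le_div_iff₀ (by positivity)]; exact min_le_right _ _
    have : 0 ≤ (K : ℝ) := K.2
    nlinarith [mul_pos hε hρ]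
  have hsub : Metric.ball z₀ (r / 2 + κ) ⊆ Metric.ball z₀ r := Metric.ball_subset_ball (by linarith)
  obtain ⟨f, hf1, hf2⟩ := exists_differentiable_approx hκ (hw.mono hsub) hSc hScl
    fun z hz => hS z (hsub hz)
  have hcb : Metric.closedBall z₀ ρ ⊆ Metric.ball z₀ (r / 2) :=
    Metric.closedBall_subset_ball (by linarith)
  obtain ⟨z₁, hz₁, hmax⟩ := SuperJet.exists_isMaxOn (w := w) (f := f) (ℓ := ℓ) hε hρ
    (fun z hz => hj' (lt_of_le_of_lt hz hρ1))
    (fun z hz => by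
      obtain ⟨ℓ', -, h⟩ := hf1 z (hcb hz)
      exact h.continuousAt.continuousWithinAt)
    (fun z hz => hf2 z (hcb hz)) hκ2
  obtain ⟨ℓ', hℓ', hfd⟩ := hf1 z₁ (hcb (Metric.ball_subset_closedBall hz₁))
  refine ⟨ℓ', hℓ', ?_⟩
  set c := 2 * ε / ρ with hc
  have hloc : IsLocalMax (fun z => f z - ℓ (z - z₀) - c * sqNorm (z - z₀)) z₁ :=
    hmax.isLocalMax (mem_of_superset (Metric.isOpen_ball.mem_nhds hz₁) Metric.ball_subset_closedBall)
  have e3 : HasFDerivAt (fun z => ℓ (z - z₀)) ℓ z₁ := by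
    simp only [map_sub]
    exact ℓ.hasFDerivAt.sub_const _
  have hder := (hfd.sub e3).sub ((sqNorm_sub_hasFDerivAt z₀ z₁).const_mul c)
  have h0 := hloc.hasFDerivAt_eq_zero hder
  have h1 : ℓ - ℓ' = -(c • jet ((2 : ℝ) • (z₁ - z₀).1) (2 * (z₁ - z₀).2)) := by
    rw [← sub_eq_zero, ← neg_eq_zero, ← h0]; abel
  rw [dist_eq_norm, h1, norm_neg]
  have hnorm : ‖z₁ - z₀‖ < ρ := by rw [← dist_eq_norm]; exact hz₁
  have hc0 : 0 < c := by positivity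
  have hcρ : c * ρ = 2 * ε := by rw [hc]; field_simp
  have hb : ‖c • jet ((2 : ℝ) • (z₁ - z₀).1) (2 * (z₁ - z₀).2)‖ ≤ c * (4 * ρ) := by
    refine ContinuousLinearMap.opNorm_le_bound _ (by positivity) fun y => ?_
    have n1 : ‖(z₁ - z₀).1‖ ≤ ρ := (norm_fst_le (z₁ - z₀)).trans hnorm.le
    have n2 : ‖(z₁ - z₀).2‖ ≤ ρ := (norm_snd_le (z₁ - z₀)).trans hnorm.le
    have h3 : ‖inner ℝ (z₁ - z₀).1 y.1‖ ≤ ρ * ‖y‖ :=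
      (norm_inner_le_norm _ _).trans (by gcongr; exact norm_fst_le y)
    have h4 : ‖(z₁ - z₀).2 * y.2‖ ≤ ρ * ‖y‖ := by
      rw [norm_mul]; gcongr; exact norm_snd_le y
    rw [smul_apply, smul_eq_mul, jet_apply, inner_smul_left, norm_mul,
      Real.norm_eq_abs c, abs_of_pos hc0, mul_assoc, mul_assoc, mul_assoc]
    refine mul_le_mul_of_nonneg_left ?_ hc0.le
    rw [Real.norm_eq_abs, abs_le] at *
    simp only [conj_trivial]
    constructor <;> linarith [h3.1, h3.2, h4.1, h4.2]
  linarith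

theorem SubJet.mem_of_fderiv_mem {w : Rn n × ℝ → ℝ} {z₀ : Rn n × ℝ} {ℓ : Rn n × ℝ →L[ℝ] ℝ}
    {r : ℝ} (hr : 0 < r) {K : ℝ≥0} (hw : LipschitzOnWith K w (Metric.ball z₀ r))
    {S : Set (Rn n × ℝ →L[ℝ] ℝ)} (hSc : Convex ℝ S) (hScl : IsClosed S)
    (hS : ∀ z ∈ Metric.ball z₀ r, DifferentiableAt ℝ w z → fderiv ℝ w z ∈ S)
    (hj : SubJet w z₀ ℓ) : ℓ ∈ S := by
  have h := (subJet_iff_superJet_neg.1 hj).mem_of_fderiv_mem hr hw.neg (S := -S) hSc.neg hScl.neg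
    (fun z hz hd => by
      have hd' : DifferentiableAt ℝ w z := by simpa using hd.neg
      rw [fderiv_neg, Set.mem_neg, neg_neg]
      exact hS z hz hd')
  rwa [Set.mem_neg, neg_neg] at h

theorem norm_le_norm_jet (p : Rn n) (a : ℝ) : ‖p‖ ≤ ‖jet p a‖ := by
  rcases eq_or_ne p 0 with rfl | hp
  · simp
  have h := (jet p a).le_opNorm (p, 0)
  have h1 : jet p a (p, 0) = ‖p‖ ^ 2 := by simp
  have h2 : ‖((p, 0) : Rn n × ℝ)‖ = ‖p‖ := by simp [Prod.norm_def]
  rw [h1, h2, Real.norm_eq_abs, abs_of_nonneg (by positivity), sq] at h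
  exact le_of_mul_le_mul_right h (norm_pos_iff.2 hp)

/-- The momentum component of a linear form on space-time. -/
noncomputable def momentum (ℓ : Rn n × ℝ →L[ℝ] ℝ) : Rn n :=
  (InnerProductSpace.toDual ℝ (Rn n)).symm (ℓ.comp (ContinuousLinearMap.inl ℝ (Rn n) ℝ))

@[simp] theorem momentum_jet (p : Rn n) (a : ℝ) : momentum (jet p a) = p := by
  refine ext_inner_right ℝ fun y => ?_
  simp [momentum]

theorem momentum_add_smul (s t : ℝ) (ℓ₁ ℓ₂ : Rn n × ℝ →L[ℝ] ℝ) :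
    momentum (s • ℓ₁ + t • ℓ₂) = s • momentum ℓ₁ + t • momentum ℓ₂ := by
  simp [momentum, ContinuousLinearMap.add_comp, ContinuousLinearMap.smul_comp]

theorem momentum_continuous : Continuous (momentum (n := n)) :=
  (InnerProductSpace.toDual ℝ (Rn n)).symm.continuous.comp (by fun_prop)

/-- A continuous function is close to its value in one variable, uniformly over a compact set of
values of the other. -/
theorem eventually_forall_dist_lt {X Y : Type*} [TopologicalSpace X] [TopologicalSpace Y]
    {f : X × Y → ℝ} (hf : Continuous f) (x₀ : X) {P : Set Y} (hP : IsCompact P) {ε : ℝ}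
    (hε : 0 < ε) : ∀ᶠ x in 𝓝 x₀, ∀ y ∈ P, |f (x, y) - f (x₀, y)| < ε := by
  refine hP.eventually_forall_of_forall_eventually fun y _ => ?_
  have hc : Continuous fun z : X × Y => |f (z.1, z.2) - f (x₀, z.2)| := by fun_prop
  have := hc.continuousAt.eventually_lt (continuousAt_const (y := ε) (x := (x₀, y))) (by simpa)
  exact this

/-- For a Hamiltonian that is convex in the momentum, the subsolution inequality at points of
differentiability extends to superjets and to subjets. -/
theorem le_of_jet_of_differentiableAt {G : Hamiltonian n} {w : Rn n × ℝ → ℝ} {z₀ : Rn n × ℝ}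
    {r η : ℝ} (hr : 0 < r) {K : ℝ≥0} (hw : LipschitzOnWith K w (Metric.ball z₀ r))
    (hG : Continuous fun z : Rn n × Rn n × ℝ => G z.1 z.2.1 z.2.2) (hGc : ConvexInP G)
    (hS : ∀ z ∈ Metric.ball z₀ r, ∀ p a, HasFDerivAt w (jet p a) z → a + G z.1 p (w z) ≤ η)
    {p : Rn n} {a : ℝ} (hj : SuperJet w z₀ (jet p a) ∨ SubJet w z₀ (jet p a)) :
    a + G z₀.1 p (w z₀) ≤ η := by
  refine le_of_forall_pos_le_add fun ε hε => ?_
  have hf : Continuous fun y : (Rn n × ℝ) × Rn n => G y.1.1 y.2 y.1.2 :=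
    hG.comp (by fun_prop : Continuous fun y : (Rn n × ℝ) × Rn n => (y.1.1, y.2, y.1.2))
  have hev := eventually_forall_dist_lt hf (z₀.1, w z₀)
    (isCompact_closedBall (0 : Rn n) K) hε
  have hwc : ContinuousAt w z₀ := hw.continuousOn.continuousAt (Metric.ball_mem_nhds z₀ hr)
  have hpair : ContinuousAt (fun z : Rn n × ℝ => (z.1, w z)) z₀ := continuousAt_fst.prodMk hwc
  obtain ⟨ρ, hρ, hball⟩ := Metric.eventually_nhds_iff_ball.1 (hpair.eventually hev)
  have hsub : Metric.ball z₀ (min r ρ) ⊆ Metric.ball z₀ r := Metric.ball_subset_ball (min_le_left _ _)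
  let S : Set (Rn n × ℝ →L[ℝ] ℝ) := {ℓ | ℓ (0, 1) + G z₀.1 (momentum ℓ) (w z₀) ≤ η + ε}
  have hGp : Continuous fun q => G z₀.1 q (w z₀) :=
    hG.comp (by fun_prop : Continuous fun q : Rn n => (z₀.1, q, w z₀))
  have hScl : IsClosed S := by
    refine isClosed_le ?_ continuous_const
    have : Continuous fun ℓ : Rn n × ℝ →L[ℝ] ℝ => ℓ (0, 1) := by fun_prop
    exact this.add (hGp.comp momentum_continuous)
  have hSc : Convex ℝ S := by
    intro ℓ₁ h₁ ℓ₂ h₂ s t hs ht hst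
    have h₁ : ℓ₁ (0, 1) + G z₀.1 (momentum ℓ₁) (w z₀) ≤ η + ε := h₁
    have h₂ : ℓ₂ (0, 1) + G z₀.1 (momentum ℓ₂) (w z₀) ≤ η + ε := h₂
    have h3 := (hGc z₀.1 (w z₀)).2 (mem_univ (momentum ℓ₁)) (mem_univ (momentum ℓ₂)) hs ht hst
    simp only [smul_eq_mul] at h3
    change (s • ℓ₁ + t • ℓ₂) (0, 1) + G z₀.1 (momentum (s • ℓ₁ + t • ℓ₂)) (w z₀) ≤ η + ε
    rw [momentum_add_smul, add_apply, smul_apply, smul_apply, smul_eq_mul, smul_eq_mul]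
    have e : η + ε = s * (η + ε) + t * (η + ε) := by rw [← add_mul, hst, one_mul]
    rw [e]
    nlinarith [mul_le_mul_of_nonneg_left h₁ hs, mul_le_mul_of_nonneg_left h₂ ht]
  have hSd : ∀ z ∈ Metric.ball z₀ (min r ρ), DifferentiableAt ℝ w z → fderiv ℝ w z ∈ S := by
    intro z hz hd
    obtain ⟨q, b, hqb⟩ := exists_eq_jet (fderiv ℝ w z)
    have hd' := hd.hasFDerivAt
    rw [hqb] at hd'
    have h1 := hS z (hsub hz) q b hd'
    have hq : ‖q‖ ≤ K := (norm_le_norm_jet q b).trans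
      (hd'.le_of_lipschitzOn (Metric.isOpen_ball.mem_nhds (hsub hz)) hw)
    have h2 := hball z (Metric.ball_subset_ball (min_le_right _ _) hz) q (by simpa using hq)
    have h3 := (abs_lt.1 h2).1
    rw [hqb]
    change jet q b (0, 1) + G z₀.1 (momentum (jet q b)) (w z₀) ≤ η + ε
    simp only [jet_apply, momentum_jet, inner_zero_right, mul_one, zero_add]
    linarith
  have hmem : jet p a ∈ S := hj.elim
    (fun h => h.mem_of_fderiv_mem (by positivity) (hw.mono hsub) hSc hScl hSd)
    (fun h => h.mem_of_fderiv_mem (by positivity) (hw.mono hsub) hSc hScl hSd)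
  have : jet p a (0, 1) + G z₀.1 (momentum (jet p a)) (w z₀) ≤ η + ε := hmem
  simpa using this

end ContactHJ

namespace ContactHJ

open Filter Topology Set

variable {n : ℕ}

/-- `w` is `K`-Lipschitz on `ℝⁿ × [0, T]`, for the sum of the distances in space and time. -/
def LipOnStrip (K T : ℝ) (w : Rn n × ℝ → ℝ) : Prop :=
  ∀ z z' : Rn n × ℝ, 0 ≤ z.2 → z.2 ≤ T → 0 ≤ z'.2 → z'.2 ≤ T →
    |w z - w z'| ≤ K * (‖z.1 - z'.1‖ + |z.2 - z'.2|)

theorem LipOnStrip.neg {K T : ℝ} {w : Rn n × ℝ → ℝ} (h : LipOnStrip K T w) :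
    LipOnStrip K T (fun z => -w z) := by
  intro z z' h1 h2 h3 h4
  have := h z z' h1 h2 h3 h4
  rwa [neg_sub_neg, abs_sub_comm]

theorem LipOnStrip.mono {K K' T T' : ℝ} {w : Rn n × ℝ → ℝ} (h : LipOnStrip K T w) (hK : K ≤ K')
    (hT : T' ≤ T) : LipOnStrip K' T' w := by
  intro z z' h1 h2 h3 h4
  refine (h z z' h1 (h2.trans hT) h3 (h4.trans hT)).trans ?_
  gcongr

theorem LipOnStrip.lipschitzOnWith {K T : ℝ} (hK : 0 ≤ K) {w : Rn n × ℝ → ℝ}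
    (h : LipOnStrip K T w) :
    LipschitzOnWith (2 * K).toNNReal w {z : Rn n × ℝ | z.2 ∈ Icc 0 T} := by
  refine LipschitzOnWith.of_dist_le_mul fun z hz z' hz' => ?_
  rw [Real.coe_toNNReal _ (by positivity), Real.dist_eq, dist_eq_norm]
  refine (h z z' hz.1 hz.2 hz'.1 hz'.2).trans ?_
  have h1 := norm_fst_le (z - z')
  have h2 : |z.2 - z'.2| ≤ ‖z - z'‖ := norm_snd_le (z - z')
  rw [Prod.fst_sub] at h1
  nlinarith

theorem LipOnStrip.continuousOn {K T : ℝ} (hK : 0 ≤ K) {w : Rn n × ℝ → ℝ}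
    (h : LipOnStrip K T w) : ContinuousOn w {z : Rn n × ℝ | z.2 ∈ Icc 0 T} :=
  (h.lipschitzOnWith hK).continuousOn

theorem IsLipschitzOnStrips.exists_lipOnStrip {w : Rn n → ℝ → ℝ} (h : IsLipschitzOnStrips w)
    {T : ℝ} (hT : 0 < T) : ∃ K, 0 ≤ K ∧ LipOnStrip K T (fun z => w z.1 z.2) := by
  obtain ⟨K, hK⟩ := h T hT
  refine ⟨K, K.2, fun z z' h1 h2 h3 h4 => ?_⟩
  have := hK.dist_le_mul z ⟨mem_univ _, h1, h2⟩ z' ⟨mem_univ _, h3, h4⟩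
  rw [Real.dist_eq, dist_eq_norm] at this
  refine this.trans ?_
  gcongr
  rw [Prod.norm_def, Prod.fst_sub, Prod.snd_sub]
  exact max_le (le_add_of_nonneg_right (abs_nonneg _)) (le_add_of_nonneg_left (norm_nonneg _))

theorem IsLipschitzOnStrips.continuousOn {w : Rn n → ℝ → ℝ} (h : IsLipschitzOnStrips w) :
    ContinuousOn (fun z : Rn n × ℝ => w z.1 z.2) (univ ×ˢ Ici 0) := by
  rintro z ⟨-, hz⟩
  obtain ⟨K, hK⟩ := h (z.2 + 1) (by linarith [mem_Ici.1 hz])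
  have h1 := hK.continuousOn z ⟨mem_univ _, hz, by linarith⟩
  refine h1.mono_of_mem_nhdsWithin ?_
  have h2 : {y : Rn n × ℝ | y.2 < z.2 + 1} ∈ 𝓝 z :=
    (isOpen_lt continuous_snd continuous_const).mem_nhds (by simp)
  filter_upwards [self_mem_nhdsWithin, mem_nhdsWithin_of_mem_nhds h2] with y hy1 hy2
  exact ⟨mem_univ _, hy1.2, le_of_lt hy2⟩

theorem eventually_line_mem_Ioo {z : Rn n × ℝ} {T : ℝ} (h0 : 0 < z.2) (hT : z.2 < T)
    (d : Rn n × ℝ) : ∀ᶠ s : ℝ in 𝓝[>] 0, 0 < s ∧ (z + s • d).2 ∈ Ioo 0 T := by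
  have hc : Continuous fun s : ℝ => (z + s • d).2 := by fun_prop
  have : Tendsto (fun s : ℝ => (z + s • d).2) (𝓝[>] 0) (𝓝 z.2) := by
    simpa using (hc.tendsto 0).mono_left nhdsWithin_le_nhds
  exact (eventually_mem_nhdsWithin.mono fun s hs => hs).and
    (this.eventually (isOpen_Ioo.mem_nhds ⟨h0, hT⟩))

theorem SubJet.apply_le_of_lip {K T : ℝ} {w : Rn n × ℝ → ℝ} {z : Rn n × ℝ}
    {ℓ : Rn n × ℝ →L[ℝ] ℝ} (hj : SubJet w z ℓ) (h : LipOnStrip K T w) (h0 : 0 < z.2)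
    (hT : z.2 < T) (d : Rn n × ℝ) : ℓ d ≤ K * (‖d.1‖ + |d.2|) := by
  refine hj.apply_le d ?_
  filter_upwards [eventually_line_mem_Ioo h0 hT d] with s hs
  have := (abs_le.1 (h (z + s • d) z hs.2.1.le hs.2.2.le h0.le hT.le)).2
  simp only [Prod.fst_add, Prod.snd_add, add_sub_cancel_left, Prod.smul_fst, Prod.smul_snd,
    norm_smul, smul_eq_mul, abs_mul, Real.norm_eq_abs, abs_of_pos hs.1] at this
  nlinarith

theorem SubJet.norm_le {K T : ℝ} {w : Rn n × ℝ → ℝ} {z : Rn n × ℝ} {p : Rn n} {a : ℝ}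
    (hj : SubJet w z (jet p a)) (hK : 0 ≤ K) (h : LipOnStrip K T w) (h0 : 0 < z.2)
    (hT : z.2 < T) : ‖p‖ ≤ K ∧ |a| ≤ K := by
  refine ⟨?_, abs_le.2 ⟨?_, ?_⟩⟩
  · have := hj.apply_le_of_lip h h0 hT (p, 0)
    simp only [jet_apply, real_inner_self_eq_norm_sq, mul_zero, add_zero, abs_zero] at this
    rcases eq_or_ne p 0 with rfl | hp
    · simpa using hK
    · have hp' := norm_pos_iff.2 hp
      rw [sq] at this
      exact le_of_mul_le_mul_right this hp'
  · have := hj.apply_le_of_lip h h0 hT (0, -1)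
    simp at this
    linarith
  · have := hj.apply_le_of_lip h h0 hT (0, 1)
    simpa using this

theorem SuperJet.norm_le {K T : ℝ} {w : Rn n × ℝ → ℝ} {z : Rn n × ℝ} {p : Rn n} {a : ℝ}
    (hj : SuperJet w z (jet p a)) (hK : 0 ≤ K) (h : LipOnStrip K T w) (h0 : 0 < z.2)
    (hT : z.2 < T) : ‖p‖ ≤ K ∧ |a| ≤ K := by
  rw [superJet_iff_subJet_neg, neg_jet] at hj
  simpa using hj.norm_le hK h.neg h0 hT

theorem hasDerivAt_posPart_sq (s : ℝ) : HasDerivAt (fun s : ℝ => (max s 0) ^ 2) (2 * max s 0) s := by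
  rcases lt_trichotomy s 0 with hs | rfl | hs
  · have : (fun s : ℝ => (max s 0) ^ 2) =ᶠ[𝓝 s] fun _ => 0 := by
      filter_upwards [gt_mem_nhds hs] with y hy
      rw [max_eq_right hy.le]; simp
    rw [max_eq_right hs.le, mul_zero]
    exact (hasDerivAt_const s 0).congr_of_eventuallyEq this
  · rw [hasDerivAt_iff_isLittleO_nhds_zero]
    simp only [zero_add, max_self, mul_zero, smul_zero, sub_zero, ne_eq, OfNat.ofNat_ne_zero,
      not_false_eq_true, zero_pow]
    refine Asymptotics.IsBigO.trans_isLittleO ?_ (Asymptotics.isLittleO_pow_id one_lt_two)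
    refine Asymptotics.IsBigO.of_bound 1 (Eventually.of_forall fun y => ?_)
    rw [one_mul, norm_pow, norm_pow, Real.norm_eq_abs, Real.norm_eq_abs]
    refine pow_le_pow_left₀ (abs_nonneg _) ?_ 2
    rw [abs_of_nonneg (le_max_right _ _)]
    exact max_le (le_abs_self _) (abs_nonneg _)
  · have : (fun s : ℝ => (max s 0) ^ 2) =ᶠ[𝓝 s] fun s => s ^ 2 := by
      filter_upwards [lt_mem_nhds hs] with y hy
      rw [max_eq_left hy.le]
    rw [max_eq_left hs.le]
    simpa using (hasDerivAt_pow 2 s).congr_of_eventuallyEq this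

/-- The weight `e^{B t} (1 + |x|²)`. -/
noncomputable def weight (B : ℝ) (z : Rn n × ℝ) : ℝ := Real.exp (B * z.2) * (1 + ‖z.1‖ ^ 2)

theorem weight_hasFDerivAt (B : ℝ) (z : Rn n × ℝ) :
    HasFDerivAt (weight B) (jet ((2 * Real.exp (B * z.2)) • z.1) (B * weight B z)) z := by
  have h1 : HasFDerivAt (fun z : Rn n × ℝ => 1 + ‖z.1‖ ^ 2) _ z :=
    (hasFDerivAt_fst (𝕜 := ℝ) (p := z)).norm_sq.const_add 1
  have h2 : HasFDerivAt (fun z : Rn n × ℝ => Real.exp (B * z.2)) _ z :=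
    ((hasFDerivAt_snd (𝕜 := ℝ) (p := z)).const_mul B).exp
  refine (h2.mul h1).congr_fderiv ?_
  refine ContinuousLinearMap.ext fun y => ?_
  simp [inner_smul_left, weight]
  ring

/-- A barrier that vanishes where `weight B ≤ ρ` and exceeds `N` where `weight B ≥ 2 ρ`. -/
noncomputable def barrier (N B ρ : ℝ) (z : Rn n × ℝ) : ℝ := N * (max (weight B z / ρ - 1) 0) ^ 2

theorem barrier_hasFDerivAt (N B ρ : ℝ) (z : Rn n × ℝ) :
    HasFDerivAt (barrier N B ρ)
      ((N * (2 * max (weight B z / ρ - 1) 0) / ρ) •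
        jet ((2 * Real.exp (B * z.2)) • z.1) (B * weight B z)) z := by
  have h1 : HasFDerivAt (fun z => weight B z / ρ - 1) _ z :=
    ((weight_hasFDerivAt B z).mul_const ρ⁻¹).sub_const 1
  have h2 : HasFDerivAt (barrier N B ρ) _ z :=
    ((hasDerivAt_posPart_sq _).comp_hasFDerivAt z h1).const_mul N
  refine h2.congr_fderiv ?_
  rw [smul_smul, smul_smul]
  congr 1

end ContactHJ

namespace ContactHJ

open Filter Topology Set

variable {n : ℕ}

theorem weight_pos (B : ℝ) (z : Rn n × ℝ) : 0 < weight B z := by unfold weight; positivity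

theorem barrier_nonneg {N : ℝ} (hN : 0 ≤ N) (B ρ : ℝ) (z : Rn n × ℝ) : 0 ≤ barrier N B ρ z := by
  unfold barrier; positivity

theorem weight_lt_of_barrier_lt {N B ρ : ℝ} (hN : 0 ≤ N) (hρ : 0 < ρ) {z : Rn n × ℝ}
    (h : barrier N B ρ z < N) : weight B z < 2 * ρ := by
  by_contra! hle
  have h1 : 1 ≤ weight B z / ρ - 1 := by
    rw [le_sub_iff_add_le, le_div_iff₀ hρ]; linarith
  have h2 : 1 ≤ max (weight B z / ρ - 1) 0 := h1.trans (le_max_left _ _)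
  have h3 : N * 1 ≤ barrier N B ρ z := mul_le_mul_of_nonneg_left (one_le_pow₀ h2) hN
  linarith

theorem time_lt_of_weight_lt {B t₁ : ℝ} {x₀ : Rn n} (hB : 2 * (1 + ‖x₀‖ ^ 2) ≤ B)
    {z : Rn n × ℝ} (h : weight B z < 2 * weight B (x₀, t₁)) : z.2 < t₁ + 1 := by
  by_contra! hle
  have hB0 : 0 ≤ B := le_trans (by positivity) hB
  have h1 : Real.exp (B * (t₁ + 1)) ≤ Real.exp (B * z.2) := by
    apply Real.exp_le_exp.2; gcongr
  have h2 : 2 * (1 + ‖x₀‖ ^ 2) ≤ Real.exp B := by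
    have := Real.add_one_le_exp B
    linarith
  have h3 : 2 * weight B (x₀, t₁) ≤ Real.exp (B * (t₁ + 1)) := by
    rw [mul_add, Real.exp_add, mul_one, weight]
    have := mul_le_mul_of_nonneg_left h2 (Real.exp_pos (B * t₁)).le
    linarith
  have h4 : Real.exp (B * z.2) ≤ weight B z := by
    simp only [weight]; nlinarith [Real.exp_pos (B * z.2), sq_nonneg ‖z.1‖]
  linarith

theorem norm_le_weight {B : ℝ} (hB : 0 ≤ B) {z : Rn n × ℝ} (hz : 0 ≤ z.2) :
    1 + ‖z.1‖ ^ 2 ≤ weight B z ∧ ‖z.1‖ ≤ weight B z := by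
  have h1 : 1 ≤ Real.exp (B * z.2) := Real.one_le_exp (by positivity)
  have h2 : 1 + ‖z.1‖ ^ 2 ≤ weight B z := by
    simp only [weight]; nlinarith [sq_nonneg ‖z.1‖]
  exact ⟨h2, by nlinarith [sq_nonneg (‖z.1‖ - 1)]⟩

theorem speed_mul_weight_le {A B : ℝ} (hA : 0 ≤ A) (hB : 4 * A ≤ B) (z : Rn n × ℝ) :
    A * (1 + ‖z.1‖) * (2 * Real.exp (B * z.2) * ‖z.1‖) ≤ B * weight B z := by
  have h2 : (1 + ‖z.1‖) * (2 * ‖z.1‖) ≤ 4 * (1 + ‖z.1‖ ^ 2) := by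
    nlinarith [sq_nonneg (‖z.1‖ - 1)]
  have h5 := mul_le_mul_of_nonneg_left h2 hA
  have h6 := mul_le_mul_of_nonneg_right hB (by positivity : 0 ≤ 1 + ‖z.1‖ ^ 2)
  have h3 : A * ((1 + ‖z.1‖) * (2 * ‖z.1‖)) ≤ B * (1 + ‖z.1‖ ^ 2) := by linarith
  have h4 := mul_le_mul_of_nonneg_left h3 (Real.exp_pos (B * z.2)).le
  simp only [weight]
  linarith

theorem eventually_mem_slab {r T : ℝ} {z : Rn n × ℝ} (hx : ‖z.1‖ < r) (h0 : 0 < z.2)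
    (hT : z.2 < T) : ∀ᶠ y in 𝓝 z, ‖y.1‖ < r ∧ 0 < y.2 ∧ y.2 < T := by
  have h1 : ContinuousAt (fun y : Rn n × ℝ => ‖y.1‖) z := by fun_prop
  have h2 : ContinuousAt (fun y : Rn n × ℝ => y.2) z := by fun_prop
  filter_upwards [h1.eventually (gt_mem_nhds hx), h2.eventually (lt_mem_nhds h0),
    h2.eventually (gt_mem_nhds hT)] with y a b c
  exact ⟨a, b, c⟩

/-- Jets at a maximum of the doubled functional used for comparison. -/
theorem jets_of_doubling_max {w₁ w₂ χ : Rn n × ℝ → ℝ} {C δ σ m : ℝ} {z z' : Rn n × ℝ}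
    {q : Rn n} {b : ℝ} (hδ : 0 < δ) (hχ : HasFDerivAt χ (jet q b) z)
    (hm : Real.exp (-C * z.2) * (w₁ z - w₂ z') - sqNorm (z - z') / (2 * δ) - χ z - σ * z.2 = m)
    (h₁ : ∀ᶠ y in 𝓝 z,
      Real.exp (-C * y.2) * (w₁ y - w₂ z') - sqNorm (y - z') / (2 * δ) - χ y - σ * y.2 ≤ m)
    (h₂ : ∀ᶠ y in 𝓝 z',
      Real.exp (-C * z.2) * (w₁ z - w₂ y) - sqNorm (z - y) / (2 * δ) - χ z - σ * z.2 ≤ m) :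
    SuperJet w₁ z (jet (Real.exp (C * z.2) • (δ⁻¹ • (z.1 - z'.1) + q))
      (C * (w₁ z - w₂ z') + Real.exp (C * z.2) * (δ⁻¹ * (z.2 - z'.2) + b + σ))) ∧
    SubJet w₂ z' (jet (Real.exp (C * z.2) • (δ⁻¹ • (z.1 - z'.1)))
      (Real.exp (C * z.2) * (δ⁻¹ * (z.2 - z'.2)))) := by
  have hexp : ∀ t : ℝ, Real.exp (C * t) * Real.exp (-C * t) = 1 := fun t => by
    rw [← Real.exp_add]; simp
  constructor
  · have hE : HasFDerivAt (fun y : Rn n × ℝ => Real.exp (C * y.2)) _ z :=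
      ((hasFDerivAt_snd (𝕜 := ℝ) (p := z)).const_mul C).exp
    have hR : HasFDerivAt (fun y : Rn n × ℝ =>
        m + sqNorm (y - z') * (2 * δ)⁻¹ + χ y + σ * y.2) _ z :=
      ((((sqNorm_sub_hasFDerivAt z' z).mul_const (2 * δ)⁻¹).const_add m).add hχ).add
        ((hasFDerivAt_snd (𝕜 := ℝ) (p := z)).const_mul σ)
    have hf : HasFDerivAt (fun y : Rn n × ℝ => w₂ z' + Real.exp (C * y.2) *
        (m + sqNorm (y - z') * (2 * δ)⁻¹ + χ y + σ * y.2)) _ z := (hE.mul hR).const_add (w₂ z')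
    have hval : Real.exp (C * z.2) * (m + sqNorm (z - z') * (2 * δ)⁻¹ + χ z + σ * z.2)
        = w₁ z - w₂ z' := by
      have : m + sqNorm (z - z') * (2 * δ)⁻¹ + χ z + σ * z.2
        = Real.exp (-C * z.2) * (w₁ z - w₂ z') := by rw [← hm]; ring
      rw [this, ← mul_assoc, hexp, one_mul]
    have h := SuperJet.mono (w := w₁) hf.superJet (by rw [hval]; ring) (by
      filter_upwards [h₁] with y hy
      have h3 : w₁ y - w₂ z' ≤
          Real.exp (C * y.2) * (m + sqNorm (y - z') * (2 * δ)⁻¹ + χ y + σ * y.2) := by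
        have : Real.exp (-C * y.2) * (w₁ y - w₂ z')
          ≤ m + sqNorm (y - z') * (2 * δ)⁻¹ + χ y + σ * y.2 := by
          rw [← div_eq_mul_inv]; linarith
        calc w₁ y - w₂ z' = Real.exp (C * y.2) * (Real.exp (-C * y.2) * (w₁ y - w₂ z')) := by
              rw [← mul_assoc, hexp, one_mul]
          _ ≤ _ := by gcongr
      linarith)
    convert h using 1
    refine ContinuousLinearMap.ext fun y => ?_
    have e : C * (w₁ z - w₂ z') = C * (Real.exp (C * z.2) *
        (m + sqNorm (z - z') * (2 * δ)⁻¹ + χ z + σ * z.2)) := by rw [hval]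
    simp [inner_smul_left, inner_add_left, e]
    field_simp
    ring
  · have hR : HasFDerivAt (fun y : Rn n × ℝ =>
        w₁ z - Real.exp (C * z.2) * (m + sqNorm (y - z) * (2 * δ)⁻¹ + χ z + σ * z.2)) _ z' :=
      ((((((sqNorm_sub_hasFDerivAt z z').mul_const (2 * δ)⁻¹).const_add m).add_const
        (χ z)).add_const (σ * z.2)).const_mul (Real.exp (C * z.2))).const_sub (w₁ z)
    have hsymm : ∀ y : Rn n × ℝ, sqNorm (y - z) = sqNorm (z - y) := fun y => by
      simp only [sqNorm, Prod.fst_sub, Prod.snd_sub]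
      rw [norm_sub_rev]; ring
    have h := SubJet.mono (w := w₂) hR.subJet (by
      have : m + sqNorm (z' - z) * (2 * δ)⁻¹ + χ z + σ * z.2
        = Real.exp (-C * z.2) * (w₁ z - w₂ z') := by rw [← hm, hsymm]; ring
      rw [this, ← mul_assoc, hexp, one_mul]; ring) (by
      filter_upwards [h₂] with y hy
      have h3 : w₁ z - w₂ y ≤
          Real.exp (C * z.2) * (m + sqNorm (y - z) * (2 * δ)⁻¹ + χ z + σ * z.2) := by
        have : Real.exp (-C * z.2) * (w₁ z - w₂ y)
          ≤ m + sqNorm (y - z) * (2 * δ)⁻¹ + χ z + σ * z.2 := by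
          rw [← div_eq_mul_inv, hsymm]; linarith
        calc w₁ z - w₂ y = Real.exp (C * z.2) * (Real.exp (-C * z.2) * (w₁ z - w₂ y)) := by
              rw [← mul_assoc, hexp, one_mul]
          _ ≤ _ := by gcongr
      linarith)
    convert h using 1
    refine ContinuousLinearMap.ext fun y => ?_
    simp [inner_smul_left, inner_sub_left]
    field_simp
    ring

set_option maxHeartbeats 1600000 in
/-- Local comparison: the inequalities are only used on a ball whose radius depends on the
propagation speed, the time horizon and the point, but not on the functions compared. -/
theorem exists_radius_comparison {A : ℝ} (hA : 0 ≤ A) (x₀ : Rn n) {t₁ T : ℝ} (ht₁ : 0 ≤ t₁)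
    (hT : t₁ ≤ T) : ∃ r : ℝ, 0 < r ∧ ∀ {G : Hamiltonian n} {K C η₁ η₂ δ₀ : ℝ}
      {w₁ w₂ : Rn n × ℝ → ℝ}, 0 ≤ K → 0 ≤ C → 0 ≤ η₁ → 0 ≤ η₂ → 0 ≤ δ₀ →
      Continuous (fun z : Rn n × Rn n × ℝ => G z.1 z.2.1 z.2.2) →
      (∀ x p q u, ‖p‖ ≤ K → ‖q‖ ≤ K → |G x p u - G x q u| ≤ A * (1 + ‖x‖) * ‖p - q‖) →
      (∀ x p u u', |G x p u - G x p u'| ≤ C * |u - u'|) →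
      LipOnStrip K (T + 2) w₁ → LipOnStrip K (T + 2) w₂ →
      (∀ x, ‖x‖ ≤ r → w₁ (x, 0) ≤ w₂ (x, 0) + δ₀) →
      (∀ z : Rn n × ℝ, ‖z.1‖ ≤ r → 0 < z.2 → z.2 < T + 2 → ∀ p a,
        SuperJet w₁ z (jet p a) → a + G z.1 p (w₁ z) ≤ η₁) →
      (∀ z : Rn n × ℝ, ‖z.1‖ ≤ r → 0 < z.2 → z.2 < T + 2 → ∀ p a,
        SubJet w₂ z (jet p a) → -η₂ ≤ a + G z.1 p (w₂ z)) →
      w₁ (x₀, t₁) - w₂ (x₀, t₁) ≤ Real.exp (C * t₁) * (δ₀ + (η₁ + η₂) * t₁) := by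
  set B : ℝ := 4 * A + 2 * (1 + ‖x₀‖ ^ 2) with hB
  have hB0 : 0 < B := by positivity
  set ρ : ℝ := weight B (x₀, t₁) with hρdef
  have hρ1 : 1 + ‖x₀‖ ^ 2 ≤ ρ ∧ ‖x₀‖ ≤ ρ := norm_le_weight (z := (x₀, t₁)) hB0.le ht₁
  have hρ : 0 < ρ := weight_pos _ _
  refine ⟨2 * ρ + 1, by positivity, ?_⟩
  intro G K C η₁ η₂ δ₀ w₁ w₂ hK hC hη₁ hη₂ hδ₀ hG hGp hGu hw₁ hw₂ hinit hsub hsuper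
  by_contra! hcon
  -- a positive gap remains after adding a small slope
  have hgap : 0 < Real.exp (-C * t₁) * (w₁ (x₀, t₁) - w₂ (x₀, t₁)) - (δ₀ + (η₁ + η₂) * t₁) := by
    have h1 : Real.exp (-C * t₁) * Real.exp (C * t₁) = 1 := by rw [← Real.exp_add]; simp
    have h2 := mul_lt_mul_of_pos_left hcon (Real.exp_pos (-C * t₁))
    rw [← mul_assoc, h1, one_mul] at h2
    linarith
  obtain ⟨β, hβ, m₀, hm₀, hm₀eq⟩ : ∃ β > 0, ∃ m₀ > 0, m₀ =
      Real.exp (-C * t₁) * (w₁ (x₀, t₁) - w₂ (x₀, t₁)) - δ₀ - (η₁ + η₂ + β) * t₁ := by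
    set g := Real.exp (-C * t₁) * (w₁ (x₀, t₁) - w₂ (x₀, t₁)) - (δ₀ + (η₁ + η₂) * t₁)
    refine ⟨g / (2 * (t₁ + 1)), by positivity, g / 2 + g / (2 * (t₁ + 1)), by positivity, ?_⟩
    have : g / (2 * (t₁ + 1)) * t₁ = g / 2 - g / (2 * (t₁ + 1)) := by field_simp; ring
    rw [add_mul, this]
    simp only [g]; ring
  have hT2 : 0 ≤ T := ht₁.trans hT
  set N : ℝ := 2 * K * (T + 1) + K + 1 with hN
  have hN0 : 0 < N := by positivity
  -- uniform continuity in the space variable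
  set U : ℝ := |w₂ (0, 0)| + K * (2 * ρ + 1 + (T + 2)) with hU
  obtain ⟨d₀, hd₀, hunif⟩ : ∃ d₀ > 0, ∀ x y p : Rn n, ∀ u : ℝ, ‖x‖ ≤ 2 * ρ + 1 → ‖y‖ ≤ 2 * ρ + 1 →
      ‖p‖ ≤ K → |u| ≤ U → ‖x - y‖ < d₀ → |G x p u - G y p u| < β := by
    have hcomp : IsCompact ((Metric.closedBall (0 : Rn n) (2 * ρ + 1)) ×ˢ
        ((Metric.closedBall (0 : Rn n) K) ×ˢ (Metric.closedBall (0 : ℝ) U))) :=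
      (isCompact_closedBall _ _).prod ((isCompact_closedBall _ _).prod (isCompact_closedBall _ _))
    obtain ⟨d₀, hd₀, h⟩ := Metric.uniformContinuousOn_iff.1
      (hcomp.uniformContinuousOn_of_continuous hG.continuousOn) β hβ
    refine ⟨d₀, hd₀, fun x y p u hx hy hp hu hxy => ?_⟩
    refine h (x, p, u) (by simp [hx, hp, hu]) (y, p, u) (by simp [hy, hp, hu]) ?_
    simpa [Prod.dist_eq, dist_eq_norm, hd₀] using hxy
  set e : ℝ := min (1 / 2) (min (d₀ / 2) (m₀ / (8 * (K + 1)))) with he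
  have he0 : 0 < e := by positivity
  have he1 : e ≤ 1 / 2 := min_le_left _ _
  have he2 : e ≤ d₀ / 2 := (min_le_right _ _).trans (min_le_left _ _)
  have he3 : 2 * K * e ≤ m₀ / 4 := by
    have : e ≤ m₀ / (8 * (K + 1)) := (min_le_right _ _).trans (min_le_right _ _)
    rw [le_div_iff₀ (by positivity)] at this
    linarith
  set δ : ℝ := e / (4 * (K + 1)) with hδdef
  have hδ : 0 < δ := by positivity
  have hδe : 4 * K * δ ≤ e := by
    have : δ * (4 * (K + 1)) = e := by rw [hδdef]; field_simp
    linarith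
  -- the doubled functional
  set χ : Rn n × ℝ → ℝ := barrier N B ρ with hχ
  set σ := η₁ + η₂ + β with hσ
  let Ψ : (Rn n × ℝ) × (Rn n × ℝ) → ℝ := fun y =>
    Real.exp (-C * y.1.2) * (w₁ y.1 - w₂ y.2) - sqNorm (y.1 - y.2) / (2 * δ) - χ y.1 - σ * y.1.2
  let D : Set ((Rn n × ℝ) × (Rn n × ℝ)) :=
    (Metric.closedBall (0 : Rn n) (2 * ρ) ×ˢ Icc 0 (T + 1)) ×ˢ
      (Metric.closedBall (0 : Rn n) (2 * ρ + 1) ×ˢ Icc 0 (T + 2))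
  have hDc : IsCompact D := ((isCompact_closedBall _ _).prod isCompact_Icc).prod
    ((isCompact_closedBall _ _).prod isCompact_Icc)
  have hχc : Continuous χ := continuous_iff_continuousAt.2 fun z =>
    (barrier_hasFDerivAt N B ρ z).continuousAt
  have hΨc : ContinuousOn Ψ D := by
    have c1 : ContinuousOn (fun y : (Rn n × ℝ) × (Rn n × ℝ) => w₁ y.1) D :=
      (hw₁.continuousOn hK).comp continuousOn_fst
        fun y hy => ⟨hy.1.2.1, hy.1.2.2.trans (by linarith)⟩
    have c2 : ContinuousOn (fun y : (Rn n × ℝ) × (Rn n × ℝ) => w₂ y.2) D :=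
      (hw₂.continuousOn hK).comp continuousOn_snd fun y hy => hy.2.2
    have c3 := (sqNorm_contDiff (n := n)).continuous
    simp only [Ψ]
    refine ((ContinuousOn.mul ?_ (c1.sub c2)).sub ?_).sub ?_ |>.sub ?_ <;> fun_prop
  have hz₁D : ((x₀, t₁), (x₀, t₁)) ∈ D := by
    have hx : ‖x₀‖ ≤ 2 * ρ := by linarith
    exact ⟨⟨by simpa using hx, ht₁, by linarith⟩, ⟨by simpa using by linarith, ht₁, by linarith⟩⟩
  obtain ⟨⟨z, z'⟩, hzD, hmax⟩ := hDc.exists_isMaxOn ⟨_, hz₁D⟩ hΨc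
  obtain ⟨⟨hx, ht0, htT⟩, ⟨hy, hs0, hsT⟩⟩ := hzD
  have hx : ‖z.1‖ ≤ 2 * ρ := by simpa using hx
  have hexp1 : Real.exp (-C * z.2) ≤ 1 := Real.exp_le_one_iff.2 (by
    have : 0 ≤ C * z.2 := mul_nonneg hC ht0
    linarith)
  have hexp0 := Real.exp_pos (-C * z.2)
  have hχ0 : ∀ y, 0 ≤ χ y := fun y => barrier_nonneg hN0.le B ρ y
  have hsq0 : 0 ≤ sqNorm (z - z') := by unfold sqNorm; positivity
  -- the two points are close
  set d := ‖z - z'‖ with hd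
  have hdx : ‖z.1 - z'.1‖ ≤ d := norm_fst_le (z - z')
  have hdt : |z.2 - z'.2| ≤ d := norm_snd_le (z - z')
  have hd0 : 0 ≤ d := norm_nonneg _
  have hde : d ≤ e := by
    have h1 : Ψ (z, z) ≤ Ψ (z, z') := hmax (show (z, z) ∈ D from
      ⟨⟨by simpa using hx, ht0, htT⟩, ⟨by simpa using by linarith, ht0, by linarith⟩⟩)
    simp only [Ψ, sub_self, sqNorm_zero, zero_div, sub_zero] at h1
    have h2 := (abs_le.1 (hw₂ z z' ht0 (by linarith) hs0 hsT)).2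
    have h3 : sqNorm (z - z') / (2 * δ) ≤ Real.exp (-C * z.2) * (w₂ z - w₂ z') := by
      rw [mul_sub] at h1 ⊢; rw [mul_sub] at h1; linarith
    have h4 : Real.exp (-C * z.2) * (w₂ z - w₂ z') ≤ 2 * K * d := by
      have h5 : K * (‖z.1 - z'.1‖ + |z.2 - z'.2|) ≤ K * (d + d) := by gcongr
      have h6 : 0 ≤ 2 * K * d := by positivity
      calc Real.exp (-C * z.2) * (w₂ z - w₂ z') ≤ Real.exp (-C * z.2) * (2 * K * d) := by
            gcongr; linarith
        _ ≤ 1 * (2 * K * d) := by gcongr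
        _ = _ := one_mul _
    have h5 := norm_sq_le_sqNorm (z - z')
    have h6 : d ^ 2 ≤ 4 * K * δ * d := by
      have := h3.trans h4
      rw [div_le_iff₀ (by positivity)] at this
      linarith
    by_contra! hlt
    have hdpos : 0 < d := he0.trans hlt
    rw [sq] at h6
    linarith [le_of_mul_le_mul_right h6 hdpos]
  have hΨ : m₀ + δ₀ ≤ Ψ (z, z') := by
    have h1 : Ψ ((x₀, t₁), (x₀, t₁)) ≤ Ψ (z, z') := hmax hz₁D
    have hχz : χ (x₀, t₁) = 0 := by
      have : weight B (x₀, t₁) / ρ = 1 := by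
        rw [div_eq_one_iff_eq hρ.ne']
      simp [hχ, barrier, this]
    simp only [Ψ, sub_self, sqNorm_zero, zero_div, sub_zero, hχz] at h1
    simp only [Ψ]
    linarith
  have hdiff : m₀ + δ₀ + χ z ≤ Real.exp (-C * z.2) * (w₁ z - w₂ z') := by
    have h1 : 0 ≤ sqNorm (z - z') / (2 * δ) := by positivity
    have h2 : 0 ≤ σ * z.2 := by positivity
    simp only [Ψ] at hΨ
    linarith
  have hwpos : 0 < w₁ z - w₂ z' := by
    have : 0 < Real.exp (-C * z.2) * (w₁ z - w₂ z') := by linarith [hχ0 z]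
    exact (mul_pos_iff_of_pos_left hexp0).1 this
  have hupper : w₁ z - w₂ z' ≤ δ₀ + 2 * K * z.2 + 2 * K * d := by
    have h1 := (abs_le.1 (hw₁ z (z.1, 0) ht0 (by linarith) le_rfl (by simp; linarith))).2
    have h2 := (abs_le.1 (hw₂ (z.1, 0) z le_rfl (by simp; linarith) ht0 (by linarith))).2
    have h3 := (abs_le.1 (hw₂ z z' ht0 (by linarith) hs0 hsT)).2
    have h4 := hinit z.1 (by linarith)
    simp only [sub_self, norm_zero, sub_zero, zero_sub, abs_neg, abs_of_nonneg ht0, zero_add]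
      at h1 h2
    have h5 : K * (‖z.1 - z'.1‖ + |z.2 - z'.2|) ≤ K * (d + d) := by gcongr
    linarith
  have hchain : m₀ + χ z ≤ 2 * K * z.2 + 2 * K * d := by
    have : Real.exp (-C * z.2) * (w₁ z - w₂ z') ≤ 1 * (w₁ z - w₂ z') := by gcongr
    linarith
  have hKd : 2 * K * d ≤ 2 * K * e := by gcongr
  have ht : 0 < z.2 := by
    by_contra! hle
    have : z.2 = 0 := le_antisymm hle ht0
    rw [this] at hchain
    linarith [hχ0 z]
  have hs : 0 < z'.2 := by
    by_contra! hle
    have h0 : z'.2 = 0 := le_antisymm hle hs0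
    have h1 := (abs_le.1 hdt).2
    rw [h0, sub_zero] at h1
    have : 2 * K * z.2 ≤ 2 * K * d := by gcongr
    linarith [hχ0 z]
  have hχN : χ z < N := by
    have h1 : 2 * K * z.2 ≤ 2 * K * (T + 1) := by gcongr
    have h2 : 2 * K * d ≤ 2 * K * (1 / 2) := by gcongr; linarith
    linarith
  have hψ : weight B z < 2 * ρ := weight_lt_of_barrier_lt hN0.le hρ hχN
  have htT' : z.2 < T + 1 := by
    have := time_lt_of_weight_lt (by linarith) hψ
    linarith
  have hxlt : ‖z.1‖ < 2 * ρ := (norm_le_weight hB0.le ht0).2.trans_lt hψ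
  have hylt : ‖z'.1‖ < 2 * ρ + 1 := by
    have : ‖z'.1‖ ≤ ‖z.1‖ + ‖z.1 - z'.1‖ := by
      calc ‖z'.1‖ = ‖z.1 - (z.1 - z'.1)‖ := by congr 1; abel
        _ ≤ _ := norm_sub_le _ _
    linarith
  have hsT' : z'.2 < T + 2 := by
    have := (abs_le.1 hdt).1
    linarith
  -- the jets at the maximum
  set c : ℝ := N * (2 * max (weight B z / ρ - 1) 0) / ρ with hc
  have hc0 : 0 ≤ c := by positivity
  have hχd : HasFDerivAt χ (jet (c • (2 * Real.exp (B * z.2)) • z.1) (c * (B * weight B z))) z := by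
    refine (barrier_hasFDerivAt N B ρ z).congr_fderiv ?_
    refine ContinuousLinearMap.ext fun y => ?_
    simp [inner_smul_left, ← hc]
    ring
  obtain ⟨hj₁, hj₂⟩ := jets_of_doubling_max (w₁ := w₁) (w₂ := w₂) (C := C) (σ := σ) hδ hχd rfl
    (by
      filter_upwards [eventually_mem_slab hxlt ht htT'] with y hy'
      exact hmax (show (y, z') ∈ D from
        ⟨⟨by simpa using hy'.1.le, hy'.2.1.le, hy'.2.2.le⟩, ⟨hy, hs0, hsT⟩⟩))
    (by
      filter_upwards [eventually_mem_slab hylt hs hsT'] with y hy'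
      exact hmax (show (z, y) ∈ D from
        ⟨⟨by simpa using hx, ht0, htT⟩, ⟨by simpa using hy'.1.le, hy'.2.1.le, hy'.2.2.le⟩⟩))
  set E := Real.exp (C * z.2) with hE
  have hE1 : 1 ≤ E := Real.one_le_exp (by positivity)
  have i1 := hsub z (by linarith) ht (by linarith) _ _ hj₁
  have i2 := hsuper z' hylt.le hs hsT' _ _ hj₂
  have k1 := (hj₁.norm_le hK hw₁ ht (by linarith)).1
  have k2 := (hj₂.norm_le hK hw₂ hs hsT').1
  set p₁ := E • (δ⁻¹ • (z.1 - z'.1) + c • (2 * Real.exp (B * z.2)) • z.1) with hp₁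
  set p₂ := E • (δ⁻¹ • (z.1 - z'.1)) with hp₂
  have g1 := (abs_le.1 (hGp z.1 p₁ p₂ (w₁ z) k1 k2)).1
  have g2 := (abs_le.1 (hGu z.1 p₂ (w₁ z) (w₂ z'))).1
  rw [abs_of_pos hwpos] at g2
  have g3 := (abs_lt.1 (hunif z.1 z'.1 p₂ (w₂ z') (by linarith) hylt.le k2 (by
    have h1 := hw₂ z' (0, 0) hs0 hsT le_rfl (by simp; linarith)
    have h2 : |w₂ z'| ≤ |w₂ z' - w₂ (0, 0)| + |w₂ (0, 0)| := by
      simpa using abs_add_le (w₂ z' - w₂ (0, 0)) (w₂ (0, 0))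
    simp only [sub_zero, abs_of_pos hs] at h1
    have h3 : K * (‖z'.1‖ + z'.2) ≤ K * (2 * ρ + 1 + (T + 2)) := by gcongr
    linarith) (by linarith))).1
  have hpd : ‖p₁ - p₂‖ = E * (c * (2 * Real.exp (B * z.2) * ‖z.1‖)) := by
    have : p₁ - p₂ = E • c • (2 * Real.exp (B * z.2)) • z.1 := by
      rw [hp₁, hp₂, smul_add, add_sub_cancel_left]
    rw [this, norm_smul, norm_smul, norm_smul, Real.norm_eq_abs, Real.norm_eq_abs,
      Real.norm_eq_abs, abs_of_nonneg hc0, abs_of_pos (by positivity : 0 < E),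
      abs_of_pos (by positivity : 0 < 2 * Real.exp (B * z.2))]
  have hspeed : A * (1 + ‖z.1‖) * ‖p₁ - p₂‖ ≤ E * (c * (B * weight B z)) := by
    rw [hpd]
    have h1 := speed_mul_weight_le hA (by linarith [sq_nonneg ‖x₀‖] : 4 * A ≤ B) z
    calc A * (1 + ‖z.1‖) * (E * (c * (2 * Real.exp (B * z.2) * ‖z.1‖)))
        = E * (c * (A * (1 + ‖z.1‖) * (2 * Real.exp (B * z.2) * ‖z.1‖))) := by ring
      _ ≤ _ := by gcongr
  have hσ1 : σ ≤ E * σ := by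
    have : 0 ≤ σ := by positivity
    exact le_mul_of_one_le_left this hE1
  rw [mul_add, mul_add] at i1
  linarith

end ContactHJ

namespace ContactHJ

open Filter Topology Set

variable {n : ℕ}

theorem SubJet.norm_momentum_le {w : Rn n × ℝ → ℝ} {z : Rn n × ℝ} {p : Rn n} {a K : ℝ}
    (hj : SubJet w z (jet p a)) (hK : 0 ≤ K)
    (h : ∀ x, |w (x, z.2) - w z| ≤ K * ‖x - z.1‖) : ‖p‖ ≤ K := by
  have h1 : jet p a (p, 0) ≤ K * ‖p‖ := by
    refine hj.apply_le (p, 0) ?_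
    filter_upwards [self_mem_nhdsWithin] with s hs
    have hs : 0 < s := hs
    have h2 := (abs_le.1 (h (z.1 + s • p))).2
    have h3 : z + s • ((p, 0) : Rn n × ℝ) = (z.1 + s • p, z.2) := by ext <;> simp
    rw [h3]
    rw [add_sub_cancel_left, norm_smul, Real.norm_eq_abs, abs_of_pos hs] at h2
    linarith
  simp only [jet_apply, real_inner_self_eq_norm_sq, mul_zero, add_zero, sq] at h1
  rcases eq_or_ne p 0 with rfl | hp
  · simpa using hK
  · exact le_of_mul_le_mul_right h1 (norm_pos_iff.2 hp)

theorem SuperJet.norm_momentum_le {w : Rn n × ℝ → ℝ} {z : Rn n × ℝ} {p : Rn n} {a K : ℝ}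
    (hj : SuperJet w z (jet p a)) (hK : 0 ≤ K)
    (h : ∀ x, |w (x, z.2) - w z| ≤ K * ‖x - z.1‖) : ‖p‖ ≤ K := by
  rw [superJet_iff_subJet_neg, neg_jet] at hj
  have := hj.norm_momentum_le hK (fun x => by
    have := h x
    rwa [neg_sub_neg, abs_sub_comm])
  simpa using this

theorem SuperJet.of_comp_add {V : Type*} [NormedAddCommGroup V] [NormedSpace ℝ V] {w : V → ℝ}
    {z c : V} {ℓ : V →L[ℝ] ℝ} (hj : SuperJet (fun z => w (z + c)) z ℓ) :
    SuperJet w (z + c) ℓ := by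
  intro ε hε
  have ht : Tendsto (fun y => y - c) (𝓝 (z + c)) (𝓝 z) := by
    have : Continuous fun y : V => y - c := by fun_prop
    simpa using this.tendsto (z + c)
  filter_upwards [ht.eventually (hj ε hε)] with y hy
  simpa [sub_sub, add_comm] using hy

theorem SubJet.of_comp_add {V : Type*} [NormedAddCommGroup V] [NormedSpace ℝ V] {w : V → ℝ}
    {z c : V} {ℓ : V →L[ℝ] ℝ} (hj : SubJet (fun z => w (z + c)) z ℓ) :
    SubJet w (z + c) ℓ := by
  rw [subJet_iff_superJet_neg] at hj ⊢
  exact hj.of_comp_add (w := fun z => -w z)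

/-- A function that is `M`-Lipschitz at small scales is `M`-Lipschitz. -/
theorem abs_sub_le_of_local {E : Type*} [NormedAddCommGroup E] [NormedSpace ℝ E] {f : E → ℝ}
    {M d : ℝ} (hd : 0 < d) (h : ∀ x y, ‖x - y‖ < d → |f x - f y| ≤ M * ‖x - y‖) (x y : E) :
    |f x - f y| ≤ M * ‖x - y‖ := by
  obtain ⟨N, hN⟩ := exists_nat_gt (‖x - y‖ / d)
  have hN0 : (0 : ℝ) < N := lt_of_le_of_lt (by positivity) hN
  have hstep : ‖x - y‖ / N < d := by
    rw [div_lt_iff₀ hd] at hN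
    rw [div_lt_iff₀ hN0]; linarith
  have key : ∀ k : ℕ, |f (y + (k / N : ℝ) • (x - y)) - f y| ≤ k * (M * (‖x - y‖ / N)) := by
    intro k
    induction k with
    | zero => simp
    | succ k ih =>
      have e : y + (((k + 1 : ℕ) : ℝ) / N) • (x - y) - (y + (k / N : ℝ) • (x - y))
          = (1 / N : ℝ) • (x - y) := by
        push_cast; module
      have en : ‖y + (((k + 1 : ℕ) : ℝ) / N) • (x - y) - (y + (k / N : ℝ) • (x - y))‖
          = ‖x - y‖ / N := by
        rw [e, norm_smul, Real.norm_eq_abs, abs_of_pos (by positivity)]; ring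
      have h1 := h _ _ (en ▸ hstep)
      rw [en] at h1
      have h2 := abs_sub_le (f (y + (((k + 1 : ℕ) : ℝ) / N) • (x - y)))
        (f (y + (k / N : ℝ) • (x - y))) (f y)
      push_cast at *
      linarith
  have := key N
  rw [div_self hN0.ne', one_smul, add_sub_cancel] at this
  calc _ ≤ _ := this
    _ = _ := by field_simp

/-- A Lipschitz function whose superjets have momenta bounded by `R` is `R`-Lipschitz in space. -/
theorem abs_sub_le_of_superJet_momentum_le {w : Rn n × ℝ → ℝ} {K T R t : ℝ} (hK : 0 ≤ K)
    (hw : LipOnStrip K T w) (ht : 0 < t) (htT : t < T)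
    (hj : ∀ z : Rn n × ℝ, 0 < z.2 → z.2 < T → ∀ p a, SuperJet w z (jet p a) → ‖p‖ ≤ R)
    (x y : Rn n) : |w (x, t) - w (y, t)| ≤ R * ‖x - y‖ := by
  set d := min t (T - t) / 2 with hd
  have hd0 : 0 < d := by
    have : 0 < T - t := by linarith
    positivity
  have hd1 : d ≤ t / 2 := by have := min_le_left t (T - t); linarith
  have hd2 : d ≤ (T - t) / 2 := by have := min_le_right t (T - t); linarith
  refine abs_sub_le_of_local (f := fun x => w (x, t)) hd0 (fun x y hxy => ?_) x y
  refine le_of_forall_pos_le_add fun ε hε => ?_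
  set κ := min (d / 2) (ε / (2 * (2 * K + 1))) with hκ
  have hκ0 : 0 < κ := by positivity
  have hκ1 : κ ≤ d / 2 := min_le_left _ _
  have hκ2 : 2 * (2 * K * κ) ≤ ε := by
    have : κ ≤ ε / (2 * (2 * K + 1)) := min_le_right _ _
    rw [le_div_iff₀ (by positivity)] at this
    linarith
  have hball : ∀ z ∈ Metric.ball (x, t) (d + κ), 0 < z.2 ∧ z.2 < T := by
    intro z hz
    have h1 : |z.2 - t| < d + κ := lt_of_le_of_lt (le_max_right _ _) hz
    have := abs_lt.1 h1
    constructor <;> linarith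
  have hsub : Metric.ball (x, t) (d + κ) ⊆ {z : Rn n × ℝ | z.2 ∈ Icc 0 T} := fun z hz =>
    ⟨(hball z hz).1.le, (hball z hz).2.le⟩
  let S : Set (Rn n × ℝ →L[ℝ] ℝ) := momentum ⁻¹' Metric.closedBall 0 R
  have hScl : IsClosed S := Metric.isClosed_closedBall.preimage momentum_continuous
  have hSc : Convex ℝ S := by
    intro ℓ₁ h₁ ℓ₂ h₂ s t hs ht hst
    change momentum (s • ℓ₁ + t • ℓ₂) ∈ Metric.closedBall (0 : Rn n) R
    rw [momentum_add_smul]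
    exact convex_closedBall 0 R h₁ h₂ hs ht hst
  obtain ⟨f, hf1, hf2⟩ := exists_differentiable_approx hκ0
    ((hw.lipschitzOnWith hK).mono hsub) hSc hScl (fun z hz hz' => by
      obtain ⟨p, a, hpa⟩ := exists_eq_jet (fderiv ℝ w z)
      have h1 := hz'.hasFDerivAt
      rw [hpa] at h1 ⊢
      have := hj z (hball z hz).1 (hball z hz).2 p a h1.superJet
      change momentum (jet p a) ∈ Metric.closedBall (0 : Rn n) R
      simpa using this)
  rw [Real.coe_toNNReal _ (by positivity)] at hf2
  have hmem : ∀ y' ∈ Metric.ball x d, (y', t) ∈ Metric.ball (x, t) d := by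
    intro y' hy'
    rw [Metric.mem_ball, Prod.dist_eq]
    simpa [hd0] using hy'
  have hyx : y ∈ Metric.ball x d := by rwa [Metric.mem_ball, dist_comm, dist_eq_norm]
  have hmv : ‖f (x, t) - f (y, t)‖ ≤ R * ‖x - y‖ := by
    choose! ℓ hℓS hℓ using hf1
    refine (convex_ball x d).norm_image_sub_le_of_norm_hasFDerivWithin_le
      (f := fun y => f (y, t))
      (f' := fun y => (ℓ (y, t)).comp (ContinuousLinearMap.inl ℝ (Rn n) ℝ)) ?_ ?_ hyx
      (Metric.mem_ball_self hd0)
    · intro y' hy'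
      have h1 : HasFDerivAt (fun y : Rn n => (y, t)) (ContinuousLinearMap.inl ℝ (Rn n) ℝ) y' :=
        (hasFDerivAt_id y').prodMk (hasFDerivAt_const t y')
      exact (HasFDerivAt.comp (g := f) (f := fun y : Rn n => (y, t)) y' (hℓ _ (hmem y' hy'))
        h1).hasFDerivWithinAt
    · intro y' hy'
      have h1 : ‖momentum (ℓ (y', t))‖ ≤ R := by simpa [S] using hℓS _ (hmem y' hy')
      rwa [momentum, LinearIsometryEquiv.norm_map] at h1
  have h1 := abs_le.1 (hf2 _ (hmem x (Metric.mem_ball_self hd0)))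
  have h2 := abs_le.1 (hf2 _ (hmem y hyx))
  have h3 := abs_le.1 hmv
  rw [abs_le]
  constructor <;> linarith [h1.1, h1.2, h2.1, h2.2, h3.1, h3.2]

/-- Local Lipschitz continuity in the momentum, with constant growing linearly in `x`. -/
def LinearSpeed (G : Hamiltonian n) : Prop :=
  ∀ R : ℝ, ∃ A : ℝ, 0 ≤ A ∧ ∀ x p q u, ‖p‖ ≤ R → ‖q‖ ≤ R →
    |G x p u - G x q u| ≤ A * (1 + ‖x‖) * ‖p - q‖

theorem IsViscositySolution.initial_eq {G : Hamiltonian n} {u₀ : Rn n → ℝ} {w : Rn n → ℝ → ℝ}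
    (hw : IsViscositySolution G u₀ w) (x : Rn n) : w x 0 = u₀ x :=
  le_antisymm (hw.1.2 x) (hw.2.2 x)

section Estimates

variable {G : Hamiltonian n} {u₀ : Rn n → ℝ} {w : Rn n → ℝ → ℝ} {C C₀ K₀ : ℝ}

theorem abs_sub_initial_le
    (hG : Continuous fun z : Rn n × Rn n × ℝ => G z.1 z.2.1 z.2.2) (hGp : LinearSpeed G)
    (hC : 0 ≤ C) (hGu : ∀ x p u u', |G x p u - G x p u'| ≤ C * |u - u'|)
    (hK₀ : 0 ≤ K₀) (hu₀ : ∀ x y, |u₀ x - u₀ y| ≤ K₀ * ‖x - y‖)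
    (hC₀ : 0 ≤ C₀) (hGb : ∀ x p u, ‖p‖ ≤ K₀ → |G x p u| ≤ C₀)
    (hwL : IsLipschitzOnStrips w) (hw : IsViscositySolution G u₀ w) (x : Rn n) {t : ℝ}
    (ht : 0 ≤ t) : |w x t - u₀ x| ≤ C₀ * t := by
  obtain ⟨K, hK, hwK⟩ := hwL.exists_lipOnStrip (by linarith : 0 < t + 2)
  set K' := K + K₀ + C₀ with hK'
  obtain ⟨A, hA, hAG⟩ := hGp K'
  obtain ⟨r, -, hr⟩ := exists_radius_comparison hA x ht le_rfl
  have hwK' := hwK.mono (by linarith : K ≤ K') le_rfl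
  have hc := hwL.continuousOn
  have hlin : ∀ c : ℝ, |c| ≤ C₀ → LipOnStrip K' (t + 2) (fun z => u₀ z.1 + c * z.2) := by
    intro c hc z z' _ _ _ _
    have h1 := hu₀ z.1 z'.1
    have h2 : |c * (z.2 - z'.2)| ≤ C₀ * |z.2 - z'.2| := by rw [abs_mul]; gcongr
    have e : u₀ z.1 + c * z.2 - (u₀ z'.1 + c * z'.2) = (u₀ z.1 - u₀ z'.1) + c * (z.2 - z'.2) := by
      ring
    rw [e]
    refine (abs_add_le _ _).trans ?_
    nlinarith [norm_nonneg (z.1 - z'.1), abs_nonneg (z.2 - z'.2),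
      mul_nonneg hK (norm_nonneg (z.1 - z'.1)), mul_nonneg hK (abs_nonneg (z.2 - z'.2)),
      mul_nonneg hC₀ (norm_nonneg (z.1 - z'.1)), mul_nonneg hK₀ (abs_nonneg (z.2 - z'.2))]
  have hx0 : ∀ (c : ℝ) (z : Rn n × ℝ) (x : Rn n),
      |(u₀ x + c * z.2) - (u₀ z.1 + c * z.2)| ≤ K₀ * ‖x - z.1‖ := by
    intro c z x; simpa using hu₀ x z.1
  rw [abs_le]
  constructor
  · have h := hr (G := G) (K := K') (C := C) (η₁ := 0) (η₂ := 0) (δ₀ := 0)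
      (w₁ := fun z => u₀ z.1 + (-C₀) * z.2) (w₂ := fun z => w z.1 z.2)
      (by positivity) hC le_rfl le_rfl le_rfl hG hAG hGu (hlin _ (by simp [abs_of_nonneg hC₀]))
      hwK' (fun y _ => by simp [hw.initial_eq])
      (fun z _ h0 _ p a hj => by
        have hp := hj.norm_momentum_le hK₀ (hx0 _ z)
        have ha : -jet p a (0, -1) ≤ -C₀ := hj.apply_le (0, -1) (Eventually.of_forall fun s => by
          simp only [Prod.fst_add, Prod.snd_add, Prod.smul_fst, Prod.smul_snd, smul_zero, add_zero,
            smul_eq_mul]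
          linarith)
        simp at ha
        linarith [(abs_le.1 (hGb z.1 p (u₀ z.1 + (-C₀) * z.2) hp)).2])
      (fun z _ h0 _ p a hj => by
        have := hw.2.le_subJet hG hc h0 hj
        simpa using this)
    simp at h
    linarith
  · have h := hr (G := G) (K := K') (C := C) (η₁ := 0) (η₂ := 0) (δ₀ := 0)
      (w₂ := fun z => u₀ z.1 + C₀ * z.2) (w₁ := fun z => w z.1 z.2)
      (by positivity) hC le_rfl le_rfl le_rfl hG hAG hGu hwK' (hlin _ (by simp [abs_of_nonneg hC₀]))
      (fun y _ => by simp [hw.initial_eq])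
      (fun z _ h0 _ p a hj => hw.1.superJet_le hG hc h0 hj)
      (fun z _ h0 _ p a hj => by
        have hp := hj.norm_momentum_le hK₀ (hx0 _ z)
        have ha : jet p a (0, -1) ≤ -C₀ := hj.apply_le (0, -1) (Eventually.of_forall fun s => by
          simp only [Prod.fst_add, Prod.snd_add, Prod.smul_fst, Prod.smul_snd, smul_zero, add_zero,
            smul_eq_mul]
          linarith)
        simp at ha
        linarith [(abs_le.1 (hGb z.1 p (u₀ z.1 + C₀ * z.2) hp)).1])
    simp at h
    linarith

theorem abs_time_shift_le
    (hG : Continuous fun z : Rn n × Rn n × ℝ => G z.1 z.2.1 z.2.2) (hGp : LinearSpeed G)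
    (hC : 0 ≤ C) (hGu : ∀ x p u u', |G x p u - G x p u'| ≤ C * |u - u'|)
    (hK₀ : 0 ≤ K₀) (hu₀ : ∀ x y, |u₀ x - u₀ y| ≤ K₀ * ‖x - y‖)
    (hC₀ : 0 ≤ C₀) (hGb : ∀ x p u, ‖p‖ ≤ K₀ → |G x p u| ≤ C₀)
    (hwL : IsLipschitzOnStrips w) (hw : IsViscositySolution G u₀ w) (x : Rn n) {t s : ℝ}
    (ht : 0 ≤ t) (hs : 0 ≤ s) : |w x (t + s) - w x t| ≤ Real.exp (C * t) * (C₀ * s) := by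
  obtain ⟨K, hK, hwK⟩ := hwL.exists_lipOnStrip (by linarith : 0 < t + s + 2)
  obtain ⟨A, hA, hAG⟩ := hGp K
  obtain ⟨r, -, hr⟩ := exists_radius_comparison hA x ht le_rfl
  have hc := hwL.continuousOn
  have h0 := hwK.mono (T' := t + 2) le_rfl (by linarith)
  have h1 : LipOnStrip K (t + 2) (fun z => w (z + ((0 : Rn n), s)).1 (z + ((0 : Rn n), s)).2) := by
    intro z z' a b c d
    have := hwK (z + ((0 : Rn n), s)) (z' + ((0 : Rn n), s)) (by simp; linarith)
      (by simp; linarith) (by simp; linarith) (by simp; linarith)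
    simpa using this
  have hi : ∀ x, |w x s - u₀ x| ≤ C₀ * s := fun x =>
    abs_sub_initial_le hG hGp hC hGu hK₀ hu₀ hC₀ hGb hwL hw x hs
  rw [abs_le]
  constructor
  · have h := hr (G := G) (K := K) (C := C) (η₁ := 0) (η₂ := 0) (δ₀ := C₀ * s)
      (w₁ := fun z => w z.1 z.2) (w₂ := fun z => w (z + ((0 : Rn n), s)).1 (z + ((0 : Rn n), s)).2)
      hK hC le_rfl le_rfl (by positivity) hG hAG hGu h0 h1
      (fun y _ => by
        simp [hw.initial_eq]
        linarith [(abs_le.1 (hi y)).1])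
      (fun z _ h0 _ p a hj => hw.1.superJet_le hG hc h0 hj)
      (fun z _ h0 _ p a hj => by
        have := hw.2.le_subJet hG hc (z₀ := z + ((0 : Rn n), s)) (by simp; linarith)
          (SubJet.of_comp_add (w := fun z : Rn n × ℝ => w z.1 z.2) hj)
        simpa using this)
    simp at h
    linarith
  · have h := hr (G := G) (K := K) (C := C) (η₁ := 0) (η₂ := 0) (δ₀ := C₀ * s)
      (w₂ := fun z => w z.1 z.2) (w₁ := fun z => w (z + ((0 : Rn n), s)).1 (z + ((0 : Rn n), s)).2)
      hK hC le_rfl le_rfl (by positivity) hG hAG hGu h1 h0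
      (fun y _ => by
        simp [hw.initial_eq]
        linarith [(abs_le.1 (hi y)).2])
      (fun z _ h0 _ p a hj => by
        have := hw.1.superJet_le hG hc (z₀ := z + ((0 : Rn n), s)) (by simp; linarith)
          (SuperJet.of_comp_add (w := fun z : Rn n × ℝ => w z.1 z.2) hj)
        simpa using this)
      (fun z _ h0 _ p a hj => by
        have := hw.2.le_subJet hG hc h0 hj
        simpa using this)
    simp at h
    linarith

/-- A Lipschitz bound depending only on the structural constants of the Hamiltonian. -/
theorem lipOnStrip_of_isViscositySolution {T R : ℝ}
    (hG : Continuous fun z : Rn n × Rn n × ℝ => G z.1 z.2.1 z.2.2) (hGp : LinearSpeed G)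
    (hC : 0 ≤ C) (hGu : ∀ x p u u', |G x p u - G x p u'| ≤ C * |u - u'|)
    (hK₀ : 0 ≤ K₀) (hu₀ : ∀ x y, |u₀ x - u₀ y| ≤ K₀ * ‖x - y‖)
    (hC₀ : 0 ≤ C₀) (hGb : ∀ x p u, ‖p‖ ≤ K₀ → |G x p u| ≤ C₀)
    (hR : 0 ≤ R) (hGR : ∀ x p u, G x p u ≤ Real.exp (C * (T + 1)) * C₀ → ‖p‖ ≤ R)
    (hwL : IsLipschitzOnStrips w) (hw : IsViscositySolution G u₀ w) :
    LipOnStrip (K₀ + R + Real.exp (C * (T + 1)) * C₀) T (fun z => w z.1 z.2) := by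
  set C₁ := Real.exp (C * (T + 1)) * C₀ with hC₁
  have hC₁0 : 0 ≤ C₁ := by positivity
  have hc := hwL.continuousOn
  have htime0 : ∀ (x : Rn n) (t s : ℝ), 0 ≤ t → t ≤ s → s ≤ T + 1 → |w x s - w x t| ≤ C₁ * (s - t) := by
    intro x t s ht hts hsT
    have := abs_time_shift_le hG hGp hC hGu hK₀ hu₀ hC₀ hGb hwL hw x ht (sub_nonneg.2 hts)
    rw [add_sub_cancel, ← mul_assoc] at this
    refine this.trans ?_
    have h1 : 0 ≤ s - t := sub_nonneg.2 hts
    have h2 : t ≤ T + 1 := hts.trans hsT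
    rw [hC₁]
    gcongr
  have htime : ∀ (x : Rn n) (t s : ℝ), 0 ≤ t → 0 ≤ s → t ≤ T + 1 → s ≤ T + 1 →
      |w x s - w x t| ≤ C₁ * |s - t| := by
    intro x t s ht hs htT hsT
    rcases le_total t s with h | h
    · rw [abs_of_nonneg (sub_nonneg.2 h)]; exact htime0 x t s ht h hsT
    · rw [abs_sub_comm, abs_sub_comm s, abs_of_nonneg (sub_nonneg.2 h)]; exact htime0 x s t hs h htT
  have hspace : ∀ (x y : Rn n) (t : ℝ), 0 ≤ t → t ≤ T → |w x t - w y t| ≤ (K₀ + R) * ‖x - y‖ := by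
    intro x y t ht htT
    rcases ht.eq_or_lt with rfl | ht
    · rw [hw.initial_eq, hw.initial_eq]
      refine (hu₀ x y).trans ?_
      gcongr; linarith
    obtain ⟨K, hK, hwK⟩ := hwL.exists_lipOnStrip (by linarith : 0 < T + 1)
    have := abs_sub_le_of_superJet_momentum_le (R := R) hK hwK ht (by linarith)
      (fun z h0 hT p a hj => ?_) x y
    · refine this.trans ?_
      gcongr; linarith
    · have h1 := hw.1.superJet_le hG hc h0 hj
      have h2 : -jet p a (0, 1) ≤ C₁ := by
        refine hj.apply_le (0, 1) ?_
        filter_upwards [eventually_line_mem_Ioo h0 hT (0, 1)] with s hs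
        have h3 := htime z.1 z.2 (z + s • ((0 : Rn n), (1 : ℝ))).2 h0.le hs.2.1.le hT.le hs.2.2.le
        simp only [Prod.fst_add, Prod.snd_add, Prod.smul_fst, Prod.smul_snd, smul_zero, add_zero,
            smul_eq_mul, mul_one, add_sub_cancel_left, abs_of_pos hs.1] at h3 ⊢
        linarith [(abs_le.1 h3).1]
      simp at h2
      exact hGR z.1 p _ (by linarith)
  intro z z' h1 h2 h3 h4
  have e1 := hspace z.1 z'.1 z.2 h1 h2
  have e2 := htime z'.1 z'.2 z.2 h3 h1 (by linarith) (by linarith)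
  have e3 := abs_sub_le (w z.1 z.2) (w z'.1 z.2) (w z'.1 z'.2)
  have e4 : 0 ≤ C₁ * ‖z.1 - z'.1‖ := by positivity
  have e5 : 0 ≤ (K₀ + R) * |z.2 - z'.2| := by positivity
  calc _ ≤ _ := e3
    _ ≤ (K₀ + R) * ‖z.1 - z'.1‖ + C₁ * |z.2 - z'.2| := add_le_add e1 e2
    _ ≤ _ := by linarith

end Estimates

end ContactHJ

namespace ContactHJ

open Filter Topology Set

section Calculus

/-- The maximum over a compact set of a family of `C¹` functions is differentiable where the
maximizer is unique. -/
theorem hasFDerivAt_max_of_unique {Θ V : Type*} [NormedAddCommGroup Θ] [NormedSpace ℝ Θ]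
    [NormedAddCommGroup V] [NormedSpace ℝ V] {f : Θ × V → ℝ} (hf : ContDiff ℝ 1 f) {P : Set V}
    (hP : IsCompact P) {k : Θ → ℝ} (hle : ∀ θ, ∀ p ∈ P, f (θ, p) ≤ k θ)
    (hex : ∀ θ, ∃ p ∈ P, f (θ, p) = k θ) {θ₀ : Θ} {p₀ : V} (hp₀ : p₀ ∈ P)
    (hmax : f (θ₀, p₀) = k θ₀) (huniq : ∀ p ∈ P, f (θ₀, p) = k θ₀ → p = p₀)
    {L : Θ →L[ℝ] ℝ} (hL : HasFDerivAt (fun θ => f (θ, p₀)) L θ₀) : HasFDerivAt k L θ₀ := by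
  have hpart : ∀ θ p, HasFDerivAt (fun θ => f (θ, p))
      ((fderiv ℝ f (θ, p)).comp (ContinuousLinearMap.inl ℝ Θ V)) θ := by
    intro θ p
    have h1 : HasFDerivAt (fun θ : Θ => (θ, p)) (ContinuousLinearMap.inl ℝ Θ V) θ :=
      (hasFDerivAt_id θ).prodMk (hasFDerivAt_const p θ)
    exact HasFDerivAt.comp (g := f) (f := fun θ : Θ => (θ, p)) θ
      (hf.differentiable one_ne_zero _).hasFDerivAt h1
  have hLeq : L = (fderiv ℝ f (θ₀, p₀)).comp (ContinuousLinearMap.inl ℝ Θ V) :=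
    hL.unique (hpart θ₀ p₀)
  have hcont : Continuous fun y : Θ × V => (fderiv ℝ f y).comp (ContinuousLinearMap.inl ℝ Θ V) :=
    (hf.continuous_fderiv one_ne_zero).clm_comp continuous_const
  rw [hasFDerivAt_iff_isLittleO]
  refine Asymptotics.IsLittleO.of_bound fun ε hε => ?_
  have hnear : ∀ᶠ y in 𝓝 (θ₀, p₀),
      ‖(fderiv ℝ f y).comp (ContinuousLinearMap.inl ℝ Θ V) - L‖ ≤ ε := by
    have h1 : Continuous fun y : Θ × V =>
      ‖(fderiv ℝ f y).comp (ContinuousLinearMap.inl ℝ Θ V) - L‖ := (hcont.sub continuous_const).norm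
    refine (h1.continuousAt.eventually_lt continuousAt_const ?_).mono fun y hy => hy.le
    rw [← hLeq]; simpa
  rw [nhds_prod_eq, eventually_prod_iff] at hnear
  obtain ⟨A, hA, U, hU, hAU⟩ := hnear
  obtain ⟨δ, hδ, hδA⟩ := Metric.eventually_nhds_iff_ball.1 hA
  obtain ⟨O, hOU, hO, hpO⟩ := mem_nhds_iff.1 hU
  have hfar : ∀ᶠ θ in 𝓝 θ₀, ∀ p ∈ P \ O, f (θ, p) < f (θ, p₀) := by
    refine (hP.diff hO).eventually_forall_of_forall_eventually fun p hp => ?_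
    have hlt : f (θ₀, p) < f (θ₀, p₀) := by
      rw [hmax]
      refine lt_of_le_of_ne (hle θ₀ p hp.1) fun h => hp.2 ?_
      rwa [huniq p hp.1 h]
    have h1 : Continuous fun y : Θ × V => f (y.1, y.2) := hf.continuous
    have h2 : Continuous fun y : Θ × V => f (y.1, p₀) := hf.continuous.comp (by fun_prop)
    exact h1.continuousAt.eventually_lt h2.continuousAt hlt
  have hmv : ∀ θ ∈ Metric.ball θ₀ δ, ∀ p ∈ O,
      |f (θ, p) - f (θ₀, p) - L (θ - θ₀)| ≤ ε * ‖θ - θ₀‖ := by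
    intro θ hθ p hp
    exact (convex_ball θ₀ δ).norm_image_sub_le_of_norm_hasFDerivWithin_le'
      (fun y _ => (hpart y p).hasFDerivWithinAt) (fun y hy => hAU (hδA y hy) (hOU hp))
      (Metric.mem_ball_self hδ) hθ
  filter_upwards [Metric.ball_mem_nhds θ₀ hδ, hfar] with θ hθ hfarθ
  obtain ⟨p, hpP, hp⟩ := hex θ
  have hpO' : p ∈ O := by
    by_contra hpn
    have := hfarθ p ⟨hpP, hpn⟩
    linarith [hle θ p₀ hp₀]
  have h1 := (abs_le.1 (hmv θ hθ p hpO')).2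
  have h2 := (abs_le.1 (hmv θ hθ p₀ hpO)).1
  have h3 := hle θ₀ p hpP
  have h4 := hle θ p₀ hp₀
  rw [Real.norm_eq_abs, abs_le]
  constructor <;> linarith

/-- First-order expansion of a `C¹` function, uniform on compact sets. -/
theorem exists_uniform_expansion {X : Type*} [NormedAddCommGroup X] [NormedSpace ℝ X]
    [ProperSpace X] {f : X → ℝ} (hf : ContDiff ℝ 1 f) {Q : Set X} (hQ : IsCompact Q) {η : ℝ}
    (hη : 0 < η) : ∃ δ > 0, ∀ ζ ∈ Q, ∀ d : X, ‖d‖ ≤ δ →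
      |f (ζ + d) - f ζ - fderiv ℝ f ζ d| ≤ η * ‖d‖ := by
  have hQ' : IsCompact (Metric.cthickening 1 Q) := hQ.cthickening
  obtain ⟨δ, hδ, h⟩ := Metric.uniformContinuousOn_iff.1 (hQ'.uniformContinuousOn_of_continuous
    (hf.continuous_fderiv one_ne_zero).continuousOn) η hη
  refine ⟨min 1 (δ / 2), by positivity, fun ζ hζ d hd => ?_⟩
  have hsub : Metric.closedBall ζ ‖d‖ ⊆ Metric.cthickening 1 Q := by
    intro y hy
    exact Metric.mem_cthickening_of_dist_le y ζ 1 Q hζ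
      (le_trans hy (hd.trans (min_le_left _ _)))
  have := (convex_closedBall ζ ‖d‖).norm_image_sub_le_of_norm_hasFDerivWithin_le' (f := f)
    (φ := fderiv ℝ f ζ) (C := η)
    (fun y _ => (hf.differentiable one_ne_zero y).hasFDerivAt.hasFDerivWithinAt)
    (fun y hy => by
      rw [← dist_eq_norm]
      refine (h y (hsub hy) ζ (hsub (Metric.mem_closedBall_self (norm_nonneg _))) ?_).le
      refine lt_of_le_of_lt hy (lt_of_le_of_lt (hd.trans (min_le_right _ _)) (by linarith)))
    (Metric.mem_closedBall_self (norm_nonneg _)) (y := ζ + d) (by simp)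
  simpa using this

end Calculus

variable {n : ℕ}

theorem hasFDerivAt_toDual_innerSL {f : Rn n → ℝ} {x : Rn n} (h : DifferentiableAt ℝ f x) :
    HasFDerivAt f (innerSL ℝ (gradient f x)) x := by
  exact h.hasGradientAt.hasFDerivAt.congr_fderiv (by ext; simp)

theorem IsC1.hasFDerivAt {F : Hamiltonian n} (hF : IsC1 F) (x p : Rn n) (u : ℝ) :
    ∃ ℓ : Rn n × Rn n × ℝ →L[ℝ] ℝ,
      HasFDerivAt (fun z : Rn n × Rn n × ℝ => F z.1 z.2.1 z.2.2) ℓ (x, p, u) ∧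
      ∀ d, ℓ d = inner ℝ (Dx F x p u) d.1 + inner ℝ (Dp F x p u) d.2.1 + Du F x p u * d.2.2 := by
  have hd : HasFDerivAt (fun z : Rn n × Rn n × ℝ => F z.1 z.2.1 z.2.2) _ (x, p, u) :=
    (hF.differentiable one_ne_zero (x, p, u)).hasFDerivAt
  refine ⟨_, hd, fun d => ?_⟩
  set ℓ := fderiv ℝ (fun z : Rn n × Rn n × ℝ => F z.1 z.2.1 z.2.2) (x, p, u)
  have i1 : HasFDerivAt (fun y : Rn n => (y, p, u)) (ContinuousLinearMap.inl ℝ (Rn n) (Rn n × ℝ)) x :=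
    (hasFDerivAt_id x).prodMk (hasFDerivAt_const (p, u) x)
  have i2 : HasFDerivAt (fun q : Rn n => (x, q, u)) ((ContinuousLinearMap.inr ℝ (Rn n) (Rn n × ℝ)).comp
      (ContinuousLinearMap.inl ℝ (Rn n) ℝ)) p :=
    ((hasFDerivAt_const x p).prodMk ((hasFDerivAt_id p).prodMk (hasFDerivAt_const u p))).congr_fderiv
      (by ext <;> simp)
  have i3 : HasDerivAt (fun r : ℝ => (x, p, r)) ((0 : Rn n), (0 : Rn n), (1 : ℝ)) u :=
    (hasDerivAt_const u x).prodMk ((hasDerivAt_const u p).prodMk (hasDerivAt_id u))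
  have d1 : HasFDerivAt (fun y => F y p u) _ x := HasFDerivAt.comp
    (g := fun z : Rn n × Rn n × ℝ => F z.1 z.2.1 z.2.2) x hd i1
  have d2 : HasFDerivAt (fun q => F x q u) _ p := HasFDerivAt.comp
    (g := fun z : Rn n × Rn n × ℝ => F z.1 z.2.1 z.2.2) p hd i2
  have d3 : HasDerivAt (fun r => F x p r) _ u := HasFDerivAt.comp_hasDerivAt
    (l := fun z : Rn n × Rn n × ℝ => F z.1 z.2.1 z.2.2) u hd i3
  have e1 := congrArg (fun ℓ => ℓ d.1) (d1.unique (hasFDerivAt_toDual_innerSL d1.differentiableAt))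
  have e2 := congrArg (fun ℓ => ℓ d.2.1) (d2.unique (hasFDerivAt_toDual_innerSL d2.differentiableAt))
  have e3 := d3.deriv
  simp only [ContinuousLinearMap.comp_apply, ContinuousLinearMap.inl_apply,
    ContinuousLinearMap.inr_apply, innerSL_apply_apply] at e1 e2
  rw [Dx, Dp, Du, ← e1, ← e2, e3]
  have : d = (d.1, 0) + (0, (d.2.1, 0)) + d.2.2 • ((0 : Rn n), (0 : Rn n), (1 : ℝ)) := by
    ext <;> simp
  conv_lhs => rw [this]
  rw [map_add, map_add, map_smul, smul_eq_mul, mul_comm]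

theorem IsC1.continuous {F : Hamiltonian n} (hF : IsC1 F) :
    Continuous fun z : Rn n × Rn n × ℝ => F z.1 z.2.1 z.2.2 := ContDiff.continuous hF

theorem IsC1.continuous_Dx {F : Hamiltonian n} (hF : IsC1 F) :
    Continuous fun z : Rn n × Rn n × ℝ => Dx F z.1 z.2.1 z.2.2 := by
  have h : (fun z : Rn n × Rn n × ℝ => Dx F z.1 z.2.1 z.2.2) = fun z =>
      (InnerProductSpace.toDual ℝ (Rn n)).symm
        ((fderiv ℝ (fun z : Rn n × Rn n × ℝ => F z.1 z.2.1 z.2.2) z).comp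
          (ContinuousLinearMap.inl ℝ (Rn n) (Rn n × ℝ))) := by
    funext z
    obtain ⟨ℓ, h1, h2⟩ := hF.hasFDerivAt z.1 z.2.1 z.2.2
    refine ext_inner_right ℝ fun y => ?_
    rw [InnerProductSpace.toDual_symm_apply, h1.fderiv, ContinuousLinearMap.comp_apply, h2]
    simp
  rw [h]
  exact (InnerProductSpace.toDual ℝ (Rn n)).symm.continuous.comp
    ((ContDiff.continuous_fderiv hF one_ne_zero).clm_comp continuous_const)

theorem IsC1.continuous_Dp {F : Hamiltonian n} (hF : IsC1 F) :
    Continuous fun z : Rn n × Rn n × ℝ => Dp F z.1 z.2.1 z.2.2 := by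
  have h : (fun z : Rn n × Rn n × ℝ => Dp F z.1 z.2.1 z.2.2) = fun z =>
      (InnerProductSpace.toDual ℝ (Rn n)).symm
        ((fderiv ℝ (fun z : Rn n × Rn n × ℝ => F z.1 z.2.1 z.2.2) z).comp
          ((ContinuousLinearMap.inr ℝ (Rn n) (Rn n × ℝ)).comp
            (ContinuousLinearMap.inl ℝ (Rn n) ℝ))) := by
    funext z
    obtain ⟨ℓ, h1, h2⟩ := hF.hasFDerivAt z.1 z.2.1 z.2.2
    refine ext_inner_right ℝ fun y => ?_
    rw [InnerProductSpace.toDual_symm_apply, h1.fderiv, ContinuousLinearMap.comp_apply, h2]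
    simp
  rw [h]
  exact (InnerProductSpace.toDual ℝ (Rn n)).symm.continuous.comp
    ((ContDiff.continuous_fderiv hF one_ne_zero).clm_comp continuous_const)

theorem IsC1.continuous_Du {F : Hamiltonian n} (hF : IsC1 F) :
    Continuous fun z : Rn n × Rn n × ℝ => Du F z.1 z.2.1 z.2.2 := by
  have h : (fun z : Rn n × Rn n × ℝ => Du F z.1 z.2.1 z.2.2) = fun z =>
      fderiv ℝ (fun z : Rn n × Rn n × ℝ => F z.1 z.2.1 z.2.2) z (0, 0, 1) := by
    funext z
    obtain ⟨ℓ, h1, h2⟩ := hF.hasFDerivAt z.1 z.2.1 z.2.2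
    rw [h1.fderiv, h2]
    simp
  rw [h]
  exact (ContDiff.continuous_fderiv hF one_ne_zero).clm_apply continuous_const

/-- First-order expansion of a Hamiltonian along the contact flow of a commuting one. -/
theorem exists_commuting_expansion {Φ F : Hamiltonian n} (hΦ : IsC1 Φ) (hF : IsC1 F)
    (hJ : JacobiCommute Φ F) {Q : Set (Rn n × Rn n × ℝ)} (hQ : IsCompact Q) {η : ℝ} (hη : 0 < η) :
    ∃ ε₀ > 0, ∃ τ₀ > 0, ∀ ε τ : ℝ, 0 < ε → ε ≤ ε₀ → 0 < τ → τ ≤ τ₀ → ∀ y p : Rn n, ∀ z κ q L,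
      (y, p, z) ∈ Q → κ = 1 - τ * Du F y p z → q = Dp F y p z + ε • p →
      L = inner ℝ p q - (F y p z + ε / 2 * ‖p‖ ^ 2) →
      |κ * Φ y (κ⁻¹ • (p + τ • Dx F y p z)) z - Φ (y + τ • q) p (z + τ * L)| ≤ η * τ ∧
      |Φ (y + τ • q) p (z + τ * L) - Φ y p z| ≤ η := by
  have cF := hF.continuous
  have cFx := hF.continuous_Dx
  have cFp := hF.continuous_Dp
  have cFu := hF.continuous_Du
  have cΦx := hΦ.continuous_Dx
  have cΦu := hΦ.continuous_Du
  obtain ⟨b₀, hb₀⟩ := hQ.exists_bound_of_continuousOn (f := fun ζ : Rn n × Rn n × ℝ =>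
    |Du F ζ.1 ζ.2.1 ζ.2.2| + ‖Dx F ζ.1 ζ.2.1 ζ.2.2 + Du F ζ.1 ζ.2.1 ζ.2.2 • ζ.2.1‖ + ‖ζ.2.1‖
      + ‖Dp F ζ.1 ζ.2.1 ζ.2.2‖ + ‖ζ.2.1‖ ^ 2 + |F ζ.1 ζ.2.1 ζ.2.2| + ‖Dx Φ ζ.1 ζ.2.1 ζ.2.2‖
      + |Du Φ ζ.1 ζ.2.1 ζ.2.2|) (by fun_prop)
  obtain ⟨b, hb1, hb⟩ : ∃ b : ℝ, 1 ≤ b ∧ b₀ ≤ b := ⟨max 1 b₀, le_max_left _ _, le_max_right _ _⟩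
  have hb0 : 0 < b := by linarith
  set η' := η / (32 * b ^ 2) with hη'
  have hη'0 : 0 < η' := by positivity
  have hη'e : η' * b ^ 2 = η / 32 := by rw [hη']; field_simp
  obtain ⟨δ, hδ, hexp⟩ := exists_uniform_expansion hΦ hQ hη'0
  refine ⟨min 1 (η / (4 * b ^ 2)), by positivity,
    min (1 / (2 * b)) (min (δ / (4 * b ^ 2)) (min 1 (η / (12 * b ^ 3)))), by positivity, ?_⟩
  intro ε τ hε hε₀ hτ hτ₀ y p z κ q L hζ hκ hq hL
  have hε1 : ε ≤ 1 := hε₀.trans (min_le_left _ _)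
  have hε2 : ε * b ^ 2 ≤ η / 4 := by
    have := hε₀.trans (min_le_right _ _)
    rw [le_div_iff₀ (by positivity)] at this
    linarith
  have hτ1 : τ * b ≤ 1 / 2 := by
    have := hτ₀.trans (min_le_left _ _)
    rw [le_div_iff₀ (by positivity)] at this
    linarith
  have hτ2 : τ * (4 * b ^ 2) ≤ δ := by
    have := hτ₀.trans ((min_le_right _ _).trans (min_le_left _ _))
    rwa [le_div_iff₀ (by positivity)] at this
  have hτ3 : τ ≤ 1 :=
    hτ₀.trans ((min_le_right _ _).trans ((min_le_right _ _).trans (min_le_left _ _)))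
  have hτ4 : τ * (12 * b ^ 3) ≤ η := by
    have := hτ₀.trans ((min_le_right _ _).trans ((min_le_right _ _).trans (min_le_right _ _)))
    rwa [le_div_iff₀ (by positivity)] at this
  have hbd := hb₀ _ hζ
  rw [Real.norm_eq_abs, abs_of_nonneg (by positivity)] at hbd
  simp only at hbd
  obtain ⟨ℓ, hℓ, hℓd⟩ := hΦ.hasFDerivAt y p z
  have hexpζ := hexp _ hζ
  rw [hℓ.fderiv] at hexpζ
  have hJζ := hJ y p z
  generalize Du F y p z = Fu at *
  generalize Dx F y p z = Fx at *
  generalize Dp F y p z = Fp at *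
  generalize Du Φ y p z = Φu at *
  generalize Dx Φ y p z = Φx at *
  generalize Dp Φ y p z = Φp at *
  generalize hF0 : F y p z = F0 at *
  have n0 := abs_nonneg Fu
  have n1 := norm_nonneg (Fx + Fu • p)
  have n2 := norm_nonneg p
  have n3 := norm_nonneg Fp
  have n4 := sq_nonneg ‖p‖
  have n5 := abs_nonneg F0
  have n6 := norm_nonneg Φx
  have n7 := abs_nonneg Φu
  have hbb : b ≤ b ^ 2 := by nlinarith only [hb1]
  -- bounds on the two increments
  have bq : ‖q‖ ≤ 2 * b := by
    rw [hq]
    refine (norm_add_le _ _).trans ?_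
    rw [norm_smul, Real.norm_eq_abs, abs_of_pos hε]
    have : ε * ‖p‖ ≤ 1 * ‖p‖ := by gcongr
    linarith only [this, hbd, hb, n0, n1, n2, n3, n4, n5, n6, n7]
  have bp : ‖p‖ ≤ b := by linarith only [hbd, hb, n0, n1, n2, n3, n4, n5, n6, n7]
  have bp2 : ‖p‖ ^ 2 ≤ b := by linarith only [hbd, hb, n0, n1, n2, n3, n4, n5, n6, n7]
  have bF : |F0| ≤ b := by linarith only [hbd, hb, n0, n1, n2, n3, n4, n5, n6, n7]
  have bΦx : ‖Φx‖ ≤ b := by linarith only [hbd, hb, n0, n1, n2, n3, n4, n5, n6, n7]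
  have bΦu : |Φu| ≤ b := by linarith only [hbd, hb, n0, n1, n2, n3, n4, n5, n6, n7]
  have bFu : |Fu| ≤ b := by linarith only [hbd, hb, n0, n1, n2, n3, n4, n5, n6, n7]
  have b1 : ‖Fx + Fu • p‖ ≤ b := by linarith only [hbd, hb, n0, n1, n2, n3, n4, n5, n6, n7]
  have bL : |L| ≤ 4 * b ^ 2 := by
    have h1 : |inner ℝ p q| ≤ b * (2 * b) := (abs_real_inner_le_norm _ _).trans (by gcongr)
    have h2 : ε / 2 * ‖p‖ ^ 2 ≤ 1 / 2 * b := by gcongr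
    have h3 : 0 ≤ ε / 2 * ‖p‖ ^ 2 := by positivity
    rw [hL]
    have h4 := abs_le.1 h1
    have h5 := abs_le.1 bF
    rw [abs_le]
    constructor <;> nlinarith only [h4.1, h4.2, h5.1, h5.2, h2, h3, hbb, hb0]
  have hκ2 : 1 / 2 ≤ κ ∧ κ ≤ 2 := by
    have h1 : |τ * Fu| ≤ 1 / 2 := by
      rw [abs_mul, abs_of_pos hτ]
      exact (by gcongr : τ * |Fu| ≤ τ * b).trans hτ1
    have := abs_le.1 h1
    constructor <;> linarith only [this.1, this.2, hκ]
  have hκ0 : 0 < κ := by linarith only [hκ2.1]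
  have hp1 : κ⁻¹ • (p + τ • Fx) = p + (κ⁻¹ * τ) • (Fx + Fu • p) := by
    rw [inv_smul_eq_iff₀ hκ0.ne', smul_add, smul_smul, mul_inv_cancel_left₀ hκ0.ne', hκ]
    module
  set d₁ : Rn n × Rn n × ℝ := (0, (κ⁻¹ * τ) • (Fx + Fu • p), 0) with hd₁
  set d₂ : Rn n × Rn n × ℝ := (τ • q, 0, τ * L) with hd₂
  have nd₁ : κ * ‖d₁‖ ≤ τ * b := by
    have : ‖d₁‖ = κ⁻¹ * τ * ‖Fx + Fu • p‖ := by
      rw [hd₁, Prod.norm_mk, Prod.norm_mk, norm_zero, norm_zero, max_eq_left (norm_nonneg _),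
        max_eq_right (norm_nonneg _), norm_smul, Real.norm_eq_abs,
        abs_of_pos (by positivity : 0 < κ⁻¹ * τ)]
    rw [this, ← mul_assoc, ← mul_assoc, mul_inv_cancel₀ hκ0.ne', one_mul]
    gcongr
  have nd₂ : ‖d₂‖ ≤ τ * (4 * b ^ 2) := by
    rw [hd₂, Prod.norm_mk, Prod.norm_mk, norm_zero, norm_smul, Real.norm_eq_abs, norm_mul,
      Real.norm_eq_abs, Real.norm_eq_abs, abs_of_pos hτ]
    refine max_le ?_ (max_le (by positivity) (by gcongr))
    gcongr
    linarith only [bq, hbb, hb0]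
  have nd₁' : ‖d₁‖ ≤ δ := by
    have h1 : 1 / 2 * ‖d₁‖ ≤ κ * ‖d₁‖ := by gcongr; exact hκ2.1
    have h2 : τ * b ≤ τ * b ^ 2 := by gcongr
    linarith only [h1, h2, nd₁, hτ2, mul_pos hτ hb0]
  have E₁ := hexpζ d₁ nd₁'
  have E₂ := hexpζ d₂ (nd₂.trans hτ2)
  rw [hℓd] at E₁ E₂
  have ev₁ : (y, p, z) + d₁ = (y, κ⁻¹ • (p + τ • Fx), z) := by rw [hp1]; simp [hd₁]
  have ev₂ : (y, p, z) + d₂ = (y + τ • q, p, z + τ * L) := by simp [hd₂]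
  rw [ev₁] at E₁
  rw [ev₂] at E₂
  simp only [hd₁, hd₂, inner_zero_right, inner_smul_right, mul_zero, zero_add, add_zero] at E₁ E₂
  generalize Φ y (κ⁻¹ • (p + τ • Fx)) z = P₁ at *
  generalize Φ (y + τ • q) p (z + τ * L) = P₂ at *
  generalize Φ y p z = P₀ at *
  have F₂ : η' * ‖d₂‖ ≤ η / 8 * τ := by
    calc η' * ‖d₂‖ ≤ η' * (τ * (4 * b ^ 2)) := by gcongr
      _ = 4 * τ * (η' * b ^ 2) := by ring
      _ = _ := by rw [hη'e]; ring
  have F₁ : κ * (η' * ‖d₁‖) ≤ η / 32 * τ := by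
    calc κ * (η' * ‖d₁‖) = η' * (κ * ‖d₁‖) := by ring
      _ ≤ η' * (τ * b ^ 2) := mul_le_mul_of_nonneg_left (nd₁.trans (by gcongr)) hη'0.le
      _ = τ * (η' * b ^ 2) := by ring
      _ = _ := by rw [hη'e]; ring
  have E₂' := abs_le.1 (E₂.trans F₂)
  have hi1 : |inner ℝ Φx p| ≤ b ^ 2 := (abs_real_inner_le_norm _ _).trans (by rw [sq]; gcongr)
  constructor
  · have E₁' : |κ * (P₁ - P₀ - κ⁻¹ * τ * inner ℝ Φp (Fx + Fu • p))| ≤ η / 32 * τ := by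
      rw [abs_mul, abs_of_pos hκ0]
      exact (mul_le_mul_of_nonneg_left E₁ hκ0.le).trans F₁
    have e1 : κ * (P₁ - P₀ - κ⁻¹ * τ * inner ℝ Φp (Fx + Fu • p))
        = κ * P₁ - κ * P₀ - τ * inner ℝ Φp (Fx + Fu • p) := by
      field_simp
    rw [e1] at E₁'
    have E₁'' := abs_le.1 E₁'
    have hrem : |τ * (ε * (inner ℝ Φx p + Φu * (‖p‖ ^ 2 / 2)))| ≤ τ * (η / 2) := by
      rw [abs_mul, abs_mul, abs_of_pos hτ, abs_of_pos hε]
      have h1 : |inner ℝ Φx p + Φu * (‖p‖ ^ 2 / 2)| ≤ 2 * b ^ 2 := by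
        refine (abs_add_le _ _).trans ?_
        have : |Φu * (‖p‖ ^ 2 / 2)| ≤ b * (b / 2) := by
          rw [abs_mul, abs_of_nonneg (by positivity : 0 ≤ ‖p‖ ^ 2 / 2)]; gcongr
        nlinarith only [this, hi1, hb0]
      have h2 : ε * |inner ℝ Φx p + Φu * (‖p‖ ^ 2 / 2)| ≤ ε * (2 * b ^ 2) := by gcongr
      refine mul_le_mul_of_nonneg_left (h2.trans ?_) hτ.le
      linarith only [hε2]
    have hrem' := abs_le.1 hrem
    have hmain : κ * P₁ - P₂ =
        (κ * P₁ - κ * P₀ - τ * inner ℝ Φp (Fx + Fu • p))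
        - (P₂ - P₀ - (τ * inner ℝ Φx q + Φu * (τ * L)))
        - τ * (ε * (inner ℝ Φx p + Φu * (‖p‖ ^ 2 / 2))) := by
      have i1 : inner ℝ Φp (Fx + Fu • p) = inner ℝ Φp Fx + Fu * inner ℝ p Φp := by
        rw [inner_add_right, inner_smul_right, real_inner_comm p Φp]
      have i2 : inner ℝ Φx q = inner ℝ Φx Fp + ε * inner ℝ Φx p := by
        rw [hq, inner_add_right, inner_smul_right]
      have i3 : inner ℝ p q = inner ℝ p Fp + ε * ‖p‖ ^ 2 := by
        rw [hq, inner_add_right, inner_smul_right, real_inner_self_eq_norm_sq]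
      rw [i1, i2, hL, i3, hκ]
      linear_combination (-τ) * hJζ
    rw [hmain, abs_le]
    constructor <;> nlinarith only [E₁''.1, E₁''.2, E₂'.1, E₂'.2, hrem'.1, hrem'.2, mul_pos hη hτ]
  · have h1 : |τ * inner ℝ Φx q + Φu * (τ * L)| ≤ η / 2 := by
      refine (abs_add_le _ _).trans ?_
      have a1 : |τ * inner ℝ Φx q| ≤ τ * (b * (2 * b)) := by
        rw [abs_mul, abs_of_pos hτ]
        gcongr
        exact (abs_real_inner_le_norm _ _).trans (by gcongr)
      have a2 : |Φu * (τ * L)| ≤ b * (τ * (4 * b ^ 2)) := by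
        rw [abs_mul, abs_mul, abs_of_pos hτ]; gcongr
      have a3 : τ * (b * (2 * b)) ≤ τ * (b * (2 * b ^ 2)) := by gcongr
      linarith only [a1, a2, a3, hτ4]
    have h2 := abs_le.1 h1
    have h3 : η / 8 * τ ≤ η / 8 * 1 := by gcongr
    rw [abs_le]
    constructor <;> linarith only [h2.1, h2.2, E₂'.1, E₂'.2, h3, hη]

end ContactHJ

namespace ContactHJ

open Filter Topology Set

variable {n : ℕ}

/-- The function maximized over `p` in the definition of `kernel`. -/
noncomputable def kernelIntegrand (N : Hamiltonian n) (y : (Rn n × Rn n × ℝ × ℝ) × Rn n) : ℝ :=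
  inner ℝ y.2 (y.1.1 - y.1.2.1) - y.1.2.2.1 * N y.1.2.1 y.2 y.1.2.2.2

/-- `kernel N R (x, y, τ, z) = max_{|p| ≤ R} (p · (x - y) - τ N(y, p, z))`, the cost of moving from
`y` to `x` in time `τ` under `N`, with momenta truncated at `R`. -/
noncomputable def kernel (N : Hamiltonian n) (R : ℝ) (θ : Rn n × Rn n × ℝ × ℝ) : ℝ :=
  sSup ((fun p => kernelIntegrand N (θ, p)) '' Metric.closedBall 0 R)

section Kernel

variable {N : Hamiltonian n} {R : ℝ}

theorem kernelIntegrand_continuous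
    (hN : Continuous fun z : Rn n × Rn n × ℝ => N z.1 z.2.1 z.2.2) :
    Continuous (kernelIntegrand N) := by
  have h1 : Continuous fun y : (Rn n × Rn n × ℝ × ℝ) × Rn n => N y.1.2.1 y.2 y.1.2.2.2 :=
    hN.comp (by fun_prop :
      Continuous fun y : (Rn n × Rn n × ℝ × ℝ) × Rn n => (y.1.2.1, y.2, y.1.2.2.2))
  unfold kernelIntegrand
  fun_prop

theorem kernelIntegrand_contDiff (hN : IsC1 N) : ContDiff ℝ 1 (kernelIntegrand N) := by
  have h1 : ContDiff ℝ 1 fun y : (Rn n × Rn n × ℝ × ℝ) × Rn n => N y.1.2.1 y.2 y.1.2.2.2 :=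
    ContDiff.comp hN (by fun_prop :
      ContDiff ℝ 1 fun y : (Rn n × Rn n × ℝ × ℝ) × Rn n => (y.1.2.1, y.2, y.1.2.2.2))
  have h2 : ContDiff ℝ 1 fun y : (Rn n × Rn n × ℝ × ℝ) × Rn n =>
    (inner ℝ y.2 (y.1.1 - y.1.2.1) : ℝ) := ContDiff.inner ℝ (by fun_prop) (by fun_prop)
  exact h2.sub (ContDiff.mul (by fun_prop) h1)

theorem exists_kernel_eq (hN : Continuous fun z : Rn n × Rn n × ℝ => N z.1 z.2.1 z.2.2)
    (hR : 0 ≤ R) (θ : Rn n × Rn n × ℝ × ℝ) :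
    ∃ p ∈ Metric.closedBall (0 : Rn n) R, kernelIntegrand N (θ, p) = kernel N R θ := by
  have hc : Continuous fun p => kernelIntegrand N (θ, p) :=
    (kernelIntegrand_continuous hN).comp (by fun_prop)
  obtain ⟨p, hp, h⟩ := (isCompact_closedBall (0 : Rn n) R).exists_sSup_image_eq
    ⟨0, Metric.mem_closedBall_self hR⟩ hc.continuousOn
  exact ⟨p, hp, h.symm⟩

theorem le_kernel (hN : Continuous fun z : Rn n × Rn n × ℝ => N z.1 z.2.1 z.2.2)
    (θ : Rn n × Rn n × ℝ × ℝ) {p : Rn n} (hp : p ∈ Metric.closedBall (0 : Rn n) R) :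
    kernelIntegrand N (θ, p) ≤ kernel N R θ := by
  have hc : Continuous fun p => kernelIntegrand N (θ, p) :=
    (kernelIntegrand_continuous hN).comp (by fun_prop)
  exact le_csSup ((isCompact_closedBall (0 : Rn n) R).bddAbove_image hc.continuousOn)
    (mem_image_of_mem _ hp)

theorem kernel_sub_kernel_le (hN : Continuous fun z : Rn n × Rn n × ℝ => N z.1 z.2.1 z.2.2)
    (hR : 0 ≤ R) {θ θ' : Rn n × Rn n × ℝ × ℝ} {b : ℝ}
    (h : ∀ p ∈ Metric.closedBall (0 : Rn n) R,
      kernelIntegrand N (θ, p) - kernelIntegrand N (θ', p) ≤ b) :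
    kernel N R θ - kernel N R θ' ≤ b := by
  obtain ⟨p, hp, hpe⟩ := exists_kernel_eq hN hR θ
  have h1 := h p hp
  have h2 := le_kernel hN θ' hp
  linarith

variable {M C : ℝ}

theorem le_kernel_of_bound (hN : Continuous fun z : Rn n × Rn n × ℝ => N z.1 z.2.1 z.2.2)
    (hR : 0 ≤ R) (hM : ∀ x p u, ‖p‖ ≤ R → |N x p u| ≤ M) (x y : Rn n) {τ : ℝ} (hτ : 0 ≤ τ)
    (z : ℝ) : R * ‖x - y‖ - τ * M ≤ kernel N R (x, y, τ, z) := by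
  rcases eq_or_ne x y with rfl | hne
  · have h1 := le_kernel (R := R) hN (x, x, τ, z) (Metric.mem_closedBall_self hR)
    have h2 := (abs_le.1 (hM x 0 z (by simpa using hR))).2
    simp only [kernelIntegrand, sub_self, inner_zero_right, norm_zero, mul_zero] at h1 ⊢
    nlinarith
  · have hpos : 0 < ‖x - y‖ := norm_pos_iff.2 (sub_ne_zero.2 hne)
    have hp : ‖(R / ‖x - y‖) • (x - y)‖ = R := by
      rw [norm_smul, Real.norm_eq_abs, abs_of_nonneg (by positivity)]; field_simp
    have h1 := le_kernel (R := R) hN (x, y, τ, z) (p := (R / ‖x - y‖) • (x - y)) (by simp [hp])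
    have h2 := (abs_le.1 (hM y ((R / ‖x - y‖) • (x - y)) z hp.le)).2
    simp only [kernelIntegrand, inner_smul_left, real_inner_self_eq_norm_sq, conj_trivial] at h1
    have h3 : R / ‖x - y‖ * ‖x - y‖ ^ 2 = R * ‖x - y‖ := by field_simp
    rw [h3] at h1
    nlinarith

theorem kernel_self_le (hN : Continuous fun z : Rn n × Rn n × ℝ => N z.1 z.2.1 z.2.2)
    (hR : 0 ≤ R) (hM : ∀ x p u, ‖p‖ ≤ R → |N x p u| ≤ M) (x : Rn n) {τ : ℝ} (hτ : 0 ≤ τ)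
    (z : ℝ) : kernel N R (x, x, τ, z) ≤ τ * M := by
  obtain ⟨p, hp, hpe⟩ := exists_kernel_eq hN hR (x, x, τ, z)
  have h2 := (abs_le.1 (hM x p z (by simpa using hp))).1
  rw [← hpe]
  simp only [kernelIntegrand, sub_self, inner_zero_right]
  nlinarith

theorem kernel_diff_le (hN : Continuous fun z : Rn n × Rn n × ℝ => N z.1 z.2.1 z.2.2)
    (hR : 0 ≤ R) (hM : ∀ x p u, ‖p‖ ≤ R → |N x p u| ≤ M)
    (hC : ∀ x p u u', |N x p u - N x p u'| ≤ C * |u - u'|) (x x' y : Rn n) {τ τ' : ℝ}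
    (hτ' : 0 ≤ τ') (z z' : ℝ) :
    kernel N R (x, y, τ, z) - kernel N R (x', y, τ', z')
      ≤ R * ‖x - x'‖ + M * |τ - τ'| + τ' * (C * |z - z'|) := by
  refine kernel_sub_kernel_le hN hR fun p hp => ?_
  have hp : ‖p‖ ≤ R := by simpa using hp
  have h1 : inner ℝ p (x - x') ≤ R * ‖x - x'‖ :=
    (real_inner_le_norm _ _).trans (by gcongr)
  have h2 : |(τ' - τ) * N y p z| ≤ |τ - τ'| * M := by
    rw [abs_mul, abs_sub_comm]; gcongr; exact hM y p z hp
  have h3 : |τ' * (N y p z' - N y p z)| ≤ τ' * (C * |z - z'|) := by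
    rw [abs_mul, abs_of_nonneg hτ', abs_sub_comm]; gcongr; exact hC y p z z'
  have h4 := (abs_le.1 h2).2
  have h5 := (abs_le.1 h3).2
  have h6 : inner ℝ p (x - y) - inner ℝ p (x' - y) = inner ℝ p (x - x') := by
    rw [← inner_sub_right]; simp
  simp only [kernelIntegrand]
  linarith

theorem kernel_maximizer_unique (hN : Continuous fun z : Rn n × Rn n × ℝ => N z.1 z.2.1 z.2.2)
    (hNs : ∀ x u, StrictConvexOn ℝ univ fun p => N x p u) {x y : Rn n} {τ z : ℝ} (hτ : 0 < τ)
    {p q : Rn n} (hp : p ∈ Metric.closedBall (0 : Rn n) R) (hq : q ∈ Metric.closedBall (0 : Rn n) R)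
    (hpe : kernelIntegrand N ((x, y, τ, z), p) = kernel N R (x, y, τ, z))
    (hqe : kernelIntegrand N ((x, y, τ, z), q) = kernel N R (x, y, τ, z)) : q = p := by
  by_contra hne
  have hmid : (1 / 2 : ℝ) • q + (1 / 2 : ℝ) • p ∈ Metric.closedBall (0 : Rn n) R :=
    convex_closedBall _ _ hq hp (by norm_num) (by norm_num) (by norm_num)
  have h1 := (hNs y z).2 (mem_univ q) (mem_univ p) hne (by norm_num : (0 : ℝ) < 1 / 2)
    (by norm_num : (0 : ℝ) < 1 / 2) (by norm_num)
  have h2 := le_kernel hN (x, y, τ, z) hmid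
  simp only [kernelIntegrand, inner_add_left, inner_smul_left, smul_eq_mul, conj_trivial]
    at h1 h2 hpe hqe
  nlinarith

/-- The differential of the kernel at a point with positive time. -/
theorem kernel_hasFDerivAt (hN : IsC1 N) (hR : 0 ≤ R)
    (hNs : ∀ x u, StrictConvexOn ℝ univ fun p => N x p u) {x y p : Rn n} {τ z : ℝ} (hτ : 0 < τ)
    (hp : p ∈ Metric.closedBall (0 : Rn n) R)
    (hpe : kernelIntegrand N ((x, y, τ, z), p) = kernel N R (x, y, τ, z)) :
    ∃ L : Rn n × Rn n × ℝ × ℝ →L[ℝ] ℝ, HasFDerivAt (kernel N R) L (x, y, τ, z) ∧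
      ∀ d, L d = inner ℝ p (d.1 - d.2.1) - d.2.2.1 * N y p z
        - τ * (inner ℝ (Dx N y p z) d.2.1 + Du N y p z * d.2.2.2) := by
  obtain ⟨ℓ, hℓ, hℓd⟩ := hN.hasFDerivAt y p z
  let E := Rn n × Rn n × ℝ × ℝ
  have h1 : HasFDerivAt (fun θ : E => θ.1) (ContinuousLinearMap.fst ℝ _ _) (x, y, τ, z) :=
    hasFDerivAt_fst
  have h2 : HasFDerivAt (fun θ : E => θ.2) (ContinuousLinearMap.snd ℝ _ _) (x, y, τ, z) :=
    hasFDerivAt_snd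
  have h3 : HasFDerivAt (fun θ : E => θ.2.1) _ (x, y, τ, z) := h2.fst
  have h4 : HasFDerivAt (fun θ : E => θ.2.2.1) _ (x, y, τ, z) := h2.snd.fst
  have h5 : HasFDerivAt (fun θ : E => θ.2.2.2) _ (x, y, τ, z) := h2.snd.snd
  have h6 : HasFDerivAt (fun θ : E => (θ.2.1, p, θ.2.2.2)) _ (x, y, τ, z) :=
    h3.prodMk ((hasFDerivAt_const p _).prodMk h5)
  have h7 : HasFDerivAt (fun θ : E => N θ.2.1 p θ.2.2.2) _ (x, y, τ, z) :=
    HasFDerivAt.comp (g := fun z : Rn n × Rn n × ℝ => N z.1 z.2.1 z.2.2)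
      (f := fun θ : E => (θ.2.1, p, θ.2.2.2)) (x, y, τ, z) hℓ h6
  have h8 : HasFDerivAt (fun θ : E => (innerSL ℝ p) (θ.1 - θ.2.1)) _ (x, y, τ, z) :=
    HasFDerivAt.comp (g := fun v : Rn n => (innerSL ℝ p) v) (f := fun θ : E => θ.1 - θ.2.1)
      (x, y, τ, z) (innerSL ℝ p).hasFDerivAt (h1.sub h3)
  have h9 : HasFDerivAt (fun θ => kernelIntegrand N (θ, p)) _ (x, y, τ, z) := h8.sub (h4.mul h7)
  refine ⟨_, hasFDerivAt_max_of_unique (kernelIntegrand_contDiff hN) (isCompact_closedBall 0 R)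
    (fun θ p hp => le_kernel hN.continuous θ hp) (exists_kernel_eq hN.continuous hR) hp hpe
    (fun q hq hqe => kernel_maximizer_unique hN.continuous hNs hτ hp hq hpe hqe) h9, fun d => ?_⟩
  simp [hℓd, inner_sub_right]
  ring

/-- A maximizer in the interior of the ball is a critical point. -/
theorem sub_eq_smul_Dp_of_kernel_eq (hN : IsC1 N) {x y p : Rn n} {τ z : ℝ} (hp : ‖p‖ < R)
    (hpe : kernelIntegrand N ((x, y, τ, z), p) = kernel N R (x, y, τ, z)) :
    x - y = τ • Dp N y p z := by
  have hloc : IsLocalMax (fun q => kernelIntegrand N ((x, y, τ, z), q)) p := by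
    filter_upwards [Metric.isOpen_ball.mem_nhds (show p ∈ Metric.ball (0 : Rn n) R by simpa using hp)]
      with q hq
    rw [hpe]
    exact le_kernel hN.continuous _ (Metric.ball_subset_closedBall hq)
  have hd : DifferentiableAt ℝ (fun q => N y q z) p := by
    have : ContDiff ℝ 1 fun q => N y q z := ContDiff.comp hN
      (by fun_prop : ContDiff ℝ 1 fun q : Rn n => (y, q, z))
    exact this.differentiable one_ne_zero p
  have h1 := (hasFDerivAt_toDual_innerSL hd).const_mul τ
  have h2 : HasFDerivAt (fun q => (innerSL ℝ (x - y)) q) (innerSL ℝ (x - y)) p :=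
    (innerSL ℝ (x - y)).hasFDerivAt
  have h3 : HasFDerivAt (fun q => kernelIntegrand N ((x, y, τ, z), q)) _ p :=
    (h2.sub h1).congr_of_eventuallyEq (Eventually.of_forall fun q => by
      simp only [kernelIntegrand, innerSL_apply_apply, Pi.sub_apply, real_inner_comm q])
  have h4 := hloc.hasFDerivAt_eq_zero h3
  refine ext_inner_right ℝ fun v => ?_
  have h5 := congrArg (fun ℓ => ℓ v) h4
  simp only [sub_apply, smul_apply, innerSL_apply_apply, zero_apply,
    smul_eq_mul] at h5
  rw [inner_smul_left, Dp]
  simp only [conj_trivial]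
  linarith

end Kernel

/-- A subjet of a minimum over `y` of `v (y, t) + kernel N R (x, y, h t, v (y, t))` determines the
optimal momentum and a subjet of `v` at the minimizer. -/
theorem SubJet.of_inf_kernel {N : Hamiltonian n} (hN : IsC1 N) {R K T h : ℝ} (hR : 0 ≤ R)
    (hNs : ∀ x u, StrictConvexOn ℝ univ fun p => N x p u) (hK : 0 ≤ K) (hh : 0 < h)
    {v w : Rn n × ℝ → ℝ} (hv : LipOnStrip K T v)
    (hle : ∀ x t y, 0 ≤ t → t ≤ T → w (x, t) ≤ v (y, t) + kernel N R (x, y, h * t, v (y, t)))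
    {x y p : Rn n} {t a : ℝ} (ht : 0 < t) (htT : t < T)
    (heq : w (x, t) = v (y, t) + kernel N R (x, y, h * t, v (y, t)))
    (hu : h * t * Du N y p (v (y, t)) < 1)
    (hj : SubJet w (x, t) (jet p a)) :
    p ∈ Metric.closedBall (0 : Rn n) R ∧
    kernelIntegrand N ((x, y, h * t, v (y, t)), p) = kernel N R (x, y, h * t, v (y, t)) ∧
    SubJet v (y, t) (jet ((1 - h * t * Du N y p (v (y, t)))⁻¹ •
        (p + (h * t) • Dx N y p (v (y, t))))
      ((1 - h * t * Du N y p (v (y, t)))⁻¹ * (a + h * N y p (v (y, t))))) := by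
  set z := v (y, t) with hz
  set τ := h * t with hτdef
  have hτ : 0 < τ := by positivity
  obtain ⟨q, hq, hqe⟩ := exists_kernel_eq hN.continuous hR (x, y, τ, z)
  obtain ⟨L, hL, hLd⟩ := kernel_hasFDerivAt hN hR hNs hτ hq hqe
  -- the momentum of the jet is the maximizer
  have hpq : p = q := by
    have hsub : ∀ d : Rn n, inner ℝ p d ≤ inner ℝ q d := by
      intro d
      have hk : HasDerivAt (fun s : ℝ => kernel N R (x + s • d, y, τ, z)) (inner ℝ q d) 0 := by
        have hline : HasDerivAt (fun s : ℝ => (x + s • d, y, τ, z))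
            (d, (0 : Rn n), (0 : ℝ), (0 : ℝ)) 0 := by
          have : HasDerivAt (fun s : ℝ => x + s • d) d 0 := by
            simpa using ((hasDerivAt_id (0 : ℝ)).smul_const d).const_add x
          exact this.prodMk (hasDerivAt_const 0 (y, τ, z))
        have h0 : HasFDerivAt (kernel N R) L (x + (0 : ℝ) • d, y, τ, z) := by simpa using hL
        have := HasFDerivAt.comp_hasDerivAt (l := kernel N R)
          (f := fun s : ℝ => (x + s • d, y, τ, z)) 0 h0 hline
        rw [hLd] at this
        simpa [Function.comp_def] using this
      refine le_of_forall_pos_le_add fun ε hε => ?_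
      have h1 := hj.apply_le (d, 0) (M := inner ℝ q d + ε) (by
        have h2 := (hasDerivAt_iff_isLittleO_nhds_zero.1 hk).def hε
        filter_upwards [mem_nhdsWithin_of_mem_nhds h2, self_mem_nhdsWithin] with s hs hs0
        have hs0 : 0 < s := hs0
        have h3 := hle (x + s • d) t y ht.le htT.le
        have e : ((x, t) : Rn n × ℝ) + s • ((d, 0) : Rn n × ℝ) = (x + s • d, t) := by
          ext <;> simp
        rw [e, heq]
        have h4 := (abs_le.1 hs).2
        simp only [zero_add, zero_smul, add_zero, smul_eq_mul, Real.norm_eq_abs,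
          abs_of_pos hs0] at h4
        rw [← hz] at h3
        linarith)
      simpa using h1
    have := hsub (p - q)
    rw [← sub_nonpos, ← inner_sub_left, real_inner_self_eq_norm_sq] at this
    have h0 : ‖p - q‖ = 0 := by nlinarith [norm_nonneg (p - q)]
    exact sub_eq_zero.1 (norm_eq_zero.1 h0)
  subst hpq
  refine ⟨hq, hqe, ?_⟩
  set κ := 1 - τ * Du N y p z with hκ
  have hκ0 : 0 < κ := by linarith
  intro ε hε
  set B := 1 + h + 2 * K with hB
  have hB0 : 0 < B := by positivity
  set ε' := κ * ε / (1 + B) with hε'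
  have hε'0 : 0 < ε' := by positivity
  have htend : Tendsto (fun s : Rn n × ℝ => (x, s.1, h * s.2, v s)) (𝓝 (y, t))
      (𝓝 (x, y, τ, z)) := by
    have hvc : ContinuousAt v (y, t) := by
      refine (hv.continuousOn hK).continuousAt ?_
      filter_upwards [eventually_mem_slab (lt_add_one ‖y‖) ht htT] with s hs
      exact ⟨hs.2.1.le, hs.2.2.le⟩
    have h1 : ContinuousAt (fun s : Rn n × ℝ => (x, s.1, h * s.2, v s)) (y, t) := by fun_prop
    exact h1
  have htime : Tendsto (fun s : Rn n × ℝ => (x, s.2)) (𝓝 (y, t)) (𝓝 (x, t)) := by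
    have h1 : Continuous (fun s : Rn n × ℝ => (x, s.2)) := by fun_prop
    exact h1.tendsto (y, t)
  filter_upwards [htend.eventually (hL.isLittleO.def hε'0), htime.eventually (hj ε' hε'0),
    eventually_mem_slab (lt_add_one ‖y‖) ht htT] with s h1 h2 h3
  set D := ‖s - (y, t)‖ with hD
  have hDx : ‖s.1 - y‖ ≤ D := norm_fst_le (s - (y, t))
  have hDt : |s.2 - t| ≤ D := norm_snd_le (s - (y, t))
  have hD0 : 0 ≤ D := norm_nonneg _
  have hvs : |v s - z| ≤ 2 * K * D := by
    have h4 := hv s (y, t) h3.2.1.le h3.2.2.le ht.le htT.le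
    simp only at h4
    calc |v s - z| ≤ K * (‖s.1 - y‖ + |s.2 - t|) := h4
      _ ≤ K * (D + D) := by gcongr
      _ = _ := by ring
  have hn : ‖((x, s.1, h * s.2, v s) : Rn n × Rn n × ℝ × ℝ) - (x, y, τ, z)‖ ≤ B * D := by
    have a1 : 0 ≤ h * D := by positivity
    have a2 : 0 ≤ 2 * K * D := by positivity
    simp only [Prod.mk_sub_mk, sub_self, Prod.norm_mk, norm_zero, Real.norm_eq_abs]
    refine max_le (by positivity) (max_le ?_ (max_le ?_ ?_))
    · rw [hB]; linarith
    · rw [hτdef, ← mul_sub, abs_mul, abs_of_pos hh]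
      have : h * |s.2 - t| ≤ h * D := by gcongr
      rw [hB]; linarith
    · rw [hB]; linarith
  have h4 := (abs_le.1 h1).2
  rw [hLd] at h4
  simp only [Prod.mk_sub_mk, sub_self, zero_sub, inner_neg_right] at h4 h2
  have h5 : ε' * ‖((x, s.1, h * s.2, v s) : Rn n × Rn n × ℝ × ℝ) - (x, y, τ, z)‖
      ≤ ε' * (B * D) := by gcongr
  simp only [Prod.mk_sub_mk, sub_self] at h5
  have h6 : ε' * ‖((0, s.2 - t) : Rn n × ℝ)‖ ≤ ε' * D := by
    gcongr
    simp [Prod.norm_mk, hDt]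
  rw [jet_apply] at h2
  simp only [inner_zero_right, zero_add] at h2
  have h7 := hle x s.2 s.1 h3.2.1.le h3.2.2.le
  simp only [Prod.mk.eta] at h7
  have h8 : ε' * D + ε' * (B * D) = κ * (ε * D) := by rw [hε']; field_simp
  have h9 : (a + h * N y p z) * (s.2 - t) + inner ℝ (p + τ • Dx N y p z) (s.1 - y)
      - κ * (ε * D) ≤ κ * (v s - z) := by
    rw [inner_add_left, inner_smul_left, conj_trivial]
    have : h * s.2 - τ = h * (s.2 - t) := by rw [hτdef]; ring
    rw [this] at h4 h5
    rw [hκ] at h8 ⊢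
    linarith
  have h10 := mul_le_mul_of_nonneg_left h9 (inv_pos.2 hκ0).le
  rw [inv_mul_cancel_left₀ hκ0.ne', mul_sub, inv_mul_cancel_left₀ hκ0.ne'] at h10
  rw [jet_apply, inner_smul_left, conj_trivial]
  simp only [Prod.fst_sub, Prod.snd_sub]
  linarith

end ContactHJ

namespace ContactHJ

open Filter Topology Set

variable {n : ℕ}

section InfConvolution

variable {N : Hamiltonian n} {R K M C T h : ℝ} {v w : Rn n × ℝ → ℝ}

/-- `w (x, t)` is the minimum over `y` of `v (y, t) + kernel N R (x, y, h t, v (y, t))` for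
`0 ≤ t ≤ T`, attained within distance `2 h t M` of `x`. -/
structure IsInfConvolution (N : Hamiltonian n) (R M T h : ℝ) (v w : Rn n × ℝ → ℝ) : Prop where
  le : ∀ x t y, 0 ≤ t → t ≤ T → w (x, t) ≤ v (y, t) + kernel N R (x, y, h * t, v (y, t))
  exists_eq : ∀ x t, 0 ≤ t → t ≤ T → ∃ y, ‖x - y‖ ≤ 2 * (h * t) * M ∧
    w (x, t) = v (y, t) + kernel N R (x, y, h * t, v (y, t))

theorem kernel_continuous (hN : IsC1 N) (hR : 0 ≤ R) : Continuous (kernel N R) := by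
  rw [continuous_iff_continuousAt]
  intro θ₀
  rw [Metric.continuousAt_iff']
  intro ε hε
  filter_upwards [eventually_forall_dist_lt (kernelIntegrand_continuous hN.continuous) θ₀
    (isCompact_closedBall (0 : Rn n) R) (half_pos hε)] with θ hθ
  have h1 := kernel_sub_kernel_le hN.continuous hR (θ := θ) (θ' := θ₀) (b := ε / 2)
    fun p hp => ((abs_lt.1 (hθ p hp)).2).le
  have h2 := kernel_sub_kernel_le hN.continuous hR (θ := θ₀) (θ' := θ) (b := ε / 2)
    fun p hp => by linarith [(abs_lt.1 (hθ p hp)).1]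
  rw [Real.dist_eq, abs_lt]
  constructor <;> linarith

theorem exists_isInfConvolution (hN : IsC1 N) (hK : 0 ≤ K) (hR : K + 1 ≤ R) (hM0 : 0 ≤ M)
    (hM : ∀ x p u, ‖p‖ ≤ R → |N x p u| ≤ M) (hh : 0 ≤ h) (hv : LipOnStrip K T v) :
    ∃ w, IsInfConvolution N R M T h v w := by
  have hR0 : 0 ≤ R := by linarith
  have key : ∀ s : Rn n × ℝ, ∃ c : ℝ, 0 ≤ s.2 → s.2 ≤ T →
      (∀ y, c ≤ v (y, s.2) + kernel N R (s.1, y, h * s.2, v (y, s.2))) ∧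
      ∃ y, ‖s.1 - y‖ ≤ 2 * (h * s.2) * M ∧
        c = v (y, s.2) + kernel N R (s.1, y, h * s.2, v (y, s.2)) := by
    rintro ⟨x, t⟩
    by_cases ht : 0 ≤ t ∧ t ≤ T
    swap
    · exact ⟨0, fun h1 h2 => absurd ⟨h1, h2⟩ ht⟩
    obtain ⟨ht, htT⟩ := ht
    have hτ : 0 ≤ h * t := by positivity
    have hr : 0 ≤ 2 * (h * t) * M := by positivity
    have hvc : Continuous fun y => v (y, t) :=
      (hv.continuousOn hK).comp_continuous (by fun_prop) fun y => ⟨ht, htT⟩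
    have hc : Continuous fun y => v (y, t) + kernel N R (x, y, h * t, v (y, t)) :=
      hvc.add ((kernel_continuous hN hR0).comp
        (continuous_const.prodMk (continuous_id.prodMk (continuous_const.prodMk hvc))))
    obtain ⟨y, hy, hmin⟩ := (isCompact_closedBall x (2 * (h * t) * M)).exists_isMinOn
      ⟨x, Metric.mem_closedBall_self hr⟩ hc.continuousOn
    refine ⟨v (y, t) + kernel N R (x, y, h * t, v (y, t)), fun _ _ => ⟨fun y' => ?_, y, ?_, rfl⟩⟩
    · by_cases hy' : y' ∈ Metric.closedBall x (2 * (h * t) * M)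
      · exact hmin hy'
      · have h1 : v (y, t) + kernel N R (x, y, h * t, v (y, t))
            ≤ v (x, t) + kernel N R (x, x, h * t, v (x, t)) := hmin (Metric.mem_closedBall_self hr)
        have h2 := kernel_self_le hN.continuous hR0 hM x hτ (v (x, t))
        have h3 := le_kernel_of_bound hN.continuous hR0 hM x y' hτ (v (y', t))
        have h4 := (abs_le.1 (hv (x, t) (y', t) ht htT ht htT)).2
        simp only [sub_self, abs_zero, add_zero] at h4
        have h5 : 2 * (h * t) * M < ‖x - y'‖ := by
          rw [Metric.mem_closedBall, not_le, dist_comm, dist_eq_norm] at hy'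
          exact hy'
        have h6 : (K + 1) * ‖x - y'‖ ≤ R * ‖x - y'‖ := by gcongr
        change _ ≤ v (y', t) + kernel N R (x, y', h * t, v (y', t))
        linarith
    · rw [← dist_eq_norm, dist_comm]; exact hy
  choose w hw using key
  exact ⟨w, fun x t y h1 h2 => (hw (x, t) h1 h2).1 y, fun x t h1 h2 => (hw (x, t) h1 h2).2⟩

theorem IsInfConvolution.lipOnStrip (hw : IsInfConvolution N R M T h v w) (hN : IsC1 N)
    (hK : 0 ≤ K) (hR : 0 ≤ R) (hM0 : 0 ≤ M) (hC0 : 0 ≤ C)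
    (hM : ∀ x p u, ‖p‖ ≤ R → |N x p u| ≤ M)
    (hC : ∀ x p u u', |N x p u - N x p u'| ≤ C * |u - u'|) (hh : 0 ≤ h) (hh1 : h ≤ 1)
    (hv : LipOnStrip K T v) : LipOnStrip (R + K * (1 + T * C) + M) T w := by
  have key : ∀ z z' : Rn n × ℝ, 0 ≤ z.2 → z.2 ≤ T → 0 ≤ z'.2 → z'.2 ≤ T →
      w z - w z' ≤ (R + K * (1 + T * C) + M) * (‖z.1 - z'.1‖ + |z.2 - z'.2|) := by
    rintro ⟨x, t⟩ ⟨x', t'⟩ h1 h2 h3 h4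
    simp only at h1 h2 h3 h4 ⊢
    obtain ⟨y, -, hy⟩ := hw.exists_eq x' t' h3 h4
    have h5 := hw.le x t y h1 h2
    have h6 := kernel_diff_le hN.continuous hR hM hC x x' y (τ := h * t) (τ' := h * t')
      (by positivity) (v (y, t)) (v (y, t'))
    have h7 := hv (y, t) (y, t') h1 h2 h3 h4
    simp only [sub_self, norm_zero, zero_add] at h7
    have h8 := (abs_le.1 h7).2
    have h9 : |h * t - h * t'| ≤ 1 * |t - t'| := by
      rw [← mul_sub, abs_mul, abs_of_nonneg hh]; gcongr
    have hT : 0 ≤ T := h1.trans h2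
    have h10 : h * t' * (C * |v (y, t) - v (y, t')|) ≤ 1 * T * (C * (K * |t - t'|)) := by gcongr
    have h11 : M * |h * t - h * t'| ≤ M * (1 * |t - t'|) := by gcongr
    have h12 : 0 ≤ (K * (1 + T * C) + M) * ‖x - x'‖ := by positivity
    have h13 : 0 ≤ R * |t - t'| := by positivity
    nlinarith only [h5, h6, h8, h10, h11, h12, h13, hy]
  intro z z' h1 h2 h3 h4
  rw [abs_le]
  have a1 := key z z' h1 h2 h3 h4
  have a2 := key z' z h3 h4 h1 h2
  rw [norm_sub_rev, abs_sub_comm] at a2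
  constructor <;> linarith

theorem IsInfConvolution.initial_eq (hw : IsInfConvolution N R M T h v w) (hN : IsC1 N)
    (hR : 0 ≤ R) (hT : 0 ≤ T) (x : Rn n) : w (x, 0) = v (x, 0) := by
  obtain ⟨y, hy, hye⟩ := hw.exists_eq x 0 le_rfl hT
  have : x = y := by
    rw [mul_zero, mul_zero, zero_mul] at hy
    exact sub_eq_zero.1 (norm_le_zero_iff.1 hy)
  subst this
  obtain ⟨p, -, hp⟩ := exists_kernel_eq hN.continuous hR (x, x, h * 0, v (x, 0))
  rw [hye, ← hp]
  simp [kernelIntegrand]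

end InfConvolution

/-- The Hamiltonian `F + ε |p|² / 2`. -/
noncomputable def regularized (F : Hamiltonian n) (ε : ℝ) : Hamiltonian n :=
  fun x p u => F x p u + ε / 2 * ‖p‖ ^ 2

section Regularized

variable {F : Hamiltonian n} {ε : ℝ}

theorem regularized_isC1 (hF : IsC1 F) : IsC1 (regularized F ε) := by
  have h1 : ContDiff ℝ 1 fun z : Rn n × Rn n × ℝ => ‖z.2.1‖ ^ 2 :=
    ContDiff.norm_sq ℝ (by fun_prop)
  exact ContDiff.add hF (contDiff_const.mul h1)

theorem Dx_regularized (x p : Rn n) (u : ℝ) : Dx (regularized F ε) x p u = Dx F x p u := by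
  unfold Dx regularized gradient
  rw [fderiv_add_const]

theorem Du_regularized (x p : Rn n) (u : ℝ) : Du (regularized F ε) x p u = Du F x p u := by
  unfold Du regularized
  rw [deriv_add_const]

theorem Dp_regularized (hF : IsC1 F) (x p : Rn n) (u : ℝ) :
    Dp (regularized F ε) x p u = Dp F x p u + ε • p := by
  have hd : DifferentiableAt ℝ (fun q => F x q u) p := by
    have : ContDiff ℝ 1 fun q => F x q u := ContDiff.comp hF
      (by fun_prop : ContDiff ℝ 1 fun q : Rn n => (x, q, u))
    exact this.differentiable one_ne_zero p
  unfold Dp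
  refine HasGradientAt.gradient ?_
  rw [hasGradientAt_iff_hasFDerivAt]
  have h2 : HasFDerivAt (fun q : Rn n => ‖q‖ ^ 2) _ p := (hasFDerivAt_id p).norm_sq
  refine ((hasFDerivAt_toDual_innerSL hd).add (h2.const_mul (ε / 2))).congr_fderiv ?_
  refine ContinuousLinearMap.ext fun v => ?_
  simp
  ring

theorem regularized_strictConvexOn (hF : ConvexInP F) (hε : 0 < ε) (x : Rn n) (u : ℝ) :
    StrictConvexOn ℝ univ fun p => regularized F ε x p u := by
  refine StrongConvexOn.strictConvexOn (m := ε) ?_ hε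
  rw [strongConvexOn_iff_convex]
  simpa [regularized] using hF x u

end Regularized

theorem jacobiCommute_self (F : Hamiltonian n) : JacobiCommute F F := by
  intro x p u
  rw [real_inner_comm]
  ring

/-- Subjets of the inf-convolution of `v` by the kernel of a regularization of `F` correspond to
subjets of `v`, and the equation with Hamiltonian `H + l F` for `v` turns into the one with
Hamiltonian `H + (l + h) F` up to an error `η h`. -/
theorem exists_infConvolution_estimate {H F : Hamiltonian n} (hH : IsC1 H) (hF : IsC1 F)
    (hJ : JacobiCommute H F) (hFc : ConvexInP F) {C K T Λ M r U η : ℝ} (hC0 : 0 ≤ C)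
    (hC : ∀ x p u, |Du F x p u| ≤ C) (hK : 0 ≤ K) (hT : 0 ≤ T) (hΛ : 0 ≤ Λ) (hM0 : 0 ≤ M)
    (hη : 0 < η) :
    ∃ ε₀ > 0, ∃ h₀ > 0, ∀ ε h l : ℝ, 0 < ε → ε ≤ ε₀ → 0 < h → h ≤ h₀ → 0 ≤ l → l ≤ Λ →
      ∀ v w : Rn n × ℝ → ℝ, LipOnStrip K T v →
      (∀ y t, ‖y‖ ≤ r + 1 → 0 ≤ t → t ≤ T → |v (y, t)| ≤ U) →
      IsInfConvolution (regularized F ε) (K + 1) M T h v w →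
      ∀ z : Rn n × ℝ, ‖z.1‖ ≤ r → 0 < z.2 → z.2 < T → ∀ p a, SubJet w z (jet p a) →
      ∃ y q b κ, 0 < κ ∧ SubJet v (y, z.2) (jet q b) ∧
        |κ * (b + (H y q (v (y, z.2)) + l * F y q (v (y, z.2))))
          - (a + (H z.1 p (w z) + (l + h) * F z.1 p (w z)))| ≤ η * h := by
  set Q : Set (Rn n × Rn n × ℝ) := Metric.closedBall 0 (r + 1) ×ˢ
    (Metric.closedBall 0 (K + 1) ×ˢ Metric.closedBall 0 U) with hQdef
  have hQ : IsCompact Q :=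
    (isCompact_closedBall _ _).prod ((isCompact_closedBall _ _).prod (isCompact_closedBall _ _))
  set η₁ := η / (2 * (T * (1 + Λ) + 1)) with hη₁
  have hη₁0 : 0 < η₁ := by positivity
  have hη₁e : η₁ * (T * (1 + Λ) + 1) = η / 2 := by rw [hη₁]; field_simp
  obtain ⟨εH, hεH, τH, hτH, expH⟩ := exists_commuting_expansion hH hF hJ hQ hη₁0
  obtain ⟨εF, hεF, τF, hτF, expF⟩ :=
    exists_commuting_expansion hF hF (jacobiCommute_self F) hQ hη₁0
  obtain ⟨b₀, hb₀⟩ := hQ.exists_bound_of_continuousOn hF.continuous_Dx.continuousOn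
  set b₁ := max b₀ 0 with hb₁
  have hb₁0 : 0 ≤ b₁ := le_max_right _ _
  set τs := min (min τH τF) (min (1 / (2 * M + 1)) (min (1 / (2 * C + 1))
    (1 / (2 * (K * C + b₁) + 1)))) with hτs
  have hτs0 : 0 < τs := by positivity
  refine ⟨min (min εH εF) (η / (K + 1) ^ 2), by positivity, τs / (T + 1), by positivity, ?_⟩
  intro ε h l hε hε₀ hh hh₀ hl hlΛ v w hv hU hw z hzr hz0 hzT p a hj
  obtain ⟨x, t⟩ := z
  simp only at hzr hz0 hzT ⊢
  set N := regularized F ε with hN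
  have hNC : IsC1 N := regularized_isC1 hF
  have hK1 : 0 ≤ K + 1 := by linarith
  set τ := h * t with hτdef
  have hτ0 : 0 < τ := by positivity
  have hτT : τ ≤ h * T := by rw [hτdef]; gcongr
  have hττ : τ ≤ τs := by
    rw [le_div_iff₀ (by positivity)] at hh₀
    linarith
  have hτ1 : τ ≤ τH := hττ.trans ((min_le_left _ _).trans (min_le_left _ _))
  have hτ2 : τ ≤ τF := hττ.trans ((min_le_left _ _).trans (min_le_right _ _))
  have hτ3 : τ * (2 * M + 1) ≤ 1 := by
    have := hττ.trans ((min_le_right _ _).trans (min_le_left _ _))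
    rwa [le_div_iff₀ (by positivity)] at this
  have hτ4 : τ * (2 * C + 1) ≤ 1 := by
    have := hττ.trans ((min_le_right _ _).trans ((min_le_right _ _).trans (min_le_left _ _)))
    rwa [le_div_iff₀ (by positivity)] at this
  have hτ5 : τ * (2 * (K * C + b₁) + 1) ≤ 1 := by
    have := hττ.trans ((min_le_right _ _).trans ((min_le_right _ _).trans (min_le_right _ _)))
    rwa [le_div_iff₀ (by positivity)] at this
  have hε1 : ε ≤ εH := hε₀.trans ((min_le_left _ _).trans (min_le_left _ _))
  have hε2 : ε ≤ εF := hε₀.trans ((min_le_left _ _).trans (min_le_right _ _))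
  have hε3 : ε * (K + 1) ^ 2 ≤ η := by
    have := hε₀.trans (min_le_right _ _)
    rwa [le_div_iff₀ (by positivity)] at this
  obtain ⟨y, hxy, hye⟩ := hw.exists_eq x t hz0.le hzT.le
  rw [← hτdef] at hye hxy
  set ζ := v (y, t) with hζ
  have hyr : ‖y‖ ≤ r + 1 := by
    have h1 : ‖y‖ ≤ ‖x‖ + ‖x - y‖ := by
      calc ‖y‖ = ‖x - (x - y)‖ := by congr 1; abel
        _ ≤ _ := norm_sub_le _ _
    linarith
  have hDu : |τ * Du F y p ζ| ≤ τ * C := by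
    rw [abs_mul, abs_of_pos hτ0]; gcongr; exact hC y p ζ
  have hDu' := abs_le.1 hDu
  obtain ⟨hpR, hpe, hjv⟩ := hj.of_inf_kernel hNC hK1 (regularized_strictConvexOn hFc hε) hK hh hv
    hw.le hz0 hzT hye (by rw [hN, Du_regularized, ← hτdef, ← hζ]; linarith [hDu'.2])
  rw [← hζ, ← hτdef, hN, Du_regularized, Dx_regularized] at hjv
  rw [← hζ, ← hτdef] at hpe
  set κ := 1 - τ * Du F y p ζ with hκ
  have hκ0 : 0 < κ := by linarith [hDu'.2]
  have hpR' : ‖p‖ ≤ K + 1 := by simpa using hpR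
  have hmem : (y, p, ζ) ∈ Q := by
    refine ⟨by simpa using hyr, hpR, ?_⟩
    simpa using hU y t hyr hz0.le hzT.le
  -- the optimal momentum lies in the interior of the ball
  have hpK : ‖p‖ < K + 1 := by
    have h1 := (hjv.norm_le hK hv hz0 hzT).1
    rw [norm_smul, Real.norm_eq_abs, abs_of_pos (inv_pos.2 hκ0), inv_mul_le_iff₀ hκ0] at h1
    have h2 : ‖Dx F y p ζ‖ ≤ b₁ := (hb₀ _ hmem).trans (le_max_left _ _)
    have h3 : ‖p‖ ≤ ‖p + τ • Dx F y p ζ‖ + τ * b₁ := by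
      calc ‖p‖ = ‖(p + τ • Dx F y p ζ) - τ • Dx F y p ζ‖ := by congr 1; abel
        _ ≤ ‖p + τ • Dx F y p ζ‖ + ‖τ • Dx F y p ζ‖ := norm_sub_le _ _
        _ ≤ _ := by
          rw [norm_smul, Real.norm_eq_abs, abs_of_pos hτ0]; gcongr
    have h4 : κ * K ≤ (1 + τ * C) * K := by gcongr; linarith [hDu'.1]
    nlinarith only [h1, h3, h4, hτ5, hτ0]
  have hsub := sub_eq_smul_Dp_of_kernel_eq hNC hpK hpe
  rw [hN, Dp_regularized hF] at hsub
  set q := Dp F y p ζ + ε • p with hq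
  set L := inner ℝ p q - (F y p ζ + ε / 2 * ‖p‖ ^ 2) with hL
  have hx : x = y + τ • q := by rw [← hsub]; abel
  have hwx : w (x, t) = ζ + τ * L := by
    rw [hye, ← hpe]
    simp only [kernelIntegrand, hsub, inner_smul_right, hN, regularized, hL]
    ring
  obtain ⟨EH, -⟩ := expH ε τ hε hε1 hτ0 hτ1 y p ζ κ q L hmem hκ hq hL
  obtain ⟨EF, EF'⟩ := expF ε τ hε hε2 hτ0 hτ2 y p ζ κ q L hmem hκ hq hL
  refine ⟨y, _, _, κ, hκ0, hjv, ?_⟩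
  rw [← hζ, hwx]
  rw [← hx] at EH EF EF'
  set q' := κ⁻¹ • (p + τ • Dx F y p ζ)
  have hb : κ * (κ⁻¹ * (a + h * regularized F ε y p ζ)) = a + h * (F y p ζ + ε / 2 * ‖p‖ ^ 2) := by
    rw [mul_inv_cancel_left₀ hκ0.ne', regularized]
  have hmain : κ * (κ⁻¹ * (a + h * regularized F ε y p ζ) + (H y q' ζ + l * F y q' ζ))
      - (a + (H x p (ζ + τ * L) + (l + h) * F x p (ζ + τ * L)))
      = (κ * H y q' ζ - H x p (ζ + τ * L)) + l * (κ * F y q' ζ - F x p (ζ + τ * L))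
        + h * (ε / 2 * ‖p‖ ^ 2 - (F x p (ζ + τ * L) - F y p ζ)) := by
    rw [mul_add, hb]; ring
  rw [hmain]
  have t1 : |l * (κ * F y q' ζ - F x p (ζ + τ * L))| ≤ Λ * (η₁ * τ) := by
    rw [abs_mul, abs_of_nonneg hl]; gcongr
  have t2 : |ε / 2 * ‖p‖ ^ 2 - (F x p (ζ + τ * L) - F y p ζ)| ≤ η / 2 + η₁ := by
    refine (abs_sub _ _).trans (add_le_add ?_ EF')
    rw [abs_of_nonneg (by positivity)]
    have : ε / 2 * ‖p‖ ^ 2 ≤ ε / 2 * (K + 1) ^ 2 := by gcongr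
    linarith
  have t3 : |h * (ε / 2 * ‖p‖ ^ 2 - (F x p (ζ + τ * L) - F y p ζ))| ≤ h * (η / 2 + η₁) := by
    rw [abs_mul, abs_of_pos hh]; gcongr
  refine (abs_add_le _ _).trans ((add_le_add ((abs_add_le _ _).trans (add_le_add EH t1)) t3).trans ?_)
  have t4 : η₁ * τ + Λ * (η₁ * τ) ≤ η₁ * (h * T) + Λ * (η₁ * (h * T)) := by gcongr
  calc η₁ * τ + Λ * (η₁ * τ) + h * (η / 2 + η₁)
      ≤ η₁ * (h * T) + Λ * (η₁ * (h * T)) + h * (η / 2 + η₁) := by linarith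
    _ = h * (η₁ * (T * (1 + Λ) + 1) + η / 2) := by ring
    _ = η * h := by rw [hη₁e]; ring

end ContactHJ

namespace ContactHJ

open Filter Topology Set

variable {n : ℕ}

section Structure

variable {H F : Hamiltonian n}

theorem LocallyBounded.exists_bound (hH : LocallyBounded H) (R : ℝ) :
    ∃ K : ℝ, 0 < K ∧ ∀ x p u, ‖p‖ ≤ R → |H x p u| ≤ K := by
  obtain ⟨K, hK, h⟩ := hH (|R| + 1) (by positivity)
  refine ⟨K, hK, fun x p u hp => (h x p u ?_).1⟩
  rw [mem_ball_zero_iff]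
  linarith [le_abs_self R]

theorem LocallyBounded.linearSpeed (hH : LocallyBounded H) (hHC : IsC1 H) : LinearSpeed H := by
  intro R
  obtain ⟨K, hK, h⟩ := hH (|R| + 1) (by positivity)
  refine ⟨K, hK.le, fun x p q u hp hq => ?_⟩
  have hd : ∀ p, DifferentiableAt ℝ (fun q => H x q u) p := by
    have : ContDiff ℝ 1 fun q => H x q u := ContDiff.comp hHC
      (by fun_prop : ContDiff ℝ 1 fun q : Rn n => (x, q, u))
    exact this.differentiable one_ne_zero
  refine (convex_closedBall (0 : Rn n) R).norm_image_sub_le_of_norm_hasFDerivWithin_le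
    (f := fun q => H x q u) (C := K * (1 + ‖x‖))
    (fun p _ => (hasFDerivAt_toDual_innerSL (hd p)).hasFDerivWithinAt) (fun p hp => ?_)
    (by simpa using hq) (by simpa using hp)
  rw [innerSL_apply_norm]
  refine (h x p u ?_).2
  rw [mem_ball_zero_iff]
  have : ‖p‖ ≤ R := by simpa using hp
  linarith [le_abs_self R]

theorem IsC1.abs_sub_le_of_Du_le (hH : IsC1 H) {C : ℝ} (hC : ∀ x p u, |Du H x p u| ≤ C)
    (x p : Rn n) (u u' : ℝ) : |H x p u - H x p u'| ≤ C * |u - u'| := by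
  have hd : Differentiable ℝ (fun r => H x p r) := by
    have : ContDiff ℝ 1 fun r => H x p r := ContDiff.comp
      (g := fun z : Rn n × Rn n × ℝ => H z.1 z.2.1 z.2.2) hH
      (by fun_prop : ContDiff ℝ 1 fun r : ℝ => (x, p, r))
    exact this.differentiable one_ne_zero
  exact convex_univ.norm_image_sub_le_of_norm_deriv_le (f := fun r => H x p r)
    (fun r _ => hd r) (fun r _ => hC x p r) (mem_univ u') (mem_univ u)

theorem IsC1.add_const_mul (hH : IsC1 H) (hF : IsC1 F) (l : ℝ) :
    IsC1 fun x p u => H x p u + l * F x p u :=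
  ContDiff.add hH (contDiff_const.mul hF)

theorem LinearSpeed.add_const_mul (hH : LinearSpeed H) (hF : LinearSpeed F) (l : ℝ) :
    LinearSpeed fun x p u => H x p u + l * F x p u := by
  intro R
  obtain ⟨A, hA, h1⟩ := hH R
  obtain ⟨B, hB, h2⟩ := hF R
  refine ⟨A + |l| * B, by positivity, fun x p q u hp hq => ?_⟩
  have e : H x p u + l * F x p u - (H x q u + l * F x q u)
      = (H x p u - H x q u) + l * (F x p u - F x q u) := by ring
  rw [e]
  refine (abs_add_le _ _).trans ?_
  rw [abs_mul]
  have h3 : |l| * |F x p u - F x q u| ≤ |l| * (B * (1 + ‖x‖) * ‖p - q‖) := by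
    gcongr; exact h2 x p q u hp hq
  linarith [h1 x p q u hp hq]

theorem abs_add_const_mul_sub_le {C D Λ l : ℝ} (hl : 0 ≤ l) (hlΛ : l ≤ Λ)
    (h1 : ∀ x p u u', |H x p u - H x p u'| ≤ C * |u - u'|)
    (h2 : ∀ x p u u', |F x p u - F x p u'| ≤ D * |u - u'|) (x p : Rn n) (u u' : ℝ) :
    |H x p u + l * F x p u - (H x p u' + l * F x p u')| ≤ (C + Λ * D) * |u - u'| := by
  have e : H x p u + l * F x p u - (H x p u' + l * F x p u')
      = (H x p u - H x p u') + l * (F x p u - F x p u') := by ring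
  rw [e]
  refine (abs_add_le _ _).trans ?_
  rw [abs_mul, abs_of_nonneg hl]
  have h3 : l * |F x p u - F x p u'| ≤ Λ * (D * |u - u'|) := by
    gcongr
    exacts [hl.trans hlΛ, h2 x p u u']
  linarith [h1 x p u u']

theorem ConvexInP.add_const_mul (hH : ConvexInP H) (hF : ConvexInP F) {l : ℝ} (hl : 0 ≤ l) :
    ConvexInP fun x p u => H x p u + l * F x p u := fun x u =>
  (hH x u).add ((hF x u).smul hl)

theorem Superlinear.exists_le (hH : Superlinear H) {m : ℝ} :
    ∃ R : ℝ, 0 < R ∧ ∀ x p u, R ≤ ‖p‖ → m * ‖p‖ ≤ H x p u := by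
  obtain ⟨R, -, hR⟩ := (hasBasis_cobounded_norm (E := Rn n)).eventually_iff.1 (hH m)
  refine ⟨|R| + 1, by positivity, fun x p u hp => ?_⟩
  have h1 : 0 < ‖p‖ := lt_of_lt_of_le (by positivity) hp
  have h2 := hR (x := p) (by
    have := le_abs_self R
    change R ≤ ‖p‖
    linarith) x u
  rwa [le_div_iff₀ h1] at h2

/-- Coercivity of `H + l F`, uniform for `l` in a bounded interval. -/
theorem exists_uniform_coercivity (hH2 : Superlinear H) (hF1 : LocallyBounded F)
    (hF2 : Superlinear F) (Λ c : ℝ) : ∃ R : ℝ, 0 ≤ R ∧ ∀ l, 0 ≤ l → l ≤ Λ → ∀ x p u,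
      H x p u + l * F x p u ≤ c → ‖p‖ ≤ R := by
  obtain ⟨R₁, hR₁, h1⟩ := hH2.exists_le (m := 1)
  obtain ⟨R₂, hR₂, h2⟩ := hF2.exists_le (m := 0)
  obtain ⟨B, hB, h3⟩ := hF1.exists_bound R₂
  have hFB : ∀ x p u, -B ≤ F x p u := by
    intro x p u
    rcases le_total R₂ ‖p‖ with h | h
    · have := h2 x p u h
      linarith
    · exact (abs_le.1 (h3 x p u h)).1
  refine ⟨max R₁ (c + Λ * B), le_max_of_le_left hR₁.le, fun l hl hlΛ x p u hle => ?_⟩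
  by_contra! hlt
  have h4 := h1 x p u ((le_max_left _ _).trans hlt.le)
  have h5 : c + Λ * B < ‖p‖ := (le_max_right _ _).trans_lt hlt
  have h6 : l * (-B) ≤ l * F x p u := mul_le_mul_of_nonneg_left (hFB x p u) hl
  have h7 : l * B ≤ Λ * B := by gcongr
  linarith

theorem exists_uniform_lipOnStrip (hH : IsC1 H) (hF : IsC1 F) (hH1 : LocallyBounded H)
    (hF1 : LocallyBounded F) (hH2 : Superlinear H) (hF2 : Superlinear F) (hH4 : LipschitzInU H)
    (hF4 : LipschitzInU F) {u₀ : Rn n → ℝ} {K₀ : ℝ≥0} (hu₀ : LipschitzWith K₀ u₀) {T Λ : ℝ}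
    (hΛ : 0 ≤ Λ) :
    ∃ K, 0 ≤ K ∧ ∀ l, 0 ≤ l → l ≤ Λ → ∀ w, IsLipschitzOnStrips w →
      IsViscositySolution (fun x p u => H x p u + l * F x p u) u₀ w →
      LipOnStrip K T fun z => w z.1 z.2 := by
  obtain ⟨CH, hCH, hCH'⟩ := hH4
  obtain ⟨CF, hCF, hCF'⟩ := hF4
  obtain ⟨BH, hBH, hBH'⟩ := hH1.exists_bound K₀
  obtain ⟨BF, hBF, hBF'⟩ := hF1.exists_bound K₀
  set C := CH + Λ * CF with hC
  set C₀ := BH + Λ * BF with hC₀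
  have hC0 : 0 ≤ C := by positivity
  have hC₀0 : 0 ≤ C₀ := by positivity
  obtain ⟨R, hR, hR'⟩ := exists_uniform_coercivity hH2 hF1 hF2 Λ (Real.exp (C * (T + 1)) * C₀)
  refine ⟨K₀ + R + Real.exp (C * (T + 1)) * C₀, by positivity, fun l hl hlΛ w hwL hw => ?_⟩
  refine lipOnStrip_of_isViscositySolution (hH.add_const_mul hF l).continuous
    ((hH1.linearSpeed hH).add_const_mul (hF1.linearSpeed hF) l) hC0
    (abs_add_const_mul_sub_le hl hlΛ (hH.abs_sub_le_of_Du_le hCH')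
      (hF.abs_sub_le_of_Du_le hCF')) K₀.2
    (fun x y => by simpa [Real.dist_eq, dist_eq_norm] using hu₀.dist_le_mul x y) hC₀0
    (fun x p u hp => ?_) hR (hR' l hl hlΛ) hwL hw
  refine (abs_add_le _ _).trans ?_
  rw [abs_mul, abs_of_nonneg hl]
  exact add_le_add (hBH' x p u hp) (by gcongr; exact hBF' x p u hp)

end Structure

theorem exists_ball_subset_slab {T : ℝ} {z : Rn n × ℝ} (h0 : 0 < z.2) (hT : z.2 < T) :
    ∃ ρ > 0, ∀ z' ∈ Metric.ball z ρ, ‖z'.1‖ < ‖z.1‖ + 1 ∧ 0 < z'.2 ∧ z'.2 < T :=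
  Metric.eventually_nhds_iff_ball.1 (eventually_mem_slab (lt_add_one ‖z.1‖) h0 hT)

/-- The solutions for the parameters `l` and `l - h` compared through the kernel of `F`. -/
theorem exists_kernel_comparison {H F : Hamiltonian n} (hH : IsC1 H) (hF : IsC1 F)
    (hH1 : LocallyBounded H) (hF1 : LocallyBounded F) (hH2 : Superlinear H) (hF2 : Superlinear F)
    (hH4 : LipschitzInU H) (hF4 : LipschitzInU F) (hJ : JacobiCommute H F) (hFc : ConvexInP F)
    {u₀ : Rn n → ℝ} {K₀ : ℝ≥0} (hu₀ : LipschitzWith K₀ u₀) {v : Rn n → ℝ → ℝ → ℝ}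
    (hvLip : ∀ l : ℝ, 0 ≤ l → IsLipschitzOnStrips (fun x t => v x t l))
    (hv : ∀ l : ℝ, 0 ≤ l →
      IsViscositySolution (fun x p u => H x p u + l * F x p u) u₀ (fun x t => v x t l))
    (x₀ : Rn n) {t₀ l₀ : ℝ} (ht₀ : 0 < t₀) (hl₀ : 0 < l₀) :
    ∃ K M : ℝ, 0 ≤ K ∧ 0 ≤ M ∧ (∀ x, |v x t₀ l₀ - v x₀ t₀ l₀| ≤ K * ‖x - x₀‖) ∧
      ∀ η : ℝ, 0 < η → ∃ ε > 0, ε ≤ η ∧ ∃ h₀ > 0, h₀ < l₀ ∧ ∀ h, 0 < h → h ≤ h₀ →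
        (∀ y, v x₀ t₀ l₀ ≤ v y t₀ (l₀ - h) + kernel (regularized F ε) (K + 1)
          (x₀, y, h * t₀, v y t₀ (l₀ - h)) + η * h) ∧
        (ConvexInP H → ∃ y, ‖x₀ - y‖ ≤ 2 * (h * t₀) * M ∧
          v y t₀ (l₀ - h) + kernel (regularized F ε) (K + 1)
            (x₀, y, h * t₀, v y t₀ (l₀ - h)) ≤ v x₀ t₀ l₀ + η * h) := by
  set T := t₀ + 2 with hT
  have hT0 : 0 ≤ T := by positivity
  obtain ⟨K, hK, hKv⟩ := exists_uniform_lipOnStrip (T := T) hH hF hH1 hF1 hH2 hF2 hH4 hF4 hu₀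
    hl₀.le
  obtain ⟨CH, hCH, hCH'⟩ := hH4
  obtain ⟨CF, hCF, hCF'⟩ := hF4
  obtain ⟨BF, hBF, hBF'⟩ := hF1.exists_bound (K + 1)
  set M := BF + (K + 1) ^ 2 with hM
  have hM0 : 0 ≤ M := by positivity
  have hNM : ∀ ε, 0 < ε → ε ≤ 1 → ∀ x p u, ‖p‖ ≤ K + 1 → |regularized F ε x p u| ≤ M := by
    intro ε hε hε1 x p u hp
    refine (abs_add_le _ _).trans (add_le_add (hBF' x p u hp) ?_)
    rw [abs_of_nonneg (by positivity)]
    calc ε / 2 * ‖p‖ ^ 2 ≤ 1 * (K + 1) ^ 2 := by gcongr; linarith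
      _ = _ := one_mul _
  have hFu := hF.abs_sub_le_of_Du_le hCF'
  have hNu : ∀ ε x p u u', |regularized F ε x p u - regularized F ε x p u'| ≤ CF * |u - u'| := by
    intro ε x p u u'
    simpa [regularized] using hFu x p u u'
  set K₂ := K + 1 + K * (1 + T * CF) + M with hK₂
  have hKK₂ : K ≤ K₂ := by
    have : 0 ≤ K * (1 + T * CF) := by positivity
    linarith
  have hK₂0 : 0 ≤ K₂ := hK.trans hKK₂
  set G : Hamiltonian n := fun x p u => H x p u + l₀ * F x p u with hG
  have hGc := (hH.add_const_mul hF l₀).continuous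
  obtain ⟨A, hA, hAG⟩ := ((hH1.linearSpeed hH).add_const_mul (hF1.linearSpeed hF) l₀) K₂
  set C := CH + l₀ * CF with hC
  have hC0 : 0 ≤ C := by positivity
  have hGu : ∀ x p u u', |G x p u - G x p u'| ≤ C * |u - u'| :=
    abs_add_const_mul_sub_le hl₀.le le_rfl (hH.abs_sub_le_of_Du_le hCH') hFu
  obtain ⟨r, hr, hcomp⟩ := exists_radius_comparison hA x₀ ht₀.le le_rfl
  have hv₀ := hKv l₀ hl₀.le le_rfl _ (hvLip l₀ hl₀.le) (hv l₀ hl₀.le)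
  refine ⟨K, M, hK, hM0, fun x => ?_, fun η hη => ?_⟩
  · have := hv₀ (x, t₀) (x₀, t₀) ht₀.le (by simp [hT]) ht₀.le (by simp [hT])
    simpa using this
  set η' := η / (Real.exp (C * t₀) * (t₀ + 1)) with hη'
  have hη'0 : 0 < η' := by positivity
  have hη'e : ∀ h, 0 < h → Real.exp (C * t₀) * (η' * h * t₀) ≤ η * h := by
    intro h hh
    have h1 : Real.exp (C * t₀) * (η' * h * (t₀ + 1)) = η * h := by rw [hη']; field_simp
    have h2 : Real.exp (C * t₀) * (η' * h * t₀) ≤ Real.exp (C * t₀) * (η' * h * (t₀ + 1)) := by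
      gcongr; linarith
    linarith
  obtain ⟨ε₀, hε₀, h₀, hh₀, hest⟩ := exists_infConvolution_estimate hH hF hJ hFc (K := K) (T := T)
    (Λ := l₀) (M := M) (r := r + 1) (U := |u₀ 0| + K * (r + 1 + 1 + T)) hCF.le hCF' hK hT0 hl₀.le
    hM0 hη'0
  set ε := min ε₀ (min η 1) with hεdef
  have hε : 0 < ε := by positivity
  have hε1 : ε ≤ 1 := (min_le_right _ _).trans (min_le_right _ _)
  refine ⟨ε, hε, (min_le_right _ _).trans (min_le_left _ _), min h₀ (min (l₀ / 2) 1),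
    by positivity, lt_of_le_of_lt ((min_le_right _ _).trans (min_le_left _ _)) (by linarith),
    fun h hh hhle => ?_⟩
  have hh1 : h ≤ h₀ := hhle.trans (min_le_left _ _)
  have hh2 : h ≤ l₀ / 2 := hhle.trans ((min_le_right _ _).trans (min_le_left _ _))
  have hh3 : h ≤ 1 := hhle.trans ((min_le_right _ _).trans (min_le_right _ _))
  set l := l₀ - h with hl
  have hl0 : 0 ≤ l := by linarith
  have hll : l ≤ l₀ := by linarith
  have hlh : l + h = l₀ := by rw [hl]; ring
  have hvl := hKv l hl0 hll _ (hvLip l hl0) (hv l hl0)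
  set V : Rn n × ℝ → ℝ := fun z => v z.1 z.2 l with hV
  set V₀ : Rn n × ℝ → ℝ := fun z => v z.1 z.2 l₀ with hV₀
  have hNC : IsC1 (regularized F ε) := regularized_isC1 hF
  obtain ⟨w, hw⟩ := exists_isInfConvolution (T := T) (h := h) hNC hK le_rfl hM0 (hNM ε hε hε1)
    hh.le hvl
  have hwL : LipOnStrip K₂ T w :=
    hw.lipOnStrip hNC hK (by linarith) hM0 hCF.le (hNM ε hε hε1) (hNu ε) hh.le hh3 hvl
  have hw0 : ∀ x, w (x, 0) = V₀ (x, 0) := fun x => by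
    rw [hw.initial_eq hNC (by linarith) hT0]
    exact ((hv l hl0).initial_eq x).trans ((hv l₀ hl₀.le).initial_eq x).symm
  have hU : ∀ y t, ‖y‖ ≤ r + 1 + 1 → 0 ≤ t → t ≤ T →
      |V (y, t)| ≤ |u₀ 0| + K * (r + 1 + 1 + T) := by
    intro y t hy ht htT
    have h1 := hvl (y, t) (0, 0) ht htT le_rfl hT0
    have h2 : V (0, 0) = u₀ 0 := (hv l hl0).initial_eq 0
    simp only [sub_zero, abs_of_nonneg ht] at h1
    have h3 : |V (y, t)| ≤ |V (y, t) - V (0, 0)| + |V (0, 0)| := by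
      simpa using abs_add_le (V (y, t) - V (0, 0)) (V (0, 0))
    have h4 : K * (‖y‖ + t) ≤ K * (r + 1 + 1 + T) := by gcongr
    rw [h2] at h3
    have h5 : |V (y, t) - V (0, 0)| ≤ K * (‖y‖ + t) := h1
    rw [h2] at h5
    linarith
  have hestw := hest ε h l hε (min_le_left _ _) hh hh1 hl0 hll V w hvl hU hw
  rw [hlh] at hestw
  have hcl := (hvLip l hl0).continuousOn
  have hc₀ := (hvLip l₀ hl₀.le).continuousOn
  have hGlc := (hH.add_const_mul hF l).continuous
  constructor
  · have key := hcomp (G := G) (K := K₂) (C := C) (η₁ := 0) (η₂ := η' * h) (δ₀ := 0) (w₁ := V₀)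
      (w₂ := w) hK₂0 hC0 le_rfl (by positivity) le_rfl hGc hAG hGu (hv₀.mono hKK₂ le_rfl) hwL
      (fun x _ => by rw [hw0 x]; simp)
      (fun z _ h0 _ p a hj => (hv l₀ hl₀.le).1.superJet_le hGc hc₀ h0 hj)
      (fun z hzr h0 hzT p a hj => by
        obtain ⟨y, q, b, κ, hκ, hjv, hle⟩ := hestw z (by linarith) h0 hzT p a hj
        have h1 := (hv l hl0).2.le_subJet hGlc hcl (z₀ := (y, z.2)) h0 hjv
        have h2 := mul_nonneg hκ.le h1
        have h3 := (abs_le.1 hle).2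
        simp only at h2 h3
        simp only [hG]
        linarith)
    intro y
    have h1 := hw.le x₀ t₀ y ht₀.le (by linarith)
    rw [zero_add, zero_add] at key
    have h2 := hη'e h hh
    have h3 : V₀ (x₀, t₀) ≤ w (x₀, t₀) + η * h := by linarith
    exact h3.trans (by linarith)
  · intro hHc
    have hGlconv : ConvexInP fun x p u => H x p u + l * F x p u := hHc.add_const_mul hFc hl0
    have hGconv : ConvexInP G := hHc.add_const_mul hFc hl₀.le
    -- subjets of the solution satisfy the subsolution inequality
    have hBJ : ∀ z : Rn n × ℝ, 0 < z.2 → z.2 < T → ∀ p a, SubJet V z (jet p a) →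
        a + (H z.1 p (V z) + l * F z.1 p (V z)) ≤ 0 := by
      intro z h0 hzT p a hj
      obtain ⟨ρ, hρ, hball⟩ := exists_ball_subset_slab h0 hzT
      exact le_of_jet_of_differentiableAt (G := fun x p u => H x p u + l * F x p u) hρ
        ((hvl.lipschitzOnWith hK).mono fun z' hz' => ⟨(hball z' hz').2.1.le, (hball z' hz').2.2.le⟩)
        hGlc hGlconv
        (fun z' hz' p a hd => (hv l hl0).1.superJet_le hGlc hcl (hball z' hz').2.1 hd.superJet)
        (Or.inr hj)
    have hdiff : ∀ z : Rn n × ℝ, ‖z.1‖ ≤ r + 1 → 0 < z.2 → z.2 < T → ∀ p a,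
        SubJet w z (jet p a) → a + G z.1 p (w z) ≤ η' * h := by
      intro z hzr h0 hzT p a hj
      obtain ⟨y, q, b, κ, hκ, hjv, hle⟩ := hestw z hzr h0 hzT p a hj
      have h1 := hBJ (y, z.2) h0 hzT q b hjv
      have h2 := mul_nonpos_of_nonneg_of_nonpos hκ.le h1
      have h3 := (abs_le.1 hle).1
      simp only at h2 h3
      simp only [hG]
      linarith
    have key := hcomp (G := G) (K := K₂) (C := C) (η₁ := η' * h) (η₂ := 0) (δ₀ := 0) (w₁ := w)
      (w₂ := V₀) hK₂0 hC0 (by positivity) le_rfl le_rfl hGc hAG hGu hwL (hv₀.mono hKK₂ le_rfl)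
      (fun x _ => by rw [hw0 x]; simp)
      (fun z hzr h0 hzT p a hj => by
        obtain ⟨ρ, hρ, hball⟩ := exists_ball_subset_slab h0 hzT
        exact le_of_jet_of_differentiableAt hρ
          ((hwL.lipschitzOnWith hK₂0).mono
            fun z' hz' => ⟨(hball z' hz').2.1.le, (hball z' hz').2.2.le⟩) hGc hGconv
          (fun z' hz' p a hd => hdiff z' (by linarith [(hball z' hz').1]) (hball z' hz').2.1
            (hball z' hz').2.2 p a hd.subJet) (Or.inl hj))
      (fun z _ h0 _ p a hj => by
        have := (hv l₀ hl₀.le).2.le_subJet hGc hc₀ h0 hj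
        simpa using this)
    obtain ⟨y, hy, hye⟩ := hw.exists_eq x₀ t₀ ht₀.le (by linarith)
    refine ⟨y, hy, ?_⟩
    rw [zero_add, add_zero] at key
    have h2 := hη'e h hh
    have h3 : w (x₀, t₀) ≤ V₀ (x₀, t₀) + η * h := by linarith
    rw [hye] at h3
    exact h3

end ContactHJ

namespace ContactHJ

open Filter Topology Set

variable {n : ℕ}

/-- A differentiable convex Hamiltonian lies above its tangents in the momentum. -/
theorem ConvexInP.add_inner_Dp_le {F : Hamiltonian n} (hFc : ConvexInP F) (hF : IsC1 F)
    (x p₀ p : Rn n) (u : ℝ) : F x p₀ u + inner ℝ (Dp F x p₀ u) (p - p₀) ≤ F x p u := by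
  have hd : DifferentiableAt ℝ (fun q => F x q u) p₀ := by
    have : ContDiff ℝ 1 fun q => F x q u := ContDiff.comp hF
      (by fun_prop : ContDiff ℝ 1 fun q : Rn n => (x, q, u))
    exact (this.differentiable one_ne_zero) p₀
  have hline : HasDerivAt (fun s : ℝ => p₀ + s • (p - p₀)) (p - p₀) 0 := by
    simpa using ((hasDerivAt_id (0 : ℝ)).smul_const (p - p₀)).const_add p₀
  have hg : HasDerivAt (fun s : ℝ => F x (p₀ + s • (p - p₀)) u)
      (inner ℝ (Dp F x p₀ u) (p - p₀)) 0 := by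
    have h1 : HasFDerivAt (fun q => F x q u) (innerSL ℝ (Dp F x p₀ u))
        (p₀ + (0 : ℝ) • (p - p₀)) := by
      simpa [Dp] using hasFDerivAt_toDual_innerSL hd
    exact h1.comp_hasDerivAt (0 : ℝ) hline
  have hc : ConvexOn ℝ univ fun s : ℝ => F x (p₀ + s • (p - p₀)) u := by
    have := (hFc x u).comp_affineMap (AffineMap.lineMap p₀ p : ℝ →ᵃ[ℝ] Rn n)
    refine this.congr ?_ |>.subset (by simp) convex_univ
    intro s _
    simp [AffineMap.lineMap_apply, add_comm]
  have := hc.le_slope_of_hasDerivAt (mem_univ 0) (mem_univ 1) one_pos hg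
  simp [slope_def_field] at this
  linarith

/-- For short times `z ↦ z + kernel N R (x, y, τ, z)` is nondecreasing. -/
theorem add_kernel_mono {N : Hamiltonian n} {R C τ z z' : ℝ}
    (hN : Continuous fun z : Rn n × Rn n × ℝ => N z.1 z.2.1 z.2.2) (hR : 0 ≤ R)
    (hC : ∀ x p u u', |N x p u - N x p u'| ≤ C * |u - u'|) (hτ : 0 ≤ τ) (hτC : τ * C ≤ 1)
    (hz : z ≤ z') (x y : Rn n) :
    z + kernel N R (x, y, τ, z) ≤ z' + kernel N R (x, y, τ, z') := by
  have := kernel_sub_kernel_le hN hR (θ := (x, y, τ, z)) (θ' := (x, y, τ, z')) (b := z' - z)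
    fun p _ => by
      have h1 : τ * (N y p z' - N y p z) ≤ τ * (C * (z' - z)) := by
        gcongr
        refine (le_abs_self _).trans ((hC y p z' z).trans_eq ?_)
        rw [abs_of_nonneg (sub_nonneg.2 hz)]
      have h2 : τ * C * (z' - z) ≤ 1 * (z' - z) :=
        mul_le_mul_of_nonneg_right hτC (sub_nonneg.2 hz)
      simp only [kernelIntegrand]
      linarith
  linarith

theorem abs_regularized_sub_le {F : Hamiltonian n} {C : ℝ}
    (hC : ∀ x p u u', |F x p u - F x p u'| ≤ C * |u - u'|) (ε : ℝ) (x p : Rn n) (u u' : ℝ) :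
    |regularized F ε x p u - regularized F ε x p u'| ≤ C * |u - u'| := by
  simpa [regularized] using hC x p u u'

/-- One-sided comparison with the short-time kernel yields the subsolution inequality. -/
theorem add_mul_le_zero_of_le_kernel {F : Hamiltonian n} (hF : IsC1 F) (hFc : ConvexInP F) {C : ℝ}
    (hC : ∀ x p u u', |F x p u - F x p u'| ≤ C * |u - u'|) {V : Rn n → ℝ → ℝ}
    {φ : Rn n × ℝ → ℝ} {x₀ p : Rn n} {t₀ l₀ a R : ℝ} (ht₀ : 0 ≤ t₀) (hR : 0 ≤ R)
    (hφ : HasFDerivAt φ (jet p a) (x₀, l₀)) (hVφ : V x₀ l₀ = φ (x₀, l₀))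
    (hle : ∀ x l, 0 < l → V x l ≤ φ (x, l))
    (hcmp : ∀ η : ℝ, 0 < η → ∃ ε > 0, ∃ h₀ > 0, h₀ < l₀ ∧ ∀ h, 0 < h → h ≤ h₀ → ∀ y,
      V x₀ l₀ ≤ V y (l₀ - h)
        + kernel (regularized F ε) R (x₀, y, h * t₀, V y (l₀ - h)) + η * h) :
    a + t₀ * F x₀ p (φ (x₀, l₀)) ≤ 0 := by
  set u := φ (x₀, l₀) with hu
  set q := Dp F x₀ p u with hq
  set d : Rn n × ℝ := (-(t₀ • q), -1) with hd
  set c := ‖d‖ + t₀ + 1 with hc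
  have hc0 : 0 < c := by positivity
  refine le_of_forall_pos_le_add fun η' hη' => ?_
  rw [zero_add]
  set η := η' / c with hη
  have hη0 : 0 < η := by positivity
  have hηc : η * c = η' := by rw [hη]; field_simp
  rw [← hηc]
  obtain ⟨ε, hε, h₀, hh₀, hhl, hk⟩ := hcmp η hη0
  have hpath : Tendsto (fun h : ℝ => (x₀, l₀) + h • d) (𝓝[>] 0) (𝓝 (x₀, l₀)) := by
    have : Continuous fun h : ℝ => (x₀, l₀) + h • d := by fun_prop
    simpa using (this.tendsto 0).mono_left nhdsWithin_le_nhds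
  have hFcont : Continuous fun z : (Rn n × ℝ) × Rn n => F z.1.1 z.2 z.1.2 :=
    hF.continuous.comp
      (by fun_prop : Continuous fun z : (Rn n × ℝ) × Rn n => (z.1.1, z.2, z.1.2))
  have hgraph : Tendsto (fun z : Rn n × ℝ => (z.1, φ z)) (𝓝 (x₀, l₀)) (𝓝 (x₀, u)) :=
    (continuous_fst.tendsto _).prodMk_nhds hφ.continuousAt
  have hunif := hgraph.eventually (eventually_forall_dist_lt hFcont (x₀, u)
    (isCompact_closedBall (0 : Rn n) R) hη0)
  have hsmall : ∀ᶠ h : ℝ in 𝓝[>] 0, h * t₀ * C < 1 := by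
    have : Continuous fun h : ℝ => h * t₀ * C := by fun_prop
    exact ((this.tendsto 0).mono_left nhdsWithin_le_nhds).eventually
      (gt_mem_nhds (by simp))
  obtain ⟨h, hjet, hclose, hτ, hh0, hhh⟩ := ((hpath.eventually (hφ.superJet η hη0)).and
    ((hpath.eventually hunif).and (hsmall.and (Ioc_mem_nhdsGT hh₀)))).exists
  have hz : (x₀, l₀) + h • d = (x₀ - (h * t₀) • q, l₀ - h) := by
    ext1 <;> simp [hd, sub_eq_add_neg, smul_smul]
  rw [add_sub_cancel_left, norm_smul, map_smul, hz, Real.norm_eq_abs, abs_of_pos hh0, jet_apply]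
    at hjet
  rw [hz] at hclose
  set y := x₀ - (h * t₀) • q with hy
  have hV := hk h hh0 hhh y
  have hmono := add_kernel_mono (R := R) (regularized_isC1 (ε := ε) hF).continuous hR
    (abs_regularized_sub_le hC ε) (mul_nonneg hh0.le ht₀) hτ.le
    (hle y (l₀ - h) (by linarith)) x₀ y
  obtain ⟨r, hr, hre⟩ := exists_kernel_eq (regularized_isC1 (ε := ε) hF).continuous hR
    (x₀, y, h * t₀, φ (y, l₀ - h))
  have hF1 := (abs_lt.1 (hclose r hr)).1
  have hF2 := hFc.add_inner_Dp_le hF x₀ p r u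
  have hxy : x₀ - y = (h * t₀) • q := by simp [hy]
  simp only [kernelIntegrand, regularized, hxy, inner_smul_right] at hre
  rw [inner_sub_right, real_inner_comm r, real_inner_comm p] at hF2
  simp only [hd, inner_neg_right, inner_smul_right, smul_eq_mul] at hjet
  have hε2 : 0 ≤ h * t₀ * (ε / 2 * ‖r‖ ^ 2) := by positivity
  have hprod : h * t₀ * (inner ℝ r q - F y r (φ (y, l₀ - h)))
      ≤ h * t₀ * (inner ℝ p q - F x₀ p u + η) := by
    refine mul_le_mul_of_nonneg_left ?_ (by positivity)
    linarith
  have : h * (a + t₀ * F x₀ p u) ≤ h * (η * c) := by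
    rw [hc]
    linarith
  exact le_of_mul_le_mul_left this hh0

/-- Almost optimality of the short-time kernel at a nearby point yields the supersolution
inequality. -/
theorem zero_le_add_mul_of_kernel_le {F : Hamiltonian n} (hF : IsC1 F) {C : ℝ}
    (hC : ∀ x p u u', |F x p u - F x p u'| ≤ C * |u - u'|) {V : Rn n → ℝ → ℝ}
    {φ : Rn n × ℝ → ℝ} {x₀ p : Rn n} {t₀ l₀ a R M : ℝ} (ht₀ : 0 ≤ t₀) (hM : 0 ≤ M)
    (hp : ‖p‖ ≤ R) (hφ : HasFDerivAt φ (jet p a) (x₀, l₀)) (hVφ : V x₀ l₀ = φ (x₀, l₀))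
    (hle : ∀ x l, 0 < l → φ (x, l) ≤ V x l)
    (hcmp : ∀ η : ℝ, 0 < η → ∃ ε > 0, ε ≤ η ∧ ∃ h₀ > 0, h₀ < l₀ ∧ ∀ h, 0 < h → h ≤ h₀ →
      ∃ y, ‖x₀ - y‖ ≤ 2 * (h * t₀) * M ∧ V y (l₀ - h)
        + kernel (regularized F ε) R (x₀, y, h * t₀, V y (l₀ - h)) ≤ V x₀ l₀ + η * h) :
    0 ≤ a + t₀ * F x₀ p (φ (x₀, l₀)) := by
  have hR : 0 ≤ R := (norm_nonneg p).trans hp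
  set u := φ (x₀, l₀) with hu
  set b := 2 * t₀ * M + 1 with hb
  have hb0 : 0 < b := by positivity
  set c := b + t₀ * (1 + R ^ 2 / 2) + 1 with hc
  have hc0 : 0 < c := by positivity
  refine le_of_forall_pos_le_add fun η' hη' => ?_
  set η := η' / c with hη
  have hη0 : 0 < η := by positivity
  have hηc : η * c = η' := by rw [hη]; field_simp
  rw [← hηc]
  obtain ⟨ε, hε, hεη, h₀, hh₀, hhl, hk⟩ := hcmp η hη0
  have hcont : ContinuousAt (fun z : Rn n × ℝ => F z.1 p (φ z)) (x₀, l₀) := by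
    have h1 : ContinuousAt (fun z : Rn n × ℝ => (z.1, p, φ z)) (x₀, l₀) :=
      continuousAt_fst.prodMk (continuousAt_const.prodMk hφ.continuousAt)
    exact ContinuousAt.comp (g := fun z : Rn n × Rn n × ℝ => F z.1 z.2.1 z.2.2)
      hF.continuous.continuousAt h1
  have hnear : ∀ᶠ z : Rn n × ℝ in 𝓝 (x₀, l₀), F z.1 p (φ z) < F x₀ p u + η :=
    hcont.eventually (gt_mem_nhds (by simpa [hu] using hη0))
  obtain ⟨δ, hδ, hball⟩ := Metric.eventually_nhds_iff.1 (hnear.and (hφ.subJet η hη0))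
  have hsmall : ∀ᶠ h : ℝ in 𝓝[>] 0, h * t₀ * C < 1 ∧ h * b < δ := by
    have h1 : Continuous fun h : ℝ => h * t₀ * C := by fun_prop
    have h2 : Continuous fun h : ℝ => h * b := by fun_prop
    exact (((h1.tendsto 0).mono_left nhdsWithin_le_nhds).eventually
      (gt_mem_nhds (by simp))).and
      (((h2.tendsto 0).mono_left nhdsWithin_le_nhds).eventually (gt_mem_nhds (by simpa)))
  obtain ⟨h, ⟨hτ, hhδ⟩, hh0, hhh⟩ := (hsmall.and (Ioc_mem_nhdsGT hh₀)).exists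
  obtain ⟨y, hy, hV⟩ := hk h hh0 hhh
  have hzn : ‖((y, l₀ - h) : Rn n × ℝ) - (x₀, l₀)‖ ≤ h * b := by
    rw [Prod.mk_sub_mk, Prod.norm_mk, norm_sub_rev y x₀, sub_sub_cancel_left, norm_neg,
      Real.norm_eq_abs, abs_of_pos hh0, hb]
    have : 0 ≤ 2 * (h * t₀) * M := by positivity
    exact max_le (by linarith) (by linarith)
  obtain ⟨hF1, hjet⟩ := hball (y := (y, l₀ - h)) (by rw [dist_eq_norm]; exact hzn.trans_lt hhδ)
  have hmono := add_kernel_mono (R := R) (regularized_isC1 (ε := ε) hF).continuous hR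
    (abs_regularized_sub_le hC ε) (mul_nonneg hh0.le ht₀) hτ.le
    (hle y (l₀ - h) (by linarith)) x₀ y
  have hker := le_kernel (R := R) (regularized_isC1 (ε := ε) hF).continuous
    (x₀, y, h * t₀, φ (y, l₀ - h)) (p := p) (by simpa using hp)
  simp only [kernelIntegrand, regularized] at hker hF1
  rw [jet_apply] at hjet
  simp only [Prod.mk_sub_mk, sub_sub_cancel_left] at hjet hzn
  have hxy : (inner ℝ p (x₀ - y) : ℝ) = -inner ℝ p (y - x₀) := by
    rw [← inner_neg_right, neg_sub]
  have hε2 : ε / 2 * ‖p‖ ^ 2 ≤ η / 2 * R ^ 2 := by gcongr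
  have hprod : h * t₀ * (F y p (φ (y, l₀ - h)) + ε / 2 * ‖p‖ ^ 2)
      ≤ h * t₀ * (F x₀ p u + η + η / 2 * R ^ 2) := by
    refine mul_le_mul_of_nonneg_left ?_ (by positivity)
    linarith
  have hη2 := mul_le_mul_of_nonneg_left hzn hη0.le
  have : h * 0 ≤ h * (a + t₀ * F x₀ p u + η * c) := by
    rw [hc]
    linarith
  exact le_of_mul_le_mul_left this hh0

section Main

variable {H F : Hamiltonian n} {u₀ : Rn n → ℝ} {v : Rn n → ℝ → ℝ → ℝ}

theorem isViscositySubsolution_parameter (hH : IsC1 H) (hF : IsC1 F)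
    (hH1 : LocallyBounded H) (hF1 : LocallyBounded F) (hH2 : Superlinear H) (hF2 : Superlinear F)
    (hH4 : LipschitzInU H) (hF4 : LipschitzInU F) (hJ : JacobiCommute H F) (hFc : ConvexInP F)
    (hu₀ : IsLipBUC u₀) (hvLip : ∀ l : ℝ, 0 ≤ l → IsLipschitzOnStrips (fun x t => v x t l))
    (hv : ∀ l : ℝ, 0 ≤ l →
      IsViscositySolution (fun x p u => H x p u + l * F x p u) u₀ (fun x t => v x t l))
    {t : ℝ} (ht : 0 ≤ t) :
    IsViscositySubsolution (fun x p u => t * F x p u) (fun x => v x t 0)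
      (fun x l => v x t l) := by
  refine ⟨fun φ hφ x₀ l₀ hl₀ heq hmax => ?_, fun x => le_rfl⟩
  obtain ⟨⟨K₀, hK₀⟩, -, -⟩ := hu₀
  obtain ⟨C, -, hC⟩ := id hF4
  have hd := hasFDerivAt_jet_of_contDiffOn hφ x₀ hl₀
  have hle : ∀ x l, 0 < l → v x t l ≤ φ (x, l) := by
    intro x l hl
    by_cases hne : (x, l) = (x₀, l₀)
    · obtain ⟨rfl, rfl⟩ := Prod.mk.inj hne
      exact heq.le
    · linarith [hmax x l hl hne]
  rcases ht.eq_or_lt with rfl | ht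
  · have hj : SuperJet (fun z : Rn n × ℝ => v z.1 0 z.2) (x₀, l₀) _ := hd.superJet.mono heq.symm
      ((lt_mem_nhds hl₀).prod_inr_nhds x₀ |>.mono fun z hz => hle z.1 z.2 hz)
    have := hj.apply_le (0, -1) (M := 0) (by
      filter_upwards [Ioc_mem_nhdsGT hl₀] with s hs
      have h1 := (hv l₀ hl₀.le).initial_eq x₀
      have h2 := (hv (l₀ - s) (by linarith [hs.2])).initial_eq x₀
      simp [h1, ← sub_eq_add_neg, h2])
    simpa using this
  · obtain ⟨K, M, hK, -, -, hcmp⟩ := exists_kernel_comparison hH hF hH1 hF1 hH2 hF2 hH4 hF4 hJ hFc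
      hK₀ hvLip hv x₀ ht hl₀
    refine add_mul_le_zero_of_le_kernel hF hFc (hF.abs_sub_le_of_Du_le hC) (R := K + 1) ht.le
      (by positivity) hd heq hle fun η hη => ?_
    obtain ⟨ε, hε, -, h₀, hh₀, hhl, h⟩ := hcmp η hη
    exact ⟨ε, hε, h₀, hh₀, hhl, fun s hs hsh => (h s hs hsh).1⟩

theorem isViscositySupersolution_parameter (hH : IsC1 H) (hF : IsC1 F)
    (hH1 : LocallyBounded H) (hF1 : LocallyBounded F) (hH2 : Superlinear H) (hF2 : Superlinear F)
    (hH4 : LipschitzInU H) (hF4 : LipschitzInU F) (hJ : JacobiCommute H F) (hFc : ConvexInP F)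
    (hHc : ConvexInP H) (hu₀ : IsLipBUC u₀)
    (hvLip : ∀ l : ℝ, 0 ≤ l → IsLipschitzOnStrips (fun x t => v x t l))
    (hv : ∀ l : ℝ, 0 ≤ l →
      IsViscositySolution (fun x p u => H x p u + l * F x p u) u₀ (fun x t => v x t l))
    {t : ℝ} (ht : 0 ≤ t) :
    IsViscositySupersolution (fun x p u => t * F x p u) (fun x => v x t 0)
      (fun x l => v x t l) := by
  refine ⟨fun φ hφ x₀ l₀ hl₀ heq hmin => ?_, fun x => le_rfl⟩
  obtain ⟨⟨K₀, hK₀⟩, -, -⟩ := hu₀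
  obtain ⟨C, -, hC⟩ := id hF4
  have hd := hasFDerivAt_jet_of_contDiffOn hφ x₀ hl₀
  have hle : ∀ x l, 0 < l → φ (x, l) ≤ v x t l := by
    intro x l hl
    by_cases hne : (x, l) = (x₀, l₀)
    · obtain ⟨rfl, rfl⟩ := Prod.mk.inj hne
      exact heq.ge
    · linarith [hmin x l hl hne]
  have hj : SubJet (fun z : Rn n × ℝ => v z.1 t z.2) (x₀, l₀) _ := hd.subJet.mono heq.symm
    ((lt_mem_nhds hl₀).prod_inr_nhds x₀ |>.mono fun z hz => hle z.1 z.2 hz)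
  rcases ht.eq_or_lt with rfl | ht
  · have := hj.apply_le (0, -1) (M := 0) (by
      filter_upwards [Ioc_mem_nhdsGT hl₀] with s hs
      have h1 := (hv l₀ hl₀.le).initial_eq x₀
      have h2 := (hv (l₀ - s) (by linarith [hs.2])).initial_eq x₀
      simp [h1, ← sub_eq_add_neg, h2])
    simpa using this
  · obtain ⟨K, M, hK, hM, hKv, hcmp⟩ := exists_kernel_comparison hH hF hH1 hF1 hH2 hF2 hH4 hF4 hJ
      hFc hK₀ hvLip hv x₀ ht hl₀
    have hp := hj.norm_momentum_le hK hKv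
    refine zero_le_add_mul_of_kernel_le hF (hF.abs_sub_le_of_Du_le hC) (R := K + 1) ht.le hM
      (by linarith) hd heq hle fun η hη => ?_
    obtain ⟨ε, hε, hεη, h₀, hh₀, hhl, h⟩ := hcmp η hη
    exact ⟨ε, hε, hεη, h₀, hh₀, hhl, fun s hs hsh => (h s hs hsh).2 hHc⟩

end Main

end ContactHJ

theorem theorem3 (n : ℕ) (H F : ContactHJ.Hamiltonian n)
    (hH : ContactHJ.IsC1 H) (hF : ContactHJ.IsC1 F)
    (hH1 : ContactHJ.LocallyBounded H) (hF1 : ContactHJ.LocallyBounded F)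
    (hH2 : ContactHJ.Superlinear H) (hF2 : ContactHJ.Superlinear F)
    (hH4 : ContactHJ.LipschitzInU H) (hF4 : ContactHJ.LipschitzInU F)
    (hHF5 : ContactHJ.JacobiCommute H F)
    (u₀ : ContactHJ.Rn n → ℝ) (hu₀ : ContactHJ.IsLipBUC u₀)
    -- `v x t l` is the value at `(x, t)` of the solution with Hamiltonian `H + l F`
    (v : ContactHJ.Rn n → ℝ → ℝ → ℝ)
    (hvLip : ∀ l : ℝ, 0 ≤ l → ContactHJ.IsLipschitzOnStrips (fun x t => v x t l))
    (hv : ∀ l : ℝ, 0 ≤ l →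
      ContactHJ.IsViscositySolution (fun x p u => H x p u + l * F x p u) u₀
        (fun x t => v x t l)) :
    (ContactHJ.ConvexInP F → ∀ t : ℝ, 0 ≤ t →
      ContactHJ.IsViscositySubsolution (fun x p u => t * F x p u) (fun x => v x t 0)
        (fun x l => v x t l)) ∧
    (ContactHJ.ConvexInP F → ContactHJ.ConvexInP H → ∀ t : ℝ, 0 ≤ t →
      ContactHJ.IsViscositySolution (fun x p u => t * F x p u) (fun x => v x t 0)
        (fun x l => v x t l)) := by
  have hsub := fun hFc t (ht : (0 : ℝ) ≤ t) => ContactHJ.isViscositySubsolution_parameter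
    hH hF hH1 hF1 hH2 hF2 hH4 hF4 hHF5 hFc hu₀ hvLip hv ht
  exact ⟨hsub, fun hFc hHc t ht => ⟨hsub hFc t ht, ContactHJ.isViscositySupersolution_parameter
    hH hF hH1 hF1 hH2 hF2 hH4 hF4 hHF5 hFc hHc hu₀ hvLip hv ht⟩⟩
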